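/- Work in the universe $V$ of all sets (a model of ZFC); classes are arbitrary subclasses of $V$. Let $\delta$ be a regular uncountable cardinal. For a transitive class $N$ with $(N,\in)\models\mathrm{ZFC}$ say that * $N$ has the *$\delta$-covering property* iff for every set $\sigma\subseteq N$ with $|\sigma|<\delta$ there is $\tau\in N$ with $|\tau|<\delta$ and $\sigma\subseteq\tau$; * $N$ has the *$\delta$-approximation property* iff for every cardinal $\kappa$ with $\mathrm{cf}(\kappa)\ge\delta$ and every $\subseteq$-increasing sequence $\langle\tau_\alpha\mid\alpha<\kappa\rangle$ (in $V$) of elements of $N$, $\bigcup_{\alpha<\kappa}\tau_\alpha\in N$; * $(\delta^+)^N=\delta^+$ iff the least cardinal of $N$ above $\delta$ is the cardinal successor $\delta^+$ of $\delta$ in $V$. **Theorem.** (1) Let $\delta$ be a regular uncountable cardinal and let $M$ and $N$ be transitive class models of ZFC, both with the $\delta$-covering and $\delta$-approximation properties, such that $(\delta^+)^M=(\delta^+)^N=\delta^+$ and $N\cap\mathcal P(\delta)=M\cap\mathcal P(\delta)$. Then $M=N$. (2) Consequently, such an $N$ is $\Sigma_2$-definable from $N\cap\mathcal P(\delta)$,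 by a formula that does not depend on $\delta$ and $N$. That is, there is a $\Sigma_2$ formula $\varphi(x,a)$ of the Lévy hierarchy in the language $\{\in\}$ such that for every regular uncountable cardinal $\delta$ and every transitive class model $N$ of ZFC with the $\delta$-covering and $\delta$-approximation properties and $(\delta^+)^N=\delta^+$, $$N=\{x\mid V\models\varphi(x,\,N\cap\mathcal P(\delta))\}.$$ -/

import Mathlib

open FirstOrder

universe u

namespace HLW

/-! ### The language of set theory -/

/-- The only symbol of the language of set theory: a binary relation symbol. -/
inductive MemRel : ℕ → Type
  | mem : MemRel 2

/-- The first-order language of set theory, `{∈}`. -/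
def setLang : Language := ⟨fun _ => Empty, MemRel⟩

/-- A class `N` of sets, regarded as the structure `(N, ∈)`. -/
instance classStructure (N : Set ZFSet.{u}) : setLang.Structure N where
  funMap := fun f => nomatch f
  RelMap := fun r => match r with
    | MemRel.mem => fun v => (v 0 : ZFSet.{u}) ∈ (v 1 : ZFSet.{u})

/-- The universe of sets, regarded as the structure `(V, ∈)`. -/
instance universeStructure : setLang.Structure ZFSet.{u} where
  funMap := fun f => nomatch f
  RelMap := fun r => match r with
    | MemRel.mem => fun v => v 0 ∈ v 1

/-- The atomic formula `x ∈ y`. -/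
def memFormula {α : Type} {n : ℕ} (x y : α ⊕ Fin n) : setLang.BoundedFormula α n :=
  Language.BoundedFormula.rel (L := setLang) (l := 2) MemRel.mem
    ![Language.Term.var x, Language.Term.var y]

/-! ### The Lévy hierarchy up to `Σ₂` -/

/-- `Δ₀` formulas: built from atomic formulas with the propositional connectives and the bounded
quantifiers `∀ x ∈ y` and `∃ x ∈ y`. (All connectives are defined from `⊥` and `⟹`. The quantified
variable of a formula in `n + 1` indexed variables is the last one, so the bound `y`, one of the
old variables, is never the quantified variable.) -/
inductive IsDelta0 {α : Type} : {n : ℕ} → setLang.BoundedFormula α n → Prop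
  | falsum {n : ℕ} : IsDelta0 (Language.BoundedFormula.falsum : setLang.BoundedFormula α n)
  | eq {n : ℕ} (x y : α ⊕ Fin n) :
      IsDelta0 (Language.BoundedFormula.equal (L := setLang)
        (Language.Term.var x) (Language.Term.var y))
  | mem {n : ℕ} (x y : α ⊕ Fin n) : IsDelta0 (memFormula x y)
  | imp {n : ℕ} {φ ψ : setLang.BoundedFormula α n} :
      IsDelta0 φ → IsDelta0 ψ → IsDelta0 (φ.imp ψ)
  | ball {n : ℕ} (y : α ⊕ Fin n) {φ : setLang.BoundedFormula α (n + 1)} :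
      IsDelta0 φ →
        IsDelta0 ((memFormula (Sum.inr (Fin.last n)) (Sum.map id Fin.castSucc y)).imp φ).all
  | bex {n : ℕ} (y : α ⊕ Fin n) {φ : setLang.BoundedFormula α (n + 1)} :
      IsDelta0 φ →
        IsDelta0 (memFormula (Sum.inr (Fin.last n)) (Sum.map id Fin.castSucc y) ⊓ φ).ex

/-- `Π₁` formulas: a block of universal quantifiers followed by a `Δ₀` formula. -/
inductive IsPi1 {α : Type} : {n : ℕ} → setLang.BoundedFormula α n → Prop
  | of_delta0 {n : ℕ} {φ : setLang.BoundedFormula α n} : IsDelta0 φ → IsPi1 φ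
  | all {n : ℕ} {φ : setLang.BoundedFormula α (n + 1)} : IsPi1 φ → IsPi1 φ.all

/-- `Σ₂` formulas: a block of existential quantifiers followed by a `Π₁` formula. -/
inductive IsSigma2 {α : Type} : {n : ℕ} → setLang.BoundedFormula α n → Prop
  | of_pi1 {n : ℕ} {φ : setLang.BoundedFormula α n} : IsPi1 φ → IsSigma2 φ
  | ex {n : ℕ} {φ : setLang.BoundedFormula α (n + 1)} : IsSigma2 φ → IsSigma2 φ.ex

/-! ### Transitive class models of ZFC -/

/-- `(N, ∈)` satisfies the axioms of ZFC. All quantifiers range over the elements of `N`, and the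
two schemes range over all first-order formulas evaluated in `(N, ∈)`, with parameters `p` from
`N`. -/
structure ModelsZFC (N : Set ZFSet.{u}) : Prop where
  extensionality : ∀ x y : N, (∀ z : N, z.1 ∈ x.1 ↔ z.1 ∈ y.1) → x = y
  foundation : ∀ x : N, (∃ y : N, y.1 ∈ x.1) →
    ∃ y : N, y.1 ∈ x.1 ∧ ∀ z : N, ¬ (z.1 ∈ x.1 ∧ z.1 ∈ y.1)
  pairing : ∀ x y : N, ∃ z : N, ∀ w : N, w.1 ∈ z.1 ↔ w = x ∨ w = y
  union : ∀ x : N, ∃ z : N, ∀ w : N, w.1 ∈ z.1 ↔ ∃ y : N, y.1 ∈ x.1 ∧ w.1 ∈ y.1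
  powerset : ∀ x : N, ∃ z : N, ∀ w : N, w.1 ∈ z.1 ↔ ∀ y : N, y.1 ∈ w.1 → y.1 ∈ x.1
  infinity : ∃ x : N, (∃ e : N, e.1 ∈ x.1 ∧ ∀ z : N, z.1 ∉ e.1) ∧
    ∀ y : N, y.1 ∈ x.1 → ∃ s : N, s.1 ∈ x.1 ∧ ∀ z : N, z.1 ∈ s.1 ↔ z.1 ∈ y.1 ∨ z = y
  separation : ∀ (k : ℕ) (φ : setLang.BoundedFormula (Fin k) 1) (p : Fin k → N) (a : N),
    ∃ b : N, ∀ x : N, x.1 ∈ b.1 ↔ x.1 ∈ a.1 ∧ φ.Realize p ![x]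
  replacement : ∀ (k : ℕ) (φ : setLang.BoundedFormula (Fin k) 2) (p : Fin k → N) (a : N),
    (∀ x y y' : N, x.1 ∈ a.1 → φ.Realize p ![x, y] → φ.Realize p ![x, y'] → y = y') →
    ∃ b : N, ∀ y : N, y.1 ∈ b.1 ↔ ∃ x : N, x.1 ∈ a.1 ∧ φ.Realize p ![x, y]
  choice : ∀ a : N, (∀ x : N, x.1 ∈ a.1 → ∃ z : N, z.1 ∈ x.1) →
    (∀ x y : N, x.1 ∈ a.1 → y.1 ∈ a.1 → x ≠ y → ∀ z : N, ¬ (z.1 ∈ x.1 ∧ z.1 ∈ y.1)) →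
    ∃ c : N, ∀ x : N, x.1 ∈ a.1 → ∃! z : N, z.1 ∈ x.1 ∧ z.1 ∈ c.1

/-- `N` is a transitive class model of ZFC. -/
structure IsTransitiveModel (N : Set ZFSet.{u}) : Prop where
  transitive : ∀ x ∈ N, ∀ y ∈ x, y ∈ N
  models : ModelsZFC N

/-! ### Covering, approximation, successor cardinals and power sets in `N` -/

/-- The `δ`-covering property. -/
def Covering (δ : Cardinal.{u}) (N : Set ZFSet.{u}) : Prop :=
  ∀ σ : ZFSet.{u}, (∀ x ∈ σ, x ∈ N) → σ.card < δ → ∃ τ ∈ N, τ.card < δ ∧ σ ⊆ τ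

/-- The `δ`-approximation property. The sequence `τ` itself is not required to be in `N`. -/
def Approximation (δ : Cardinal.{u}) (N : Set ZFSet.{u}) : Prop :=
  ∀ κ : Cardinal.{u}, δ ≤ κ.ord.cof → ∀ τ : Set.Iio κ.ord → ZFSet.{u},
    (∀ α, τ α ∈ N) → (∀ α β, α ≤ β → τ α ⊆ τ β) → ZFSet.iUnion τ ∈ N

/-- `f` is (the graph of) a bijection from `x` onto `y`. -/
def IsBijection (x y f : ZFSet.{u}) : Prop :=
  ZFSet.IsFunc x y f ∧ ∀ b ∈ y, ∃! a, ZFSet.pair a b ∈ f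

/-- The ordinal `α` belongs to `N` and is a cardinal of `N`: no element of `N` is a bijection from
a smaller ordinal onto `α`. -/
def IsCardinalIn (N : Set ZFSet.{u}) (α : Ordinal.{u}) : Prop :=
  α.toZFSet ∈ N ∧ ∀ β < α, ∀ f ∈ N, ¬ IsBijection β.toZFSet α.toZFSet f

/-- `(δ⁺)ᴺ = δ⁺`: the least cardinal of `N` above `δ` is the cardinal successor of `δ`. -/
def ComputesSucc (δ : Cardinal.{u}) (N : Set ZFSet.{u}) : Prop :=
  IsLeast {α : Ordinal.{u} | δ.ord < α ∧ IsCardinalIn N α} (Order.succ δ).ord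

/-- The set `N ∩ 𝒫(δ)`. -/
noncomputable def powersetIn (δ : Cardinal.{u}) (N : Set ZFSet.{u}) : ZFSet.{u} :=
  ZFSet.sep (fun x => x ∈ N) δ.ord.toZFSet.powerset

end HLW

/-! The model `N` is recovered from `a = N ∩ 𝒫(δ)` by coding small pieces of relations. Every `x ∈
N` lies in a transitive `t ∈ N`. Enumerating `t` inside `N` along an ordinal `θ` pulls `∈` back to a
relation `A ∈ N` on `θ`, and `x` is a value of the Mostowski collapse of `A`. It remains to express,
in terms of `a`, that a relation `A` on `θ` belongs to `N`.

By `mem_of_forall_inter_mem`, it suffices that `A ∩ τ ∈ N` for all `τ ∈ N` of size below `δ`. A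
certificate therefore contains a family `S` of subsets of `θ` of size below `δ` which is cofinal
among all such subsets. It demands that for each increasing `δ`-sequence `h` from `S`, the union `e`
of the sequence has an enumeration `g` by `δ` for which the pullbacks of `∈` and of `A` to `δ` are
coded, through Gödel pairing, by two elements `r`, `c` of `a`.

Elements of `N` are certified (`certified_of_mem`): let `S` consist of the nonempty small subsets of
`θ` in `N`. The union of a chain is in `N` by approximation and has size at most `δ`. Since `(δ⁺)ᴺ =
δ⁺`, it is enumerated by `δ` inside `N`, so the codes lie in `a`.

Certified sets are in `N` (`mem_of_certified`): the members of `S` need not be in `N`, but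
`exists_chain` interleaves them with small sets of `N`, so that the union `e` is in `N` by
approximation. The code `r` yields a collapse in `N`; matching it with the collapse of `e` puts `g`
into `N` (`graphOn_mem_of_rel`), and then `c` decodes `A` on `e` inside `N`.

Every clause is `Δ₀` in the witnesses, and only `h` is universally quantified, so the definition is
`Σ₂`. Both parts of the theorem follow from `mem_iff_certified`. -/

namespace HLW

open Language

/-! ### Semantic `Δ₀` predicates -/

/-- Assignments with `k` parameters and `n` indexed variables. -/
abbrev Env (k n : ℕ) : Type (u + 1) := (Fin k → ZFSet.{u}) × (Fin n → ZFSet.{u})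

/-- Forget the last indexed variable. -/
def pop {k n : ℕ} (e : Env.{u} k (n + 1)) : Env.{u} k n := (e.1, fun i => e.2 i.castSucc)

/-- The last indexed variable. -/
def top {k n : ℕ} (e : Env.{u} k (n + 1)) : ZFSet.{u} := e.2 (Fin.last n)

/-- A restriction of assignments to some of the indexed variables. -/
class IsProj {k m n : ℕ} (G : Env.{u} k m → Env.{u} k n) : Prop where
  out : ∃ ρ : Fin n → Fin m, ∀ e, G e = (e.1, fun i => e.2 (ρ i))

/-- A function of the assignment that reads off one variable. -/
class IsVar {k n : ℕ} (g : Env.{u} k n → ZFSet.{u}) : Prop where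
  out : ∃ s : Fin k ⊕ Fin n, ∀ e, g e = Sum.elim e.1 e.2 s

instance IsProj.refl {k n : ℕ} : IsProj (fun e : Env.{u} k n => e) := ⟨id, fun _ => rfl⟩

instance IsProj.pop {k m n : ℕ} (G : Env.{u} k m → Env.{u} k (n + 1)) [h : IsProj G] :
    IsProj (fun e => pop (G e)) := by
  obtain ⟨ρ, hρ⟩ := h.out
  exact ⟨fun i => ρ i.castSucc, fun e => by simp [HLW.pop, hρ]⟩

instance IsProj.pop_self {k n : ℕ} : IsProj (HLW.pop : Env.{u} k (n + 1) → Env.{u} k n) :=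
  IsProj.pop fun e => e

instance IsVar.top {k m n : ℕ} (G : Env.{u} k m → Env.{u} k (n + 1)) [h : IsProj G] :
    IsVar (fun e => top (G e)) := by
  obtain ⟨ρ, hρ⟩ := h.out
  exact ⟨Sum.inr (ρ (Fin.last n)), fun e => by simp [HLW.top, hρ]⟩

instance IsVar.top_self {k n : ℕ} : IsVar (HLW.top : Env.{u} k (n + 1) → ZFSet.{u}) :=
  IsVar.top fun e => e

instance IsVar.param {k m n : ℕ} (G : Env.{u} k m → Env.{u} k n) [h : IsProj G] (i : Fin k) :
    IsVar (fun e => (G e).1 i) := by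
  obtain ⟨ρ, hρ⟩ := h.out
  exact ⟨Sum.inl i, fun e => by simp [hρ]⟩

/-- Keeps a variable readable after further quantifiers are opened. Instances whose body contains
bounded quantifiers use it as a local hypothesis, for all lengths `m` at once. -/
theorem IsVar.comp {k n : ℕ} (g : Env.{u} k n → ZFSet.{u}) [h : IsVar g] {m : ℕ}
    (G : Env.{u} k m → Env.{u} k n) [hG : IsProj G] : IsVar (fun e => g (G e)) := by
  obtain ⟨ρ, hρ⟩ := hG.out
  obtain ⟨s, hs⟩ := h.out
  exact ⟨Sum.map id ρ s, fun e => by rw [hs, hρ]; cases s <;> rfl⟩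

/-- The predicate is defined by a `Δ₀` formula. -/
class D0 {k n : ℕ} (P : Env.{u} k n → Prop) : Prop where
  out : ∃ φ : setLang.BoundedFormula (Fin k) n, IsDelta0 φ ∧ ∀ e, φ.Realize e.1 e.2 ↔ P e

theorem realize_memFormula {α : Type} {n : ℕ} (x y : α ⊕ Fin n) (v : α → ZFSet.{u})
    (w : Fin n → ZFSet.{u}) :
    (memFormula x y).Realize v w ↔ Sum.elim v w x ∈ Sum.elim v w y := Iff.rfl

namespace D0

variable {k n : ℕ}

theorem congr {P Q : Env.{u} k n → Prop} (h : D0 P) (hPQ : ∀ e, P e ↔ Q e) : D0 Q := by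
  obtain ⟨φ, h1, h2⟩ := h.out
  exact ⟨φ, h1, fun e => (h2 e).trans (hPQ e)⟩

instance false : D0 (fun _ : Env.{u} k n => False) := ⟨_, .falsum, fun _ => Iff.rfl⟩

instance mem (f g : Env.{u} k n → ZFSet.{u}) [hf : IsVar f] [hg : IsVar g] :
    D0 (fun e => f e ∈ g e) := by
  obtain ⟨s, hs⟩ := hf.out
  obtain ⟨t, ht⟩ := hg.out
  exact ⟨_, .mem s t, fun e => by rw [realize_memFormula, hs, ht]⟩

instance eq (f g : Env.{u} k n → ZFSet.{u}) [hf : IsVar f] [hg : IsVar g] :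
    D0 (fun e => f e = g e) := by
  obtain ⟨s, hs⟩ := hf.out
  obtain ⟨t, ht⟩ := hg.out
  refine ⟨_, .eq s t, fun e => ?_⟩
  rw [hs, ht]
  exact Iff.rfl

instance imp (P Q : Env.{u} k n → Prop) [hP : D0 P] [hQ : D0 Q] :
    D0 (fun e => P e → Q e) := by
  obtain ⟨φ, h1, h2⟩ := hP.out
  obtain ⟨ψ, h3, h4⟩ := hQ.out
  exact ⟨_, .imp h1 h3, fun e => by rw [BoundedFormula.realize_imp, h2, h4]⟩

instance not (P : Env.{u} k n → Prop) [D0 P] : D0 (fun e => ¬ P e) :=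
  congr (imp P fun _ => False) fun _ => Iff.rfl

instance true : D0 (fun _ : Env.{u} k n => True) :=
  congr (not fun _ => False) fun _ => by simp

instance and (P Q : Env.{u} k n → Prop) [D0 P] [D0 Q] : D0 (fun e => P e ∧ Q e) :=
  congr (not fun e => P e → ¬ Q e) fun _ => by tauto

instance or (P Q : Env.{u} k n → Prop) [D0 P] [D0 Q] : D0 (fun e => P e ∨ Q e) :=
  congr (imp (fun e => ¬ P e) Q) fun _ => by tauto

instance iff (P Q : Env.{u} k n → Prop) [D0 P] [D0 Q] : D0 (fun e => P e ↔ Q e) :=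
  congr (and (fun e => P e → Q e) (fun e => Q e → P e)) fun _ => by tauto

theorem pop_snoc (e : Env.{u} k n) (z : ZFSet.{u}) :
    pop (e.1, (Fin.snoc e.2 z : Fin (n + 1) → ZFSet.{u})) = e := by
  simp [pop]

theorem top_snoc (e : Env.{u} k n) (z : ZFSet.{u}) :
    top (e.1, (Fin.snoc e.2 z : Fin (n + 1) → ZFSet.{u})) = z := by
  simp [top]

theorem elim_snoc (e : Env.{u} k n) (z : ZFSet.{u}) (t : Fin k ⊕ Fin n) :
    Sum.elim e.1 (Fin.snoc e.2 z : Fin (n + 1) → ZFSet.{u}) (Sum.map id Fin.castSucc t) =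
      Sum.elim e.1 e.2 t := by
  cases t <;> simp

instance ball (g : Env.{u} k n → ZFSet.{u}) (P : Env.{u} k n → ZFSet.{u} → Prop) [hg : IsVar g]
    [hP : D0 (fun e : Env.{u} k (n + 1) => P (pop e) (top e))] :
    D0 (fun e => ∀ z ∈ g e, P e z) := by
  obtain ⟨t, ht⟩ := hg.out
  obtain ⟨φ, h1, h2⟩ := hP.out
  refine ⟨_, .ball t h1, fun e => ?_⟩
  rw [BoundedFormula.realize_all]
  refine forall_congr' fun z => ?_
  have h3 := h2 (e.1, Fin.snoc e.2 z)
  rw [pop_snoc, top_snoc] at h3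
  rw [BoundedFormula.realize_imp, realize_memFormula, elim_snoc, h3, ht]
  simp

instance bex (g : Env.{u} k n → ZFSet.{u}) (P : Env.{u} k n → ZFSet.{u} → Prop) [hg : IsVar g]
    [hP : D0 (fun e : Env.{u} k (n + 1) => P (pop e) (top e))] :
    D0 (fun e => ∃ z ∈ g e, P e z) :=
  congr (not fun e => ∀ z ∈ g e, ¬ P e z) fun _ => by push Not; rfl

instance subset (f g : Env.{u} k n → ZFSet.{u}) [IsVar f] [IsVar g] :
    D0 (fun e => f e ⊆ g e) :=
  have := fun m => IsVar.comp (m := m) g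
  congr (ball f fun e z => z ∈ g e) fun _ => Iff.rfl

/-- A Kuratowski pair is recognised with bounded quantifiers: every member contains `g` and lies
within `{g, h}`, one member has no element but `g`, and one contains `h`. -/
instance eq_pair (f g h : Env.{u} k n → ZFSet.{u}) [IsVar f] [IsVar g] [IsVar h] :
    D0 (fun e => f e = ZFSet.pair (g e) (h e)) := by
  have := fun m => IsVar.comp (m := m) g
  have := fun m => IsVar.comp (m := m) h
  have : D0 (fun e => (∀ w ∈ f e, (∀ z ∈ w, z = g e ∨ z = h e) ∧ g e ∈ w) ∧
      (∃ w ∈ f e, ∀ z ∈ w, z = g e) ∧ (∃ w ∈ f e, h e ∈ w)) := inferInstance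
  refine this.congr fun e => ⟨fun ⟨h1, ⟨w, h2, h3⟩, ⟨w', h4, h5⟩⟩ => ?_, fun H => ?_⟩
  · have hw : w = {g e} := by
      ext z; simp only [ZFSet.mem_singleton]
      exact ⟨h3 z, fun hz => hz ▸ (h1 w h2).2⟩
    have hw' : w' = {g e, h e} := by
      ext z; simp only [ZFSet.mem_pair]
      exact ⟨(h1 w' h4).1 z, by rintro (rfl | rfl); exacts [(h1 w' h4).2, h5]⟩
    ext v
    simp only [ZFSet.pair, ZFSet.mem_pair]
    refine ⟨fun hv => ?_, by rintro (rfl | rfl); exacts [hw ▸ h2, hw' ▸ h4]⟩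
    obtain ⟨h6, h7⟩ := h1 v hv
    by_cases h8 : h e ∈ v
    · right; ext z; simp only [ZFSet.mem_pair]
      exact ⟨h6 z, by rintro (rfl | rfl); exacts [h7, h8]⟩
    · left; ext z; simp only [ZFSet.mem_singleton]
      exact ⟨fun hz => (h6 z hz).resolve_right (fun h9 => h8 (h9 ▸ hz)), fun hz => hz ▸ h7⟩
  · rw [H]
    simp only [ZFSet.pair, ZFSet.mem_pair]
    refine ⟨?_, ⟨_, Or.inl rfl, by simp⟩, ⟨_, Or.inr rfl, by simp⟩⟩
    rintro w (rfl | rfl) <;> simp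

instance pair_mem (g h f : Env.{u} k n → ZFSet.{u}) [IsVar f] [IsVar g] [IsVar h] :
    D0 (fun e => ZFSet.pair (g e) (h e) ∈ f e) :=
  have := fun m => IsVar.comp (m := m) g
  have := fun m => IsVar.comp (m := m) h
  congr (bex f fun e z => z = ZFSet.pair (g e) (h e)) fun _ => by simp

end D0

/-- Substitution of variables, needed to use a `Δ₀` predicate below quantifiers that are not its
own. Under a quantifier the renaming is extended to send the new last variable to the new last
variable. -/
theorem IsDelta0.rename {α : Type} {n : ℕ} {φ : setLang.BoundedFormula α n} (h : IsDelta0 φ) :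
    ∀ {m : ℕ} (ρ : Fin n → Fin m), ∃ ψ : setLang.BoundedFormula α m, IsDelta0 ψ ∧
      ∀ (v : α → ZFSet.{u}) (w : Fin m → ZFSet.{u}), ψ.Realize v w ↔ φ.Realize v (w ∘ ρ) := by
  have elim_map : ∀ {n m : ℕ} (ρ : Fin n → Fin m) (v : α → ZFSet.{u}) (w : Fin m → ZFSet.{u}) x,
      Sum.elim v w (Sum.map id ρ x) = Sum.elim v (w ∘ ρ) x := by
    intro n m ρ v w x; cases x <;> rfl
  have snoc_comp : ∀ {n m : ℕ} (ρ : Fin n → Fin m) (w : Fin m → ZFSet.{u}) (z : ZFSet.{u}),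
      (Fin.snoc w z : Fin (m + 1) → ZFSet.{u}) ∘
        (Fin.snoc (fun i => (ρ i).castSucc) (Fin.last m) : Fin (n + 1) → Fin (m + 1)) =
      (Fin.snoc (w ∘ ρ) z : Fin (n + 1) → ZFSet.{u}) := by
    intro n m ρ w z
    funext i
    refine Fin.lastCases ?_ (fun i => ?_) i <;> simp
  have elim_snoc : ∀ {n : ℕ} (v : α → ZFSet.{u}) (w : Fin n → ZFSet.{u}) (z : ZFSet.{u})
      (t : α ⊕ Fin n), Sum.elim v (Fin.snoc w z : Fin (n + 1) → ZFSet.{u})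
        (Sum.map id Fin.castSucc t) = Sum.elim v w t := by
    intro n v w z t; cases t <;> simp
  induction h with
  | falsum => exact fun ρ => ⟨_, .falsum, fun _ _ => Iff.rfl⟩
  | eq x y =>
    refine fun {m} ρ => ⟨_, .eq (Sum.map id ρ x) (Sum.map id ρ y), fun v w => ?_⟩
    change Sum.elim v w _ = Sum.elim v w _ ↔ Sum.elim v _ x = Sum.elim v _ y
    rw [elim_map, elim_map]
  | mem x y =>
    refine fun {m} ρ => ⟨_, .mem (Sum.map id ρ x) (Sum.map id ρ y), fun v w => ?_⟩
    rw [realize_memFormula, realize_memFormula, elim_map, elim_map]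
  | imp _ _ h1 h2 =>
    intro m ρ
    obtain ⟨ψ, h3, h4⟩ := h1 ρ
    obtain ⟨χ, h5, h6⟩ := h2 ρ
    exact ⟨_, .imp h3 h5, fun v w => by simp only [BoundedFormula.realize_imp, h4, h6]⟩
  | ball y _ h1 =>
    intro m ρ
    obtain ⟨ψ, h3, h4⟩ := h1 (Fin.snoc (fun i => (ρ i).castSucc) (Fin.last m))
    refine ⟨_, .ball (Sum.map id ρ y) h3, fun v w => ?_⟩
    simp only [BoundedFormula.realize_all, BoundedFormula.realize_imp, h4, snoc_comp,
      realize_memFormula, elim_snoc, elim_map]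
    simp
  | bex y _ h1 =>
    intro m ρ
    obtain ⟨ψ, h3, h4⟩ := h1 (Fin.snoc (fun i => (ρ i).castSucc) (Fin.last m))
    refine ⟨_, .bex (Sum.map id ρ y) h3, fun v w => ?_⟩
    simp only [BoundedFormula.realize_ex, BoundedFormula.realize_inf, h4, snoc_comp,
      realize_memFormula, elim_snoc, elim_map]
    simp

namespace D0

variable {k n : ℕ}

theorem comp {m : ℕ} {P : Env.{u} k n → Prop} (hP : D0 P) (G : Env.{u} k m → Env.{u} k n)
    [hG : IsProj G] : D0 (fun e => P (G e)) := by
  obtain ⟨φ, h1, h2⟩ := hP.out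
  obtain ⟨ρ, hρ⟩ := hG.out
  obtain ⟨ψ, h3, h4⟩ := h1.rename.{u} ρ
  exact ⟨ψ, h3, fun e => by rw [h4, hρ, ← h2]; rfl⟩

theorem comp_top {m : ℕ} {P : Env.{u} k n → ZFSet.{u} → Prop}
    (hP : D0 (fun e : Env.{u} k (n + 1) => P (pop e) (top e)))
    (G : Env.{u} k m → Env.{u} k n) [hG : IsProj G] :
    D0 (fun e : Env.{u} k (m + 1) => P (G (pop e)) (top e)) := by
  obtain ⟨ρ, hρ⟩ := hG.out
  let ρ' : Fin (n + 1) → Fin (m + 1) := Fin.snoc (fun i => (ρ i).castSucc) (Fin.last m)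
  have : IsProj (fun e : Env.{u} k (m + 1) => ((e.1, fun i => e.2 (ρ' i)) : Env.{u} k (n + 1))) :=
    ⟨ρ', fun e => rfl⟩
  refine (comp hP (fun e : Env.{u} k (m + 1) => (e.1, fun i => e.2 (ρ' i)))).congr fun e => ?_
  have h1 : pop ((e.1, fun i => e.2 (ρ' i)) : Env.{u} k (n + 1)) = G (pop e) := by
    rw [hρ]; simp [pop, ρ']
  have h2 : top ((e.1, fun i => e.2 (ρ' i)) : Env.{u} k (n + 1)) = top e := by
    simp [top, ρ']
  rw [h1, h2]

/-- The quantifier over second coordinates is really bounded, because `z` belongs to `{g, z}`, which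
belongs to the pair, which belongs to `f`. -/
instance ex_pair_mem (g f : Env.{u} k n → ZFSet.{u}) (P : Env.{u} k n → ZFSet.{u} → Prop)
    [IsVar f] [IsVar g] [hP : D0 (fun e : Env.{u} k (n + 1) => P (pop e) (top e))] :
    D0 (fun e => ∃ z, ZFSet.pair (g e) z ∈ f e ∧ P e z) := by
  have := fun m => IsVar.comp (m := m) g
  have := comp_top hP (fun e : Env.{u} k (n + 2) => pop (pop e))
  have : D0 (fun e => ∃ w ∈ f e, ∃ v ∈ w, ∃ z ∈ v, w = ZFSet.pair (g e) z ∧ P e z) :=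
    inferInstance
  refine this.congr fun e => ⟨?_, ?_⟩
  · rintro ⟨w, h1, v, h2, z, h3, rfl, h4⟩
    exact ⟨z, h1, h4⟩
  · rintro ⟨z, h1, h2⟩
    exact ⟨_, h1, {g e, z}, by simp [ZFSet.pair], z, by simp, rfl, h2⟩

instance all_pair_mem (g f : Env.{u} k n → ZFSet.{u}) (P : Env.{u} k n → ZFSet.{u} → Prop)
    [IsVar f] [IsVar g] [hP : D0 (fun e : Env.{u} k (n + 1) => P (pop e) (top e))] :
    D0 (fun e => ∀ z, ZFSet.pair (g e) z ∈ f e → P e z) :=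
  congr (not fun e => ∃ z, ZFSet.pair (g e) z ∈ f e ∧ ¬ P e z) fun _ => by push Not; rfl

end D0

/-! ### Definability over a class -/

/-- The predicate is first-order definable over the structure `(N, ∈)`. -/
def Dfn (N : Set ZFSet.{u}) {k n : ℕ} (P : Env.{u} k n → Prop) : Prop :=
  ∃ φ : setLang.BoundedFormula (Fin k) n, ∀ (v : Fin k → N) (w : Fin n → N),
    φ.Realize v w ↔ P (fun i => v i, fun i => w i)

/-- Absoluteness of `Δ₀` formulas: a witness bounded by an element of `N` is itself in `N` by
transitivity. -/
theorem IsDelta0.realize_iff {N : Set ZFSet.{u}} (hN : ∀ x ∈ N, ∀ y ∈ x, y ∈ N) {α : Type} {n : ℕ}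
    {φ : setLang.BoundedFormula α n} (h : IsDelta0 φ) (v : α → N) (w : Fin n → N) :
    φ.Realize v w ↔ φ.Realize (fun i => (v i : ZFSet.{u})) (fun i => (w i : ZFSet.{u})) := by
  have elim_coe : ∀ {n : ℕ} (w : Fin n → N) x, ((Sum.elim v w x : N) : ZFSet.{u}) =
      Sum.elim (fun i => (v i : ZFSet.{u})) (fun i => (w i : ZFSet.{u})) x := by
    intro n w x; cases x <;> rfl
  have snoc_coe : ∀ {n : ℕ} (w : Fin n → N) (z : N),
      (fun i => ((Fin.snoc w z : Fin (n + 1) → N) i : ZFSet.{u})) =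
      (Fin.snoc (fun i => (w i : ZFSet.{u})) (z : ZFSet.{u}) : Fin (n + 1) → ZFSet.{u}) := by
    intro n w z
    funext i
    refine Fin.lastCases ?_ (fun i => ?_) i <;> simp
  have hmem : ∀ {n : ℕ} (w : Fin n → N) (x y : α ⊕ Fin n), (memFormula x y).Realize v w ↔
      ((Sum.elim v w x : N) : ZFSet.{u}) ∈ ((Sum.elim v w y : N) : ZFSet.{u}) :=
    fun w x y => Iff.rfl
  have elim_snoc : ∀ {n : ℕ} (w : Fin n → N) (z : N)
      (t : α ⊕ Fin n), Sum.elim v (Fin.snoc w z : Fin (n + 1) → N)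
        (Sum.map id Fin.castSucc t) = Sum.elim v w t := by
    intro n w z t; cases t <;> simp
  have elim_snoc' : ∀ {n : ℕ} (v : α → ZFSet.{u}) (w : Fin n → ZFSet.{u}) (z : ZFSet.{u})
      (t : α ⊕ Fin n), Sum.elim v (Fin.snoc w z : Fin (n + 1) → ZFSet.{u})
        (Sum.map id Fin.castSucc t) = Sum.elim v w t := by
    intro n v w z t; cases t <;> simp
  induction h with
  | falsum => exact Iff.rfl
  | eq x y =>
    change Sum.elim v w x = Sum.elim v w y ↔ Sum.elim _ _ x = Sum.elim _ _ y
    rw [← elim_coe, ← elim_coe, Subtype.coe_inj]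
  | mem x y => rw [realize_memFormula, hmem, elim_coe, elim_coe]
  | imp _ _ h1 h2 => simp only [BoundedFormula.realize_imp, h1, h2]
  | ball y _ h1 =>
    simp only [BoundedFormula.realize_all, BoundedFormula.realize_imp, h1, snoc_coe,
      realize_memFormula, hmem, elim_snoc, elim_snoc', elim_coe]
    simp only [Sum.elim_inr, Fin.snoc_last]
    refine ⟨fun h z hz => h ⟨z, ?_⟩ hz, fun h z hz => h z hz⟩
    rw [← elim_coe] at hz
    exact hN _ (Subtype.coe_prop _) _ hz
  | bex y _ h1 =>
    simp only [BoundedFormula.realize_ex, BoundedFormula.realize_inf, h1, snoc_coe,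
      realize_memFormula, hmem, elim_snoc, elim_snoc', elim_coe]
    simp only [Sum.elim_inr, Fin.snoc_last]
    refine ⟨fun ⟨z, h⟩ => ⟨z, h⟩, fun ⟨z, hz, h⟩ => ⟨⟨z, ?_⟩, hz, h⟩⟩
    rw [← elim_coe] at hz
    exact hN _ (Subtype.coe_prop _) _ hz

theorem D0.dfn {N : Set ZFSet.{u}} (hN : IsTransitiveModel N) {k n : ℕ} {P : Env.{u} k n → Prop}
    (h : D0 P) : Dfn N P := by
  obtain ⟨φ, h1, h2⟩ := h.out
  exact ⟨φ, fun v w => (h1.realize_iff hN.transitive v w).trans (h2 (fun i => v i, fun i => w i))⟩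

namespace Dfn

variable {N : Set ZFSet.{u}} {k n : ℕ}

theorem and {P Q : Env.{u} k n → Prop} (hP : Dfn N P) (hQ : Dfn N Q) :
    Dfn N (fun e => P e ∧ Q e) := by
  obtain ⟨φ, h⟩ := hP
  obtain ⟨ψ, h'⟩ := hQ
  exact ⟨φ ⊓ ψ, fun v w => by rw [BoundedFormula.realize_inf, h, h']⟩

theorem ex {P : Env.{u} k n → ZFSet.{u} → Prop}
    (h : Dfn N (fun e : Env.{u} k (n + 1) => P (pop e) (top e))) :
    Dfn N (fun e => ∃ z ∈ N, P e z) := by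
  obtain ⟨φ, h⟩ := h
  refine ⟨φ.ex, fun v w => ?_⟩
  rw [BoundedFormula.realize_ex]
  simp only [h, pop, top, Fin.snoc_castSucc, Fin.snoc_last, Subtype.exists, exists_prop]

theorem all {P : Env.{u} k n → ZFSet.{u} → Prop}
    (h : Dfn N (fun e : Env.{u} k (n + 1) => P (pop e) (top e))) :
    Dfn N (fun e => ∀ z ∈ N, P e z) := by
  obtain ⟨φ, h⟩ := h
  refine ⟨φ.all, fun v w => ?_⟩
  rw [BoundedFormula.realize_all]
  simp only [h, pop, top, Fin.snoc_castSucc, Fin.snoc_last, Subtype.forall]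

end Dfn

/-! ### Closure properties of transitive models -/

namespace IsTransitiveModel

variable {N : Set ZFSet.{u}}

theorem mem_of_mem (hN : IsTransitiveModel N) {x y : ZFSet.{u}} (hx : x ∈ N) (hy : y ∈ x) : y ∈ N :=
  hN.transitive x hx y hy

theorem sep_mem_of_dfn (hN : IsTransitiveModel N) {k : ℕ} {P : Env.{u} k 1 → Prop} (hP : Dfn N P)
    (p : Fin k → ZFSet.{u}) (hp : ∀ i, p i ∈ N) {a : ZFSet.{u}} (ha : a ∈ N) :
    ZFSet.sep (fun x => P (p, ![x])) a ∈ N := by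
  obtain ⟨φ, hφ⟩ := hP
  obtain ⟨b, hb⟩ := hN.models.separation k φ (fun i => ⟨p i, hp i⟩) ⟨a, ha⟩
  convert b.2
  ext x
  rw [ZFSet.mem_sep]
  have key : ∀ x : N, P (p, ![(x : ZFSet.{u})]) ↔ φ.Realize (fun i => (⟨p i, hp i⟩ : N)) ![x] := by
    intro x
    rw [hφ]
    have : (fun i => ((![x] : Fin 1 → N) i : ZFSet.{u})) = ![(x : ZFSet.{u})] := by
      funext i; fin_cases i; rfl
    rw [this]
  constructor
  · rintro ⟨h1, h2⟩
    exact (hb ⟨x, hN.mem_of_mem ha h1⟩).2 ⟨h1, (key _).1 h2⟩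
  · intro h
    obtain ⟨h1, h2⟩ := (hb ⟨x, hN.mem_of_mem b.2 h⟩).1 h
    exact ⟨h1, (key _).2 h2⟩

theorem sep_mem (hN : IsTransitiveModel N) {k : ℕ} (P : Env.{u} k 1 → Prop) [hP : D0 P]
    (p : Fin k → ZFSet.{u}) (hp : ∀ i, p i ∈ N) {a : ZFSet.{u}} (ha : a ∈ N) :
    ZFSet.sep (fun x => P (p, ![x])) a ∈ N :=
  hN.sep_mem_of_dfn (hP.dfn hN) p hp ha

theorem exists_replacement (hN : IsTransitiveModel N) {k : ℕ} {P : Env.{u} k 2 → Prop}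
    (hP : Dfn N P) (p : Fin k → ZFSet.{u}) (hp : ∀ i, p i ∈ N) {a : ZFSet.{u}} (ha : a ∈ N)
    (hf : ∀ x ∈ a, ∀ y ∈ N, ∀ y' ∈ N, P (p, ![x, y]) → P (p, ![x, y']) → y = y') :
    ∃ b ∈ N, ∀ y, y ∈ b ↔ y ∈ N ∧ ∃ x ∈ a, P (p, ![x, y]) := by
  obtain ⟨φ, hφ⟩ := hP
  have key : ∀ x y : N, P (p, ![(x : ZFSet.{u}), (y : ZFSet.{u})]) ↔
      φ.Realize (fun i => (⟨p i, hp i⟩ : N)) ![x, y] := by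
    intro x y
    rw [hφ]
    have : (fun i => ((![x, y] : Fin 2 → N) i : ZFSet.{u})) =
        ![(x : ZFSet.{u}), (y : ZFSet.{u})] := by
      funext i; fin_cases i <;> rfl
    rw [this]
  obtain ⟨b, hb⟩ := hN.models.replacement k φ (fun i => ⟨p i, hp i⟩) ⟨a, ha⟩ (by
    intro x y y' hx h1 h2
    exact Subtype.ext (hf x hx y y.2 y' y'.2 ((key _ _).2 h1) ((key _ _).2 h2)))
  refine ⟨b, b.2, fun y => ⟨fun hy => ?_, ?_⟩⟩
  · have hyN := hN.mem_of_mem b.2 hy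
    obtain ⟨x, h1, h2⟩ := (hb ⟨y, hyN⟩).1 hy
    exact ⟨hyN, x, h1, (key x ⟨y, hyN⟩).2 h2⟩
  · rintro ⟨hyN, x, h1, h2⟩
    exact (hb ⟨y, hyN⟩).2 ⟨⟨x, hN.mem_of_mem ha h1⟩, h1,
      (key ⟨x, hN.mem_of_mem ha h1⟩ ⟨y, hyN⟩).1 h2⟩

theorem upair_mem (hN : IsTransitiveModel N) {x y : ZFSet.{u}} (hx : x ∈ N) (hy : y ∈ N) :
    ({x, y} : ZFSet.{u}) ∈ N := by
  obtain ⟨z, hz⟩ := hN.models.pairing ⟨x, hx⟩ ⟨y, hy⟩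
  convert z.2
  ext w
  rw [ZFSet.mem_pair]
  constructor
  · rintro (rfl | rfl)
    exacts [(hz ⟨w, hx⟩).2 (Or.inl rfl), (hz ⟨w, hy⟩).2 (Or.inr rfl)]
  · intro hw
    simpa using (hz ⟨w, hN.mem_of_mem z.2 hw⟩).1 hw

theorem singleton_mem (hN : IsTransitiveModel N) {x : ZFSet.{u}} (hx : x ∈ N) :
    ({x} : ZFSet.{u}) ∈ N := by
  simpa using hN.upair_mem hx hx

theorem pair_mem (hN : IsTransitiveModel N) {x y : ZFSet.{u}} (hx : x ∈ N) (hy : y ∈ N) :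
    ZFSet.pair x y ∈ N :=
  hN.upair_mem (hN.singleton_mem hx) (hN.upair_mem hx hy)

theorem of_pair_mem (hN : IsTransitiveModel N) {x y : ZFSet.{u}} (h : ZFSet.pair x y ∈ N) :
    x ∈ N ∧ y ∈ N := by
  have : ({x, y} : ZFSet.{u}) ∈ N := hN.mem_of_mem h (by simp [ZFSet.pair])
  exact ⟨hN.mem_of_mem this (by simp), hN.mem_of_mem this (by simp)⟩

theorem sUnion_mem (hN : IsTransitiveModel N) {x : ZFSet.{u}} (hx : x ∈ N) :
    ZFSet.sUnion x ∈ N := by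
  obtain ⟨z, hz⟩ := hN.models.union ⟨x, hx⟩
  convert z.2
  ext w
  rw [ZFSet.mem_sUnion]
  constructor
  · rintro ⟨y, h1, h2⟩
    exact (hz ⟨w, hN.mem_of_mem (hN.mem_of_mem hx h1) h2⟩).2
      ⟨⟨y, hN.mem_of_mem hx h1⟩, h1, h2⟩
  · intro hw
    obtain ⟨y, h1, h2⟩ := (hz ⟨w, hN.mem_of_mem z.2 hw⟩).1 hw
    exact ⟨y, h1, h2⟩

theorem union_mem (hN : IsTransitiveModel N) {x y : ZFSet.{u}} (hx : x ∈ N) (hy : y ∈ N) :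
    x ∪ y ∈ N := by
  simpa using hN.sUnion_mem (hN.upair_mem hx hy)

theorem insert_mem (hN : IsTransitiveModel N) {x y : ZFSet.{u}} (hx : x ∈ N) (hy : y ∈ N) :
    insert x y ∈ N := by
  rw [ZFSet.insert_eq]
  exact hN.union_mem (hN.singleton_mem hx) hy

theorem inter_mem (hN : IsTransitiveModel N) {x y : ZFSet.{u}} (hx : x ∈ N) (hy : y ∈ N) :
    x ∩ y ∈ N :=
  hN.sep_mem (k := 1) (fun e => top e ∈ e.1 0) ![y] (by simp [hy]) hx

/-- The power set of `x` in `N`. -/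
theorem exists_powerset (hN : IsTransitiveModel N) {x : ZFSet.{u}} (hx : x ∈ N) :
    ∃ z ∈ N, ∀ w, w ∈ z ↔ w ∈ N ∧ w ⊆ x := by
  obtain ⟨z, hz⟩ := hN.models.powerset ⟨x, hx⟩
  refine ⟨z, z.2, fun w => ⟨fun hw => ?_, fun ⟨h1, h2⟩ => ?_⟩⟩
  · have hwN := hN.mem_of_mem z.2 hw
    exact ⟨hwN, fun y hy => (hz ⟨w, hwN⟩).1 hw ⟨y, hN.mem_of_mem hwN hy⟩ hy⟩
  · exact (hz ⟨w, h1⟩).2 fun y hy => h2 hy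

theorem prod_mem (hN : IsTransitiveModel N) {x y : ZFSet.{u}} (hx : x ∈ N) (hy : y ∈ N) :
    ZFSet.prod x y ∈ N := by
  obtain ⟨P, hP, hP'⟩ := hN.exists_powerset (hN.union_mem hx hy)
  obtain ⟨Q, hQ, hQ'⟩ := hN.exists_powerset hP
  convert hN.sep_mem (k := 2) (fun e => ∃ a ∈ e.1 0, ∃ b ∈ e.1 1, top e = ZFSet.pair a b) ![x, y]
    (by simp [Fin.forall_fin_two, hx, hy]) hQ using 1
  ext w
  rw [ZFSet.mem_sep, ZFSet.mem_prod]
  refine ⟨fun h => ⟨?_, h⟩, fun h => h.2⟩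
  obtain ⟨a, ha, b, hb, rfl⟩ := h
  have haN := hN.mem_of_mem hx ha
  have hbN := hN.mem_of_mem hy hb
  refine (hQ' _).2 ⟨hN.pair_mem haN hbN, fun v hv => (hP' _).2 ?_⟩
  simp only [ZFSet.pair, ZFSet.mem_pair] at hv
  rcases hv with rfl | rfl
  · refine ⟨hN.singleton_mem haN, fun z hz => ?_⟩
    simp only [ZFSet.mem_singleton] at hz
    simp [hz, ha]
  · refine ⟨hN.upair_mem haN hbN, fun z hz => ?_⟩
    simp only [ZFSet.mem_pair] at hz
    rcases hz with rfl | rfl <;> simp [ha, hb]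

end IsTransitiveModel

/-- The graph of `F` restricted to the set `s`. -/
noncomputable def graphOn (F : ZFSet.{u} → ZFSet.{u}) (s : ZFSet.{u}) : ZFSet.{u} :=
  ZFSet.range (fun b : s => ZFSet.pair b (F b))

theorem mem_graphOn {F : ZFSet.{u} → ZFSet.{u}} {s w : ZFSet.{u}} :
    w ∈ graphOn F s ↔ ∃ b ∈ s, w = ZFSet.pair b (F b) := by
  simp [graphOn, eq_comm]

theorem pair_mem_graphOn {F : ZFSet.{u} → ZFSet.{u}} {s b y : ZFSet.{u}} :
    ZFSet.pair b y ∈ graphOn F s ↔ b ∈ s ∧ y = F b := by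
  rw [mem_graphOn]
  constructor
  · rintro ⟨c, h1, h2⟩
    obtain ⟨rfl, rfl⟩ := ZFSet.pair_inj.1 h2
    exact ⟨h1, rfl⟩
  · rintro ⟨h1, rfl⟩
    exact ⟨b, h1, rfl⟩

theorem mem_sUnion_sUnion_of_pair_mem {f a b : ZFSet.{u}} (h : ZFSet.pair a b ∈ f) :
    b ∈ ZFSet.sUnion (ZFSet.sUnion f) := by
  rw [ZFSet.mem_sUnion]
  exact ⟨{a, b}, ZFSet.mem_sUnion.2 ⟨_, h, by simp [ZFSet.pair]⟩, by simp⟩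

instance D0.isTransitive {k n : ℕ} (f : Env.{u} k n → ZFSet.{u}) [IsVar f] :
    D0 (fun e => (f e).IsTransitive) :=
  have := fun m => IsVar.comp (m := m) f
  D0.congr (D0.ball f fun e z => z ⊆ f e) fun _ => Iff.rfl

theorem D0.ex_eq_pair {k n : ℕ} (f g : Env.{u} k n → ZFSet.{u}) [IsVar f] [IsVar g] :
    D0 (fun e => ∃ z, f e = ZFSet.pair (g e) z) := by
  have := fun m => IsVar.comp (m := m) f
  have := fun m => IsVar.comp (m := m) g
  have : D0 (fun e => ∃ v ∈ f e, ∃ z ∈ v, f e = ZFSet.pair (g e) z) := inferInstance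
  refine this.congr fun e => ⟨?_, ?_⟩
  · rintro ⟨v, -, z, -, h⟩
    exact ⟨z, h⟩
  · rintro ⟨z, h⟩
    exact ⟨{g e, z}, by simp [h, ZFSet.pair], z, by simp, h⟩

instance IsProj.last {k n : ℕ} :
    IsProj (fun e : Env.{u} k (n + 1) => ((e.1, ![top e]) : Env.{u} k 1)) :=
  ⟨fun _ => Fin.last n, fun e => by
    refine Prod.ext rfl (funext fun i => ?_)
    fin_cases i; rfl⟩

/-! ### Recursion, Mostowski collapse and transitive closure inside a model -/

namespace IsTransitiveModel

variable {N : Set ZFSet.{u}}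

/-- Recursion inside a transitive model: a function all of whose partial computations are
recognised by a `Δ₀` predicate, and whose computations can always be prolonged, lies in `N`. -/
theorem graphOn_mem_of_computations (hN : IsTransitiveModel N) {k : ℕ} (P : Env.{u} k 1 → Prop)
    [hP : D0 P] (p : Fin k → ZFSet.{u}) (hp : ∀ i, p i ∈ N) {s : ZFSet.{u}} (hs : s ∈ N)
    (F : ZFSet.{u} → ZFSet.{u})
    (h1 : ∀ g ∈ N, P (p, ![g]) → ∀ w ∈ g, ∃ b ∈ s, w = ZFSet.pair b (F b))
    (h2 : ∀ S ∈ N, S ⊆ s → S ≠ s → graphOn F S ∈ N →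
      (∀ b ∈ S, ∃ g ∈ N, P (p, ![g]) ∧ ZFSet.pair b (F b) ∈ g) →
      (∀ g ∈ N, P (p, ![g]) → ∀ b z, ZFSet.pair b z ∈ g → b ∈ S) →
      ∃ b ∈ s, b ∉ S ∧ ∃ g ∈ N, P (p, ![g]) ∧ ZFSet.pair b (F b) ∈ g) :
    graphOn F s ∈ N := by
  have hP2 : ∀ n, D0 (fun e : Env.{u} k (n + 1) => P (e.1, ![top e])) := fun n =>
    hP.comp (fun e : Env.{u} k (n + 1) => (e.1, ![top e]))
  -- `S` collects the arguments reached by some computation in `N`. Replacement glues the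
  -- computations to the graph of `F` on `S`, and if `S ≠ s` then `h2` reaches an argument outside
  -- `S`, which is absurd. The conjunct `True` only fits the shape of `ex_pair_mem`.
  have hS : ZFSet.sep (fun b => ∃ g ∈ N, P (p, ![g]) ∧ ∃ z, ZFSet.pair b z ∈ g ∧ True) s ∈ N := by
    refine hN.sep_mem_of_dfn (P := fun e => ∃ g ∈ N, P (e.1, ![g]) ∧
      ∃ z, ZFSet.pair (top e) z ∈ g ∧ True) (Dfn.ex (.and ((hP2 1).dfn hN) (D0.dfn hN ?_))) p hp hs
    infer_instance
  set S := ZFSet.sep (fun b => ∃ g ∈ N, P (p, ![g]) ∧ ∃ z, ZFSet.pair b z ∈ g ∧ True) s with hSdef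
  have hmemS : ∀ g ∈ N, P (p, ![g]) → ∀ b z, ZFSet.pair b z ∈ g → b ∈ S := by
    intro g hg hPg b z hz
    obtain ⟨c, hc, h⟩ := h1 g hg hPg _ hz
    obtain ⟨rfl, rfl⟩ := ZFSet.pair_inj.1 h
    exact ZFSet.mem_sep.2 ⟨hc, g, hg, hPg, _, hz, trivial⟩
  have hSmem : ∀ b ∈ S, ∃ g ∈ N, P (p, ![g]) ∧ ZFSet.pair b (F b) ∈ g := by
    intro b hb
    obtain ⟨-, g, hg, hPg, z, hz, -⟩ := ZFSet.mem_sep.1 hb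
    obtain ⟨c, hc, h⟩ := h1 g hg hPg _ hz
    obtain ⟨rfl, rfl⟩ := ZFSet.pair_inj.1 h
    exact ⟨g, hg, hPg, hz⟩
  have hR : Dfn N (fun e : Env.{u} k 2 => (∃ g ∈ N, P (e.1, ![g]) ∧ top e ∈ g) ∧
      ∃ z, top e = ZFSet.pair (top (pop e)) z) := by
    refine .and (Dfn.ex (.and ((hP2 2).dfn hN) (D0.dfn hN ?_))) (D0.dfn hN (D0.ex_eq_pair _ _))
    infer_instance
  obtain ⟨h, hh, hh'⟩ := hN.exists_replacement hR p hp hS (by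
    rintro x - y - y' - ⟨⟨g, hg, hPg, hy⟩, z, hz⟩ ⟨⟨g', hg', hPg', hy'⟩, z', hz'⟩
    change y = ZFSet.pair x z at hz
    change y' = ZFSet.pair x z' at hz'
    obtain ⟨c, -, h⟩ := h1 g hg hPg _ hy
    obtain ⟨c', -, h'⟩ := h1 g' hg' hPg' _ hy'
    change y = _ at h
    change y' = _ at h'
    rw [h, h']
    rw [h] at hz; rw [h'] at hz'
    rw [(ZFSet.pair_inj.1 hz).1, (ZFSet.pair_inj.1 hz').1])
  have hgr : graphOn F S = h := by
    ext w
    rw [hh', mem_graphOn]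
    constructor
    · rintro ⟨b, hb, rfl⟩
      obtain ⟨g, hg, hPg, hbg⟩ := hSmem b hb
      exact ⟨hN.mem_of_mem hg hbg, b, hb, ⟨g, hg, hPg, hbg⟩, _, rfl⟩
    · rintro ⟨-, b, hb, ⟨g, hg, hPg, hwg⟩, z, hz⟩
      change w = ZFSet.pair b z at hz
      obtain ⟨c, -, h⟩ := h1 g hg hPg _ hwg
      change w = _ at h
      rw [h] at hz
      exact ⟨b, hb, by rw [h, (ZFSet.pair_inj.1 hz).1]⟩
  rw [← hgr] at hh
  by_cases hSs : S = s
  · rwa [hSs] at hh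
  · obtain ⟨b, hb, hbS, g, hg, hPg, hbg⟩ := h2 S hS ZFSet.sep_subset hSs hh hSmem hmemS
    exact absurd (hmemS g hg hPg _ _ hbg) hbS

/-- A transitive model contains the Mostowski collapse of each of its relations, provided that the
collapse exists. -/
theorem graphOn_mem_of_collapse (hN : IsTransitiveModel N) {s R : ZFSet.{u}} (hs : s ∈ N)
    (hR : R ∈ N) {F : ZFSet.{u} → ZFSet.{u}}
    (hF : ∀ b ∈ s, ∀ z, z ∈ F b ↔ ∃ a ∈ s, ZFSet.pair a b ∈ R ∧ z = F a) :
    graphOn F s ∈ N := by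
  refine hN.graphOn_mem_of_computations (k := 2) (fun e => ∀ w ∈ top e, ∃ b ∈ e.1 0, ∃ v ∈ w,
    ∃ y ∈ v, w = ZFSet.pair b y ∧
      (∀ a ∈ e.1 0, ZFSet.pair a b ∈ e.1 1 → ∃ z ∈ y, ZFSet.pair a z ∈ top e) ∧
      (∀ z ∈ y, ∃ a ∈ e.1 0, ZFSet.pair a b ∈ e.1 1 ∧ ZFSet.pair a z ∈ top e)) ![s, R]
    (by simp [Fin.forall_fin_two, hs, hR]) hs F ?_ ?_
  · intro g hg hP
    change ∀ w ∈ g, ∃ b ∈ s, ∃ v ∈ w, ∃ y ∈ v, w = ZFSet.pair b y ∧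
      (∀ a ∈ s, ZFSet.pair a b ∈ R → ∃ z ∈ y, ZFSet.pair a z ∈ g) ∧
      (∀ z ∈ y, ∃ a ∈ s, ZFSet.pair a b ∈ R ∧ ZFSet.pair a z ∈ g) at hP
    -- The induction is on the value `F b`: predecessors `a` of `b` have `F a ∈ F b`, so
    -- well-foundedness of `∈` replaces that of `R`.
    have key : ∀ t, ∀ b ∈ s, F b = t → ∀ y, ZFSet.pair b y ∈ g → y = F b := by
      intro t
      induction t using ZFSet.inductionOn with
      | _ t ih =>
        rintro b hb rfl y hy
        obtain ⟨b', -, v, -, y', -, h, h1, h2⟩ := hP _ hy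
        obtain ⟨rfl, rfl⟩ := ZFSet.pair_inj.1 h
        ext z
        rw [hF b hb]
        constructor
        · intro hz
          obtain ⟨a, ha, hab, haz⟩ := h2 z hz
          exact ⟨a, ha, hab, ih (F a) ((hF b hb _).2 ⟨a, ha, hab, rfl⟩) a ha rfl z haz⟩
        · rintro ⟨a, ha, hab, rfl⟩
          obtain ⟨z, hz, haz⟩ := h1 a ha hab
          rwa [← ih (F a) ((hF b hb _).2 ⟨a, ha, hab, rfl⟩) a ha rfl z haz]
    intro w hw
    obtain ⟨b, hb, v, -, y, -, rfl, -⟩ := hP w hw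
    exact ⟨b, hb, by rw [← key _ b hb rfl y hw]⟩
  · intro S hS hSs hne hG hmem hmem'
    obtain ⟨b, hb, hbS, hmin⟩ : ∃ b ∈ s, b ∉ S ∧ ∀ a ∈ s, F a ∈ F b → a ∈ S := by
      have hex : ∃ t, ∃ b ∈ s, b ∉ S ∧ F b = t := by
        by_contra! hcon
        exact hne (subset_antisymm hSs fun b hb => by_contra fun h => hcon _ b hb h rfl)
      obtain ⟨t, ⟨b, hb, hbS, rfl⟩, hmin⟩ := ZFSet.mem_wf.has_min {t | ∃ b ∈ s, b ∉ S ∧ F b = t} hex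
      exact ⟨b, hb, hbS, fun a ha hab => by_contra fun h => hmin _ ⟨a, ha, h, rfl⟩ hab⟩
    have hpred : ∀ a ∈ s, ZFSet.pair a b ∈ R → a ∈ S := fun a ha hab =>
      hmin a ha ((hF b hb _).2 ⟨a, ha, hab, rfl⟩)
    have hFb : F b ∈ N := by
      convert hN.sep_mem (k := 4) (fun e => ∃ a ∈ e.1 0, ZFSet.pair a (e.1 2) ∈ e.1 1 ∧
        ZFSet.pair a (top e) ∈ e.1 3) ![s, R, b, graphOn F S]
        (by simp [Fin.forall_fin_succ, hs, hR, hN.mem_of_mem hs hb, hG])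
        (hN.sUnion_mem (hN.sUnion_mem hG)) using 1
      ext z
      rw [ZFSet.mem_sep, hF b hb]
      constructor
      · rintro ⟨a, ha, hab, rfl⟩
        have := pair_mem_graphOn.2 ⟨hpred a ha hab, (rfl : F a = F a)⟩
        exact ⟨mem_sUnion_sUnion_of_pair_mem this, a, ha, hab, this⟩
      · rintro ⟨-, a, ha, hab, haz⟩
        exact ⟨a, ha, hab, (pair_mem_graphOn.1 haz).2⟩
    refine ⟨b, hb, hbS, insert (ZFSet.pair b (F b)) (graphOn F S),
      hN.insert_mem (hN.pair_mem (hN.mem_of_mem hs hb) hFb) hG, ?_, ZFSet.mem_insert _ _⟩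
    intro w hw
    change w ∈ insert (ZFSet.pair b (F b)) (graphOn F S) at hw
    obtain ⟨c, hc, hwc, hcS⟩ : ∃ c ∈ s, w = ZFSet.pair c (F c) ∧
        ∀ a ∈ s, ZFSet.pair a c ∈ R → a ∈ S := by
      rw [ZFSet.mem_insert_iff, mem_graphOn] at hw
      obtain rfl | ⟨c, hc, rfl⟩ := hw
      · exact ⟨b, hb, rfl, hpred⟩
      · refine ⟨c, hSs hc, rfl, fun a ha hac => ?_⟩
        obtain ⟨g, hg, hPg, hcg⟩ := hmem c hc
        obtain ⟨c', -, v, -, y, -, h, h1, -⟩ := hPg _ hcg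
        obtain ⟨rfl, rfl⟩ := ZFSet.pair_inj.1 h
        obtain ⟨z, -, haz⟩ := h1 a ha hac
        exact hmem' g hg hPg a z haz
    subst hwc
    have hval : ∀ a ∈ s, ZFSet.pair a c ∈ R →
        F a ∈ F c ∧ ZFSet.pair a (F a) ∈ insert (ZFSet.pair b (F b)) (graphOn F S) :=
      fun a ha hac => ⟨(hF c hc _).2 ⟨a, ha, hac, rfl⟩,
        ZFSet.mem_insert_of_mem _ (pair_mem_graphOn.2 ⟨hcS a ha hac, rfl⟩)⟩
    refine ⟨c, hc, {c, F c}, by simp [ZFSet.pair], F c, by simp, rfl, fun a ha hac => ?_,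
      fun z hz => ?_⟩
    · exact ⟨F a, hval a ha hac⟩
    · obtain ⟨a, ha, hac, rfl⟩ := (hF c hc z).1 hz
      exact ⟨a, ha, hac, (hval a ha hac).2⟩

/-- An `∈`-induction in `V` produces the least transitive superset of `x` in `N`. Leastness is
carried along because it makes the closures of the elements of `x` unique, as replacement in `N`
requires. -/
theorem exists_isTransitive (hN : IsTransitiveModel N) {x : ZFSet.{u}} (hx : x ∈ N) :
    ∃ t ∈ N, t.IsTransitive ∧ x ∈ t := by
  have key : ∀ x : ZFSet.{u}, x ∈ N → ∃ t ∈ N, (t.IsTransitive ∧ x ⊆ t) ∧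
      ∀ t' ∈ N, t'.IsTransitive ∧ x ⊆ t' → t ⊆ t' := by
    intro x
    induction x using ZFSet.inductionOn with
    | _ x ih =>
      intro hx
      have hD : Dfn N (fun e : Env.{u} 0 2 => ((top e).IsTransitive ∧ top (pop e) ⊆ top e) ∧
          ∀ t' ∈ N, t'.IsTransitive ∧ top (pop e) ⊆ t' → top e ⊆ t') := by
        refine .and (D0.dfn hN inferInstance) (Dfn.all (D0.dfn hN ?_))
        infer_instance
      obtain ⟨b, hb, hb'⟩ := hN.exists_replacement hD ![] (fun i => i.elim0) hx (by
        rintro y - t ht t' ht' ⟨h1, h2⟩ ⟨h3, h4⟩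
        exact subset_antisymm (h2 t' ht' h3) (h4 t ht h1))
      refine ⟨x ∪ ZFSet.sUnion b, hN.union_mem hx (hN.sUnion_mem hb), ⟨?_, ?_⟩, ?_⟩
      · intro z hz w hw
        rw [ZFSet.mem_union, ZFSet.mem_sUnion] at hz ⊢
        right
        obtain hz | ⟨t, ht, hzt⟩ := hz
        · obtain ⟨t, ht, h1, h2⟩ := ih z hz (hN.mem_of_mem hx hz)
          exact ⟨t, (hb' t).2 ⟨ht, z, hz, h1, h2⟩, h1.2 hw⟩
        · obtain ⟨-, y, -, h1, -⟩ := (hb' t).1 ht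
          exact ⟨t, ht, h1.1 z hzt hw⟩
      · intro z hz
        exact ZFSet.mem_union.2 (Or.inl hz)
      · rintro t' ht' ⟨h1, h2⟩ z hz
        rw [ZFSet.mem_union, ZFSet.mem_sUnion] at hz
        obtain hz | ⟨t, ht, hzt⟩ := hz
        · exact h2 hz
        · obtain ⟨-, y, hy, -, h4⟩ := (hb' t).1 ht
          exact h4 t' ht' ⟨h1, h1 y (h2 hy)⟩ hzt
  obtain ⟨t, ht, ⟨h1, h2⟩, -⟩ := key _ (hN.singleton_mem hx)
  exact ⟨t, ht, h1, h2 (by simp)⟩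

end IsTransitiveModel

open Cardinal

/-! ### Cardinalities of sets -/

theorem card_le_of_rel {x y : ZFSet.{u}} (r : ZFSet.{u} → ZFSet.{u} → Prop)
    (h1 : ∀ z ∈ x, ∃ w ∈ y, r w z) (h2 : ∀ w ∈ y, ∀ z ∈ x, ∀ z' ∈ x, r w z → r w z' → z = z') :
    x.card ≤ y.card := by
  choose! f hf hr using h1
  rw [← Cardinal.lift_le.{u + 1}, ← ZFSet.cardinalMk_coe_sort, ← ZFSet.cardinalMk_coe_sort]
  refine Cardinal.mk_le_of_injective (f := fun z : x => (⟨f z, hf z z.2⟩ : y)) fun z z' h => ?_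
  have h3 : f z = f z' := congrArg Subtype.val h
  exact Subtype.ext (h2 (f z) (hf z z.2) z z.2 z' z'.2 (hr z z.2) (h3 ▸ hr z' z'.2))

theorem exists_injOn_of_card_le {x y : ZFSet.{u}} (h : x.card ≤ y.card) :
    ∃ F : ZFSet.{u} → ZFSet.{u}, (∀ a ∈ x, F a ∈ y) ∧
      ∀ a ∈ x, ∀ b ∈ x, F a = F b → a = b := by
  rw [← Cardinal.lift_le.{u + 1}, ← ZFSet.cardinalMk_coe_sort, ← ZFSet.cardinalMk_coe_sort] at h
  obtain ⟨f⟩ := h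
  classical
  refine ⟨fun a => if ha : a ∈ x then f ⟨a, ha⟩ else ∅, fun a ha => ?_, fun a ha b hb hab => ?_⟩
  · simp only [ha, dif_pos]
    exact (f ⟨a, ha⟩).2
  · simp only [ha, hb, dif_pos] at hab
    exact congrArg Subtype.val (f.injective (Subtype.ext hab))

theorem card_lt_of_cover {δ : Cardinal.{u}} (hδ : δ.IsRegular) {x y : ZFSet.{u}}
    (F : ZFSet.{u} → ZFSet.{u}) (hy : y.card < δ) (hF : ∀ w ∈ y, (F w).card < δ)
    (h : ∀ z ∈ x, ∃ w ∈ y, z ∈ F w) : x.card < δ := by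
  let G : Shrink.{u} y → ZFSet.{u} := fun i => F ((equivShrink y).symm i)
  have h1 : x ⊆ ZFSet.iUnion G := by
    intro z hz
    obtain ⟨w, hw, hzw⟩ := h z hz
    exact ZFSet.mem_iUnion.2 ⟨equivShrink y ⟨w, hw⟩, by simpa [G] using hzw⟩
  refine (ZFSet.card_mono h1).trans_lt ?_
  have h2 := ZFSet.lift_card_iUnion_le_sum_card (f := G)
  rw [Cardinal.lift_id] at h2
  exact h2.trans_lt (sum_lt_of_isRegular hδ hy fun i => hF _ (Subtype.coe_prop _))

theorem card_prod_lt {δ : Cardinal.{u}} (hδ : δ.IsRegular) {x y : ZFSet.{u}}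
    (hx : x.card < δ) (hy : y.card < δ) : (ZFSet.prod x y).card < δ := by
  refine card_lt_of_cover hδ (fun a => ZFSet.range fun b : y => ZFSet.pair a b) hx
    (fun a _ => ?_) fun z hz => ?_
  · refine (card_le_of_rel (y := y) (fun w z => z = ZFSet.pair a w) ?_ ?_).trans_lt hy
    · intro z hz
      obtain ⟨b, rfl⟩ := ZFSet.mem_range.1 hz
      exact ⟨b, b.2, rfl⟩
    · rintro w - z - z' - rfl rfl
      rfl
  · obtain ⟨a, ha, b, hb, rfl⟩ := ZFSet.mem_prod.1 hz
    exact ⟨a, ha, ZFSet.mem_range.2 ⟨⟨b, hb⟩, rfl⟩⟩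

/-- Puts cofinal sequences into the form that the approximation property takes: indexed by a
cardinal and monotone. -/
theorem exists_cofinal (θ : Ordinal.{u}) :
    ∃ f : Set.Iio θ.cof.ord → Ordinal.{u}, Monotone f ∧ (∀ i, f i < θ) ∧
      ∀ β < θ, ∃ i, β ≤ f i := by
  obtain ⟨f, hf⟩ := Ordinal.exists_isFundamentalSeq (o := θ) rfl
  refine ⟨fun i => f i, fun i j hij => hf.strictMono.monotone hij, fun i => (f i).2,
    fun β hβ => ?_⟩
  obtain ⟨_, ⟨i, rfl⟩, hi⟩ := hf.isCofinal_range ⟨β, hβ⟩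
  exact ⟨i, hi⟩

theorem exists_cofinal_set (θ : Ordinal.{u}) :
    ∃ σ : ZFSet.{u}, σ.card ≤ θ.cof ∧ (∀ z ∈ σ, ∃ β < θ, β.toZFSet = z) ∧
      ∀ β < θ, ∃ γ, β ≤ γ ∧ γ.toZFSet ∈ σ := by
  obtain ⟨f, -, hf, hf'⟩ := exists_cofinal θ
  refine ⟨ZFSet.range fun i => (f i).toZFSet, ?_, ?_, ?_⟩
  · refine (card_le_of_rel (y := θ.cof.ord.toZFSet)
      (fun w z => ∃ i, w = Ordinal.toZFSet i.1 ∧ z = (f i).toZFSet) ?_ ?_).trans_eq (by rw [Ordinal.card_toZFSet, card_ord])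
    · intro z hz
      obtain ⟨i, rfl⟩ := ZFSet.mem_range.1 hz
      exact ⟨_, Ordinal.mem_toZFSet_iff.2 ⟨i, i.2, rfl⟩, i, rfl, rfl⟩
    · rintro w - z - z' - ⟨i, rfl, rfl⟩ ⟨j, h, rfl⟩
      rw [Subtype.ext (Ordinal.toZFSet_injective h)]
  · intro z hz
    obtain ⟨i, rfl⟩ := ZFSet.mem_range.1 hz
    exact ⟨_, hf i, rfl⟩
  · intro β hβ
    obtain ⟨i, hi⟩ := hf' β hβ
    exact ⟨_, hi, ZFSet.mem_range.2 ⟨i, rfl⟩⟩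

instance D0.isOrdinal {k n : ℕ} (f : Env.{u} k n → ZFSet.{u}) [IsVar f] :
    D0 (fun e => (f e).IsOrdinal) :=
  have := fun m => IsVar.comp (m := m) f
  D0.congr (D0.and (fun e => (f e).IsTransitive) fun e => ∀ z ∈ f e, z.IsTransitive) fun _ =>
    ZFSet.isOrdinal_iff_forall_mem_isTransitive.symm

/-! ### Ordinals, choice functions and well-orderings in the model -/

namespace IsTransitiveModel

variable {N : Set ZFSet.{u}} {δ : Cardinal.{u}}

/-- Induction on `θ`. In cofinality at least `δ`, the ordinal is the union of a monotone sequence of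
smaller ordinals, so approximation applies. In smaller cofinality, a cofinal set of smaller ordinals
is covered by an element of `N`. -/
theorem toZFSet_mem (hN : IsTransitiveModel N) (hcov : Covering δ N) (happ : Approximation δ N)
    (hδ : ℵ₀ ≤ δ) (θ : Ordinal.{u}) : θ.toZFSet ∈ N := by
  induction θ using WellFoundedLT.induction with
  | ind θ ih =>
    rcases lt_or_ge θ.cof δ with hc | hc
    · obtain ⟨σ, hσ, hσ1, hσ2⟩ := exists_cofinal_set θ
      obtain ⟨τ, hτ, -, hστ⟩ := hcov σ (fun z hz => by
        obtain ⟨β, hβ, rfl⟩ := hσ1 z hz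
        exact ih β hβ) (hσ.trans_lt hc)
      -- If `θ ∉ N`, transitivity forces all ordinals of `N` to be below `θ`. Hence the ordinals in
      -- `τ ∪ ⋃ τ` are exactly those below `θ`, and `Δ₀` separation yields `θ` after all.
      by_contra hcon
      refine hcon ?_
      convert hN.sep_mem (k := 0) (fun e => (top e).IsOrdinal) ![] (fun i => i.elim0)
        (hN.union_mem hτ (hN.sUnion_mem hτ)) using 1
      ext z
      rw [ZFSet.mem_sep, ZFSet.mem_union, ZFSet.mem_sUnion]
      constructor
      · intro hz
        obtain ⟨β, hβ, rfl⟩ := Ordinal.mem_toZFSet_iff.1 hz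
        refine ⟨?_, ZFSet.isOrdinal_toZFSet β⟩
        obtain ⟨γ, hγ, hγσ⟩ := hσ2 β hβ
        rcases hγ.eq_or_lt with rfl | hγ
        · exact Or.inl (hστ hγσ)
        · exact Or.inr ⟨_, hστ hγσ, Ordinal.toZFSet_mem_toZFSet_iff.2 hγ⟩
      · rintro ⟨hz, hzo⟩
        change z.IsOrdinal at hzo
        have hzN : z ∈ N := by
          obtain hz | ⟨y, hy, hz⟩ := hz
          exacts [hN.mem_of_mem hτ hz, hN.mem_of_mem (hN.mem_of_mem hτ hy) hz]
        obtain h | h := hzo.mem_or_subset (ZFSet.isOrdinal_toZFSet θ)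
        · exact h
        · obtain h | h := ((ZFSet.isOrdinal_toZFSet θ).subset_iff_eq_or_mem hzo).1 h
          exacts [absurd (h ▸ hzN) hcon, absurd (hN.mem_of_mem hzN h) hcon]
    · have hlim : Order.IsSuccLimit θ :=
        Ordinal.one_lt_cof_iff.1 (Cardinal.one_lt_aleph0.trans_le (hδ.trans hc))
      obtain ⟨f, hf, hf1, hf2⟩ := exists_cofinal θ
      convert happ θ.cof (by rwa [Ordinal.cof_ord_cof]) (fun i => (f i).toZFSet)
        (fun i => ih _ (hf1 i)) (fun i j hij => Ordinal.toZFSet_monotone (hf hij)) using 1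
      ext z
      rw [ZFSet.mem_iUnion, Ordinal.mem_toZFSet_iff]
      constructor
      · rintro ⟨β, hβ, rfl⟩
        obtain ⟨i, hi⟩ := hf2 _ (hlim.succ_lt hβ)
        exact ⟨i, Ordinal.toZFSet_mem_toZFSet_iff.2 ((Order.lt_succ β).trans_le hi)⟩
      · rintro ⟨i, hi⟩
        obtain ⟨β, hβ, rfl⟩ := Ordinal.mem_toZFSet_iff.1 hi
        exact ⟨β, hβ.trans (hf1 i), rfl⟩

/-- A choice function on the nonempty subsets of `x`, coded as a set of pairs. -/
theorem exists_choice (hN : IsTransitiveModel N) {x : ZFSet.{u}} (hx : x ∈ N) :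
    ∃ C ∈ N, ∀ y ∈ N, y ⊆ x → y.Nonempty → ∃ u ∈ y, ∀ v ∈ y, ZFSet.pair y v ∈ C ↔ v = u := by
  -- The axiom of choice in `N` concerns disjoint families, so it is applied to the sets `{y} × y`
  -- for nonempty `y ⊆ x`.
  obtain ⟨Q, hQ, hQ'⟩ := hN.exists_powerset hx
  obtain ⟨R, hR, hR'⟩ := hN.exists_powerset (hN.prod_mem hQ hx)
  have hfam := hN.sep_mem (k := 1) (fun e => ∃ y ∈ e.1 0, (∃ u ∈ y, True) ∧
    (∀ w ∈ top e, ∃ u ∈ y, w = ZFSet.pair y u) ∧ ∀ u ∈ y, ZFSet.pair y u ∈ top e) ![Q]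
    (by simp [hQ]) hR
  set fam := ZFSet.sep (fun x => ∃ y ∈ Q, (∃ u ∈ y, True) ∧
    (∀ w ∈ x, ∃ u ∈ y, w = ZFSet.pair y u) ∧ ∀ u ∈ y, ZFSet.pair y u ∈ x) R with hfamdef
  change fam ∈ N at hfam
  obtain ⟨C, hC⟩ := hN.models.choice ⟨fam, hfam⟩ (by
    rintro ⟨z, hz⟩ hzf
    change z ∈ fam at hzf
    obtain ⟨-, y, -, ⟨u, hu, -⟩, -, h⟩ := ZFSet.mem_sep.1 hzf
    exact ⟨⟨_, hN.mem_of_mem hz (h u hu)⟩, h u hu⟩) (by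
    rintro ⟨z, hz⟩ ⟨z', hz'⟩ hzf hzf' hne w ⟨hw, hw'⟩
    change z ∈ fam at hzf
    change z' ∈ fam at hzf'
    obtain ⟨-, y, -, -, h1, h2⟩ := ZFSet.mem_sep.1 hzf
    obtain ⟨-, y', -, -, h1', h2'⟩ := ZFSet.mem_sep.1 hzf'
    obtain ⟨u, hu, hwu⟩ := h1 w hw
    obtain ⟨u', hu', hwu'⟩ := h1' w hw'
    obtain ⟨rfl, rfl⟩ := ZFSet.pair_inj.1 (hwu.symm.trans hwu')
    refine hne (Subtype.ext (ZFSet.ext fun v => ⟨fun hv => ?_, fun hv => ?_⟩))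
    · obtain ⟨t, ht, rfl⟩ := h1 v hv
      exact h2' t ht
    · obtain ⟨t, ht, rfl⟩ := h1' v hv
      exact h2 t ht)
  refine ⟨C, C.2, fun y hy hyx hne => ?_⟩
  have hzN : ZFSet.prod {y} y ∈ N := hN.prod_mem (hN.singleton_mem hy) hy
  have hyQ : y ∈ Q := (hQ' y).2 ⟨hy, hyx⟩
  have hzf : ZFSet.prod {y} y ∈ fam := by
    refine ZFSet.mem_sep.2 ⟨(hR' _).2 ⟨hzN, fun w hw => ?_⟩, y, hyQ, ?_, fun w hw => ?_,
      fun u hu => by simp [hu]⟩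
    · obtain ⟨a, ha, b, hb, rfl⟩ := ZFSet.mem_prod.1 hw
      rw [ZFSet.mem_singleton] at ha
      subst ha
      simp [hyQ, hyx hb]
    · obtain ⟨u, hu⟩ := hne
      exact ⟨u, hu, trivial⟩
    · obtain ⟨a, ha, b, hb, rfl⟩ := ZFSet.mem_prod.1 hw
      rw [ZFSet.mem_singleton] at ha
      subst ha
      exact ⟨b, hb, rfl⟩
  obtain ⟨w, ⟨hw1, hw2⟩, huniq⟩ := hC ⟨_, hzN⟩ hzf
  obtain ⟨a, ha, u, hu, hwu⟩ := ZFSet.mem_prod.1 hw1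
  rw [ZFSet.mem_singleton] at ha
  subst ha
  refine ⟨u, hu, fun v hv => ⟨fun h => ?_, ?_⟩⟩
  · have := huniq ⟨_, hN.mem_of_mem C.2 h⟩ ⟨by simp [hv], h⟩
    rw [← this] at hwu
    exact (ZFSet.pair_inj.1 hwu).2
  · rintro rfl
    rwa [hwu] at hw2

/-- The well-ordering theorem in a transitive model containing all ordinals. -/
theorem exists_enumeration (hN : IsTransitiveModel N)
    (hord : ∀ α : Ordinal.{u}, α.toZFSet ∈ N) {x : ZFSet.{u}} (hx : x ∈ N) :
    ∃ (θ : Ordinal.{u}) (F : Ordinal.{u} → ZFSet.{u}),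
      (∀ α < θ, ∀ β < θ, F α = F β → α = β) ∧ (∀ z, z ∈ x ↔ ∃ α < θ, F α = z) ∧
      graphOn (fun a => F a.rank) θ.toZFSet ∈ N := by
  obtain ⟨C, hC, hC'⟩ := hN.exists_choice hx
  obtain ⟨Q, hQ, hQ'⟩ := hN.exists_powerset hx
  -- The choices coded by `C` are extended to all nonempty subsets of `x` in `V`. The recursion can
  -- then run in `V`, and is shown to stay in `N` only afterwards.
  have hch : ∃ ch : ZFSet.{u} → ZFSet.{u}, ∀ y, y ⊆ x → y.Nonempty → ch y ∈ y ∧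
      (y ∈ N → ∀ v ∈ y, ZFSet.pair y v ∈ C ↔ v = ch y) := by
    have : ∀ y : ZFSet.{u}, ∃ c, y ⊆ x → y.Nonempty → c ∈ y ∧
        (y ∈ N → ∀ v ∈ y, ZFSet.pair y v ∈ C ↔ v = c) := by
      intro y
      by_cases h : y ∈ N ∧ y ⊆ x ∧ y.Nonempty
      · obtain ⟨u, hu, hu'⟩ := hC' y h.1 h.2.1 h.2.2
        exact ⟨u, fun _ _ => ⟨hu, fun _ => hu'⟩⟩
      · by_cases h' : y.Nonempty
        · exact ⟨h'.some, fun h1 h2 => ⟨h'.some_mem, fun h3 => absurd ⟨h3, h1, h2⟩ h⟩⟩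
        · exact ⟨∅, fun _ h2 => absurd h2 h'⟩
    choose ch hch using this
    exact ⟨ch, hch⟩
  obtain ⟨ch, hch⟩ := hch
  let rest : (α : Ordinal.{u}) → ((β : Ordinal.{u}) → β < α → ZFSet.{u}) → ZFSet.{u} :=
    fun α f => ZFSet.sep (fun z => ∀ β (h : β < α), f β h ≠ z) x
  let F : Ordinal.{u} → ZFSet.{u} :=
    WellFounded.fix Ordinal.lt_wf fun α f => ch (rest α f)
  let X : Ordinal.{u} → ZFSet.{u} := fun α => ZFSet.sep (fun z => ∀ β < α, F β ≠ z) x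
  have hF : ∀ α, F α = ch (X α) := fun α => WellFounded.fix_eq _ _ _
  have hXx : ∀ α, X α ⊆ x := fun α => ZFSet.sep_subset
  have hFX : ∀ α, (X α).Nonempty → F α ∈ X α := fun α h => hF α ▸ (hch _ (hXx α) h).1
  have hinj : ∀ α β, (X α).Nonempty → (X β).Nonempty → F α = F β → α = β := by
    have : ∀ α β, (X α).Nonempty → β < α → F β ≠ F α := fun α β h1 h2 =>
      (ZFSet.mem_sep.1 (hFX α h1)).2 β h2
    intro α β hα hβ h
    rcases lt_trichotomy α β with h' | h' | h'
    exacts [absurd h (this β α hβ h'), h', absurd h.symm (this α β hα h')]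
  have hex : ∃ θ, ¬ (X θ).Nonempty := by
    by_contra! hcon
    exact not_injective_of_ordinal (fun α => (⟨F α, hXx α (hFX α (hcon α))⟩ : x))
      fun α β h => hinj α β (hcon α) (hcon β) (congrArg Subtype.val h)
  obtain ⟨θ, hθ, hmin⟩ := Ordinal.lt_wf.has_min {θ | ¬ (X θ).Nonempty} hex
  have hne : ∀ α < θ, (X α).Nonempty := fun α h => by_contra fun h' => hmin α h' h
  refine ⟨θ, F, fun α hα β hβ h => hinj α β (hne α hα) (hne β hβ) h,
    fun z => ⟨fun hz => ?_, ?_⟩, ?_⟩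
  · by_contra! hcon
    exact hθ ⟨z, ZFSet.mem_sep.2 ⟨hz, hcon⟩⟩
  · rintro ⟨α, hα, rfl⟩
    exact hXx α (hFX α (hne α hα))
  -- A computation `g` is a set of pairs `(b, u)` such that `g` is defined at every element of `b`
  -- and `u` is the choice from the set `y` of elements of `x` not yet taken below `b`. Letting `y`
  -- range over the power set `Q` of `N` keeps this `Δ₀`.
  refine hN.graphOn_mem_of_computations (k := 4) (fun e => ∀ w ∈ top e, ∃ b ∈ e.1 0, ∃ v ∈ w,
    ∃ u ∈ v, w = ZFSet.pair b u ∧ (∀ a ∈ b, ∃ z, ZFSet.pair a z ∈ top e ∧ True) ∧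
      ∃ y ∈ e.1 1, ZFSet.pair y u ∈ e.1 2 ∧ u ∈ y ∧
        ∀ z ∈ e.1 3, z ∈ y ↔ ∀ a ∈ b, ¬ ZFSet.pair a z ∈ top e)
    ![θ.toZFSet, Q, C, x] (by simp [Fin.forall_fin_succ, hord, hQ, hC, hx]) (hord θ) _ ?_ ?_
  · intro g hg hP
    change ∀ w ∈ g, ∃ b ∈ θ.toZFSet, ∃ v ∈ w,
      ∃ u ∈ v, w = ZFSet.pair b u ∧ (∀ a ∈ b, ∃ z, ZFSet.pair a z ∈ g ∧ True) ∧
        ∃ y ∈ Q, ZFSet.pair y u ∈ C ∧ u ∈ y ∧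
          ∀ z ∈ x, z ∈ y ↔ ∀ a ∈ b, ¬ ZFSet.pair a z ∈ g at hP
    have key : ∀ β : Ordinal.{u}, ∀ u, ZFSet.pair β.toZFSet u ∈ g → u = F β := by
      intro β
      induction β using WellFoundedLT.induction with
      | ind β ih =>
        intro u hu
        obtain ⟨b, hb, v, -, u', -, h, h1, y, hyQ, hyC, huy, hy⟩ := hP _ hu
        obtain ⟨rfl, rfl⟩ := ZFSet.pair_inj.1 h
        have hyX : y = X β := by
          ext z
          by_cases hz : z ∈ x
          · rw [hy z hz, ZFSet.mem_sep, and_iff_right hz]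
            constructor
            · rintro hz' γ hγ rfl
              obtain ⟨z, hγz, -⟩ := h1 γ.toZFSet (Ordinal.toZFSet_mem_toZFSet_iff.2 hγ)
              refine hz' _ (Ordinal.toZFSet_mem_toZFSet_iff.2 hγ) ?_
              rwa [← ih γ hγ z hγz]
            · intro hz' a ha haz
              obtain ⟨γ, hγ, rfl⟩ := Ordinal.mem_toZFSet_iff.1 ha
              exact hz' γ hγ (ih γ hγ z haz).symm
          · exact iff_of_false (fun h => hz (((hQ' y).1 hyQ).2 h)) fun h => hz (hXx _ h)
        subst hyX
        rw [hF]
        exact ((hch _ (hXx β) ⟨u, huy⟩).2 ((hQ' _).1 hyQ).1 u huy).1 hyC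
    intro w hw
    obtain ⟨b, hb, v, -, u, -, rfl, -⟩ := hP w hw
    obtain ⟨β, hβ, rfl⟩ := Ordinal.mem_toZFSet_iff.1 hb
    exact ⟨_, hb, by rw [Ordinal.rank_toZFSet, ← key β u hw]⟩
  · intro S hS hSs hneS hG hmem hmem'
    obtain ⟨β, hβ, hβS, hpred⟩ : ∃ β < θ, β.toZFSet ∉ S ∧ ∀ γ < β, γ.toZFSet ∈ S := by
      have hex : ∃ β, β < θ ∧ β.toZFSet ∉ S := by
        by_contra! hcon
        refine hneS (subset_antisymm hSs fun b hb => ?_)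
        obtain ⟨β, hβ, rfl⟩ := Ordinal.mem_toZFSet_iff.1 hb
        exact hcon β hβ
      obtain ⟨β, ⟨hβ, hβS⟩, hmin⟩ := Ordinal.lt_wf.has_min {β | β < θ ∧ β.toZFSet ∉ S} hex
      exact ⟨β, hβ, hβS, fun γ hγ => by_contra fun h => hmin γ ⟨hγ.trans hβ, h⟩ hγ⟩
    set G := graphOn (fun a => F a.rank) S with hGdef
    have hpairG : ∀ γ : Ordinal.{u}, ∀ z, ZFSet.pair γ.toZFSet z ∈ G ↔ γ.toZFSet ∈ S ∧ z = F γ := by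
      intro γ z
      rw [hGdef, pair_mem_graphOn, Ordinal.rank_toZFSet]
    have hXN : ∀ γ ≤ β, X γ ∈ N := by
      intro γ hγ
      convert hN.sep_mem (k := 2) (fun e => ∀ a ∈ e.1 0, ¬ ZFSet.pair a (top e) ∈ e.1 1)
        ![γ.toZFSet, G] (by simp [Fin.forall_fin_succ, hord, hG]) hx using 1
      ext z
      simp only [X, ZFSet.mem_sep]
      refine and_congr_right fun hz => ⟨fun h a ha haz => ?_, fun h ε hε hεz => ?_⟩
      · obtain ⟨ε, hε, rfl⟩ := Ordinal.mem_toZFSet_iff.1 ha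
        exact h ε hε ((hpairG ε z).1 haz).2.symm
      · exact h ε.toZFSet (Ordinal.toZFSet_mem_toZFSet_iff.2 hε)
          ((hpairG ε z).2 ⟨hpred ε (hε.trans_le hγ), hεz.symm⟩)
    have hFβ : F β ∈ N := hN.mem_of_mem hx (hXx β (hFX β (hne β hβ)))
    obtain ⟨G', hG'⟩ : ∃ G', G' = graphOn (fun a => F a.rank) (Order.succ β).toZFSet := ⟨_, rfl⟩
    have hpairG' : ∀ γ : Ordinal.{u}, ∀ z, ZFSet.pair γ.toZFSet z ∈ G' ↔ γ ≤ β ∧ z = F γ := by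
      intro γ z
      rw [hG', pair_mem_graphOn, Ordinal.rank_toZFSet, Ordinal.toZFSet_mem_toZFSet_iff,
        Order.lt_succ_iff]
    refine ⟨β.toZFSet, Ordinal.toZFSet_mem_toZFSet_iff.2 hβ, hβS, G', ?_, ?_, ?_⟩
    · convert hN.insert_mem (hN.pair_mem (hord β) hFβ)
        (hN.sep_mem (k := 1) (fun e => ∃ a ∈ e.1 0, ∃ v ∈ top e, ∃ z ∈ v, top e = ZFSet.pair a z)
          ![β.toZFSet] (by simp [hord]) hG) using 1
      ext w
      simp only [hG', mem_graphOn, ZFSet.mem_insert_iff, ZFSet.mem_sep, Ordinal.mem_toZFSet_iff,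
        Order.lt_succ_iff]
      constructor
      · rintro ⟨_, ⟨γ, hγ, rfl⟩, rfl⟩
        rcases hγ.eq_or_lt with rfl | hγ
        · left; rw [Ordinal.rank_toZFSet]
        · right
          rw [Ordinal.rank_toZFSet]
          exact ⟨(hpairG γ _).2 ⟨hpred γ hγ, rfl⟩, γ.toZFSet,
            Ordinal.toZFSet_mem_toZFSet_iff.2 hγ, {γ.toZFSet, F γ}, by simp [top, ZFSet.pair],
            F γ, by simp, rfl⟩
      · rintro (rfl | ⟨hw, a, ha, v, -, z, -, h⟩)
        · exact ⟨_, ⟨β, le_rfl, rfl⟩, by rw [Ordinal.rank_toZFSet]⟩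
        · change w = _ at h
          subst h
          obtain ⟨γ, hγ, rfl⟩ := Ordinal.mem_toZFSet_iff.1 ha
          exact ⟨_, ⟨γ, hγ.le, rfl⟩, by rw [((hpairG γ z).1 hw).2, Ordinal.rank_toZFSet]⟩
    · intro w hw
      change w ∈ G' at hw
      rw [hG'] at hw
      obtain ⟨_, hb, rfl⟩ := mem_graphOn.1 hw
      obtain ⟨γ, hγ, rfl⟩ := Ordinal.mem_toZFSet_iff.1 hb
      have hγβ := Order.lt_succ_iff.1 hγ
      rw [Ordinal.rank_toZFSet]
      have hγX := hFX γ (hne γ (hγβ.trans_lt hβ))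
      refine ⟨γ.toZFSet, Ordinal.toZFSet_mem_toZFSet_iff.2 (hγβ.trans_lt hβ), {γ.toZFSet, F γ},
        by simp [ZFSet.pair], F γ, by simp, rfl, fun a ha => ?_, X γ,
        (hQ' _).2 ⟨hXN γ hγβ, hXx γ⟩, ?_, hγX, fun z hz => ?_⟩
      · obtain ⟨ε, hε, rfl⟩ := Ordinal.mem_toZFSet_iff.1 ha
        exact ⟨F ε, (hpairG' ε _).2 ⟨hε.le.trans hγβ, rfl⟩, trivial⟩
      · exact ((hch _ (hXx γ) ⟨_, hγX⟩).2 (hXN γ hγβ) _ hγX).2 (hF γ)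
      · change z ∈ x at hz
        simp only [X, ZFSet.mem_sep, hz, true_and]
        refine ⟨fun h a ha haz => ?_, fun h ε hε hεz => ?_⟩
        · obtain ⟨ε, hε, rfl⟩ := Ordinal.mem_toZFSet_iff.1 ha
          exact h ε hε ((hpairG' ε z).1 haz).2.symm
        · exact h ε.toZFSet (Ordinal.toZFSet_mem_toZFSet_iff.2 hε)
            ((hpairG' ε z).2 ⟨hε.le.trans hγβ, hεz.symm⟩)
    · rw [Ordinal.rank_toZFSet]
      exact (hpairG' β _).2 ⟨le_rfl, rfl⟩

end IsTransitiveModel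

/-- A transitive model of ZFC with the covering and approximation properties at a regular
cardinal. -/
structure IsApproxModel (δ : Cardinal.{u}) (N : Set ZFSet.{u}) : Prop where
  reg : δ.IsRegular
  model : IsTransitiveModel N
  cov : Covering δ N
  app : Approximation δ N

/-! ### Consequences of covering and approximation -/

namespace IsApproxModel

variable {δ : Cardinal.{u}} {N : Set ZFSet.{u}}

theorem toZFSet_mem (h : IsApproxModel δ N) (θ : Ordinal.{u}) : θ.toZFSet ∈ N :=
  h.model.toZFSet_mem h.cov h.app h.reg.aleph0_le θ

/-- Small subsets of a set of `N` are covered by small subsets of it in `N`. -/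
theorem exists_cover (h : IsApproxModel δ N) {b σ : ZFSet.{u}} (hb : b ∈ N) (hσ : σ ⊆ b)
    (hc : σ.card < δ) : ∃ τ ∈ N, τ.card < δ ∧ σ ⊆ τ ∧ τ ⊆ b := by
  obtain ⟨τ, hτ, hτc, hστ⟩ := h.cov σ (fun x hx => h.model.mem_of_mem hb (hσ hx)) hc
  refine ⟨τ ∩ b, h.model.inter_mem hτ hb, (ZFSet.card_mono fun z hz => ?_).trans_lt hτc,
    fun z hz => ZFSet.mem_inter.2 ⟨hστ hz, hσ hz⟩, fun z hz => (ZFSet.mem_inter.1 hz).2⟩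
  exact (ZFSet.mem_inter.1 hz).1

/-- A small family of subsets of `b` in `N` is separated by a small subset of `b` in `N`. -/
theorem exists_separating (h : IsApproxModel δ N) {b T : ZFSet.{u}} (hb : b ∈ N)
    (hT : ∀ y ∈ T, y ⊆ b) (hc : T.card < δ) :
    ∃ D ∈ N, D.card < δ ∧ D ⊆ b ∧ ∀ y ∈ T, ∀ y' ∈ T, (∀ d ∈ D, d ∈ y ↔ d ∈ y') → y = y' := by
  have hd : ∀ y y' : ZFSet.{u}, ∃ d, y ≠ y' → ¬ (d ∈ y ↔ d ∈ y') := by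
    intro y y'
    by_cases hyy : y = y'
    · exact ⟨∅, fun h => absurd hyy h⟩
    · by_contra! hcon
      exact hyy (ZFSet.ext fun d => (hcon d).2)
  choose d hd using hd
  -- One point of difference is taken for each pair of members of `T`. For distinct subsets of `b`
  -- it lies in `b`, so intersecting with `b` discards only irrelevant default values.
  let D₀ := (ZFSet.range fun p : T × T => d p.1 p.2) ∩ b
  have hD₀ : D₀.card < δ := by
    refine (card_le_of_rel (y := ZFSet.prod T T)
      (fun w z => ∃ y y', w = ZFSet.pair y y' ∧ z = d y y') ?_ ?_).trans_lt
      (card_prod_lt h.reg hc hc)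
    · intro z hz
      obtain ⟨⟨y, y'⟩, rfl⟩ := ZFSet.mem_range.1 (ZFSet.mem_inter.1 hz).1
      exact ⟨ZFSet.pair y y', ZFSet.pair_mem_prod.2 ⟨y.2, y'.2⟩, y, y', rfl, rfl⟩
    · rintro w - z - z' - ⟨y, y', rfl, rfl⟩ ⟨v, v', hv, rfl⟩
      obtain ⟨rfl, rfl⟩ := ZFSet.pair_inj.1 hv
      rfl
  obtain ⟨D, hD, hDc, hDD, hDb⟩ := h.exists_cover hb (fun z hz => (ZFSet.mem_inter.1 hz).2) hD₀
  refine ⟨D, hD, hDc, hDb, fun y hy y' hy' hyy => by_contra fun hne => ?_⟩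
  have h1 := hd y y' hne
  refine h1 (hyy _ (hDD (ZFSet.mem_inter.2 ⟨ZFSet.mem_range.2 ⟨(⟨y, hy⟩, ⟨y', hy'⟩), rfl⟩, ?_⟩)))
  by_contra h2
  exact h1 (iff_of_false (fun h3 => h2 (hT y hy h3)) fun h3 => h2 (hT y' hy' h3))

/-- The approximation property in terms of small pieces. -/
theorem mem_of_forall_inter_mem (h : IsApproxModel δ N) {A b : ZFSet.{u}} (hb : b ∈ N)
    (hA : A ⊆ b) (happ : ∀ τ ∈ N, τ.card < δ → τ ⊆ b → A ∩ τ ∈ N) : A ∈ N := by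
  have hN := h.model
  have hord := h.toZFSet_mem
  obtain ⟨θ, F, -, hF, hf⟩ := hN.exists_enumeration hord hb
  set f := graphOn (fun a => F a.rank) θ.toZFSet with hfdef
  -- `B α` is the part of `A` enumerated before stage `α`; all these pieces are shown to be in `N`
  -- by induction on `α`.
  let B : Ordinal.{u} → ZFSet.{u} := fun α => ZFSet.sep (fun z => ∃ β < α, F β = z) A
  have hBmono : Monotone B := by
    intro α β hαβ z hz
    obtain ⟨hz, γ, hγ, rfl⟩ := ZFSet.mem_sep.1 hz
    exact ZFSet.mem_sep.2 ⟨hz, γ, hγ.trans_le hαβ, rfl⟩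
  have hBA : ∀ α, B α ⊆ A := fun α => ZFSet.sep_subset
  have key : ∀ α ≤ θ, B α ∈ N := by
    intro α
    induction α using WellFoundedLT.induction with
    | ind α ih =>
      intro hαθ
      -- The first case includes `α = 0`, which falls under small cofinality.
      by_cases hlim : ∀ β < α, Order.succ β < α
      · rcases lt_or_ge α.cof δ with hc | hc
        · obtain ⟨σ, hσ, hσ1, hσ2⟩ := exists_cofinal_set α
          obtain ⟨C, hC, hCc, hσC, hCα⟩ := h.exists_cover (hord α) (fun z hz => by
            obtain ⟨β, hβ, rfl⟩ := hσ1 z hz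
            exact Ordinal.toZFSet_mem_toZFSet_iff.2 hβ) (hσ.trans_lt hc)
          obtain ⟨P, hP, hP'⟩ := hN.exists_powerset hb
          let T := ZFSet.range fun c : C => B (c : ZFSet.{u}).rank
          have hTP : T ⊆ P := by
            intro z hz
            obtain ⟨c, rfl⟩ := ZFSet.mem_range.1 hz
            obtain ⟨β, hβ, hβc⟩ := Ordinal.mem_toZFSet_iff.1 (hCα c.2)
            rw [← hβc, Ordinal.rank_toZFSet]
            exact (hP' _).2 ⟨ih β hβ (hβ.le.trans hαθ), fun z hz => hA (hBA β hz)⟩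
          have hTc : T.card < δ := by
            refine (card_le_of_rel (y := C) (fun w z => z = B w.rank) ?_ ?_).trans_lt hCc
            · intro z hz
              obtain ⟨c, rfl⟩ := ZFSet.mem_range.1 hz
              exact ⟨c, c.2, rfl⟩
            · rintro w - z - z' - rfl rfl
              rfl
          -- The pieces `B γ` for `γ ∈ C` form a small family, but the family itself may not be in
          -- `N`. It is covered by a small `τ ∈ N`, whose members are told apart by their traces on
          -- a small `D ∈ N`.
          obtain ⟨τ, hτ, hτc, hTτ, hτP⟩ := h.exists_cover hP hTP hTc
          obtain ⟨D, hD, hDc, hDb, hsep⟩ :=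
            h.exists_separating hb (fun y hy => ((hP' y).1 (hτP hy)).2) hτc
          have hAD := happ D hD hDc hDb
          -- The trace of `B γ` on `D` can be computed in `N` from `A ∩ D`, `f` and `γ`. This
          -- selects from `τ` exactly the pieces `B γ` with `γ ∈ C`, whose union is `B α`.
          have hBγ : ∀ γ : Ordinal.{u}, γ ≤ θ → ∀ d ∈ D, d ∈ B γ ↔
              d ∈ A ∩ D ∧ ∃ β ∈ γ.toZFSet, ZFSet.pair β d ∈ f := by
            intro γ hγ d hd
            simp only [B, ZFSet.mem_sep, ZFSet.mem_inter, hd, and_true]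
            refine and_congr_right fun _ => ⟨?_, ?_⟩
            · rintro ⟨β, hβ, rfl⟩
              refine ⟨_, Ordinal.toZFSet_mem_toZFSet_iff.2 hβ, pair_mem_graphOn.2
                ⟨Ordinal.toZFSet_mem_toZFSet_iff.2 (hβ.trans_le hγ), ?_⟩⟩
              rw [Ordinal.rank_toZFSet]
            · rintro ⟨_, hβ, hβd⟩
              obtain ⟨β, hβ, rfl⟩ := Ordinal.mem_toZFSet_iff.1 hβ
              refine ⟨β, Ordinal.toZFSet_mem_toZFSet_iff.1 hβ, ?_⟩
              rw [(pair_mem_graphOn.1 hβd).2, Ordinal.rank_toZFSet]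
          have hTmem : ∀ γ : Ordinal.{u}, γ.toZFSet ∈ C → B γ ∈ τ := fun γ hγ =>
            hTτ (ZFSet.mem_range.2 ⟨⟨_, hγ⟩, by rw [Ordinal.rank_toZFSet]⟩)
          convert hN.sep_mem (k := 5) (fun e => ∃ y ∈ e.1 0, top e ∈ y ∧ ∃ γ ∈ e.1 1, ∀ d ∈ e.1 2,
            d ∈ y ↔ d ∈ e.1 3 ∧ ∃ β ∈ γ, ZFSet.pair β d ∈ e.1 4) ![τ, C, D, A ∩ D, f]
            (by simp [Fin.forall_fin_succ, hτ, hC, hD, hAD, hf]) hb using 1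
          ext z
          refine Iff.trans ?_ ZFSet.mem_sep.symm
          change z ∈ B α ↔ z ∈ b ∧ ∃ y ∈ τ, z ∈ y ∧ ∃ γ ∈ C, ∀ d ∈ D,
            d ∈ y ↔ d ∈ A ∩ D ∧ ∃ β ∈ γ, ZFSet.pair β d ∈ f
          constructor
          · intro hz
            refine ⟨hA (hBA α hz), ?_⟩
            obtain ⟨hzA, β, hβ, rfl⟩ := ZFSet.mem_sep.1 hz
            obtain ⟨γ, hγ, hγσ⟩ := hσ2 _ (hlim β hβ)
            have hγα : γ < α := Ordinal.toZFSet_mem_toZFSet_iff.1 (hCα (hσC hγσ))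
            refine ⟨B γ, hTmem γ (hσC hγσ),
              ZFSet.mem_sep.2 ⟨hzA, β, (Order.lt_succ β).trans_le hγ, rfl⟩, _, hσC hγσ,
              hBγ γ (hγα.le.trans hαθ)⟩
          · rintro ⟨-, y, hy, hzy, c, hc, hyd⟩
            obtain ⟨γ, hγ, rfl⟩ := Ordinal.mem_toZFSet_iff.1 (hCα hc)
            have : y = B γ := hsep y hy _ (hTmem γ hc) fun d hd => by
              rw [hyd d hd, hBγ γ (hγ.le.trans hαθ) d hd]
            subst this
            exact hBmono hγ.le hzy
        · obtain ⟨g, hg, hg1, hg2⟩ := exists_cofinal α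
          convert h.app α.cof (by rwa [Ordinal.cof_ord_cof]) (fun i => B (g i))
            (fun i => ih _ (hg1 i) ((hg1 i).le.trans hαθ)) (fun i j hij => hBmono (hg hij)) using 1
          ext z
          rw [ZFSet.mem_iUnion]
          constructor
          · intro hz
            obtain ⟨hzA, β, hβ, rfl⟩ := ZFSet.mem_sep.1 hz
            obtain ⟨i, hi⟩ := hg2 _ (hlim β hβ)
            exact ⟨i, ZFSet.mem_sep.2 ⟨hzA, β, (Order.lt_succ β).trans_le hi, rfl⟩⟩
          · rintro ⟨i, hi⟩
            exact hBmono (hg1 i).le hi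
      · push Not at hlim
        obtain ⟨β, hβ, hβα⟩ := hlim
        have hα : α = Order.succ β := le_antisymm hβα (Order.succ_le_of_lt hβ)
        subst hα
        have hβθ : β < θ := hβ.trans_le hαθ
        have hBβ := ih β hβ hβθ.le
        by_cases hFA : F β ∈ A
        · convert h.model.insert_mem (h.model.mem_of_mem hb (hA hFA)) hBβ using 1
          ext z
          simp only [B, ZFSet.mem_insert_iff, ZFSet.mem_sep, Order.lt_succ_iff]
          constructor
          · rintro ⟨hz, γ, hγ, rfl⟩
            rcases hγ.eq_or_lt with rfl | hγ
            exacts [Or.inl rfl, Or.inr ⟨hz, γ, hγ, rfl⟩]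
          · rintro (rfl | ⟨hz, γ, hγ, rfl⟩)
            exacts [⟨hFA, β, le_rfl, rfl⟩, ⟨hz, γ, hγ.le, rfl⟩]
        · convert hBβ using 1
          ext z
          simp only [B, ZFSet.mem_sep, Order.lt_succ_iff]
          refine and_congr_right fun hz => ⟨?_, fun ⟨γ, hγ, h⟩ => ⟨γ, hγ.le, h⟩⟩
          rintro ⟨γ, hγ, rfl⟩
          rcases hγ.eq_or_lt with rfl | hγ
          exacts [absurd hz hFA, ⟨γ, hγ, rfl⟩]
  convert key θ le_rfl using 1
  ext z
  simp only [B, ZFSet.mem_sep]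
  exact ⟨fun hz => ⟨hz, (hF z).1 (hA hz)⟩, fun hz => hz.1⟩

end IsApproxModel

/-! ### Gödel pairing -/

/-- `max a b < max c d`, for ordinals. -/
def MaxLT (a b c d : ZFSet.{u}) : Prop := (a ∈ c ∨ a ∈ d) ∧ (b ∈ c ∨ b ∈ d)

/-- The canonical well-ordering of pairs of ordinals. -/
def GodelLT (a b c d : ZFSet.{u}) : Prop :=
  MaxLT a b c d ∨ (¬ MaxLT a b c d ∧ ¬ MaxLT c d a b ∧ (a ∈ c ∨ (a = c ∧ b ∈ d)))

instance D0.godelLT {k n : ℕ} (a b c d : Env.{u} k n → ZFSet.{u}) [IsVar a] [IsVar b] [IsVar c]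
    [IsVar d] : D0 (fun e => GodelLT (a e) (b e) (c e) (d e)) := by
  unfold GodelLT MaxLT
  infer_instance

theorem maxLT_toZFSet {a b c d : Ordinal.{u}} :
    MaxLT a.toZFSet b.toZFSet c.toZFSet d.toZFSet ↔ max a b < max c d := by
  simp only [MaxLT, Ordinal.toZFSet_mem_toZFSet_iff]
  rw [max_lt_iff, lt_max_iff, lt_max_iff]

theorem godelLT_toZFSet {a b c d : Ordinal.{u}} :
    GodelLT a.toZFSet b.toZFSet c.toZFSet d.toZFSet ↔
      toLex (max a b, toLex (a, b)) < toLex (max c d, toLex (c, d)) := by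
  simp only [GodelLT, maxLT_toZFSet, Prod.Lex.toLex_lt_toLex, Ordinal.toZFSet_mem_toZFSet_iff,
    Ordinal.toZFSet_injective.eq_iff]
  rcases lt_trichotomy (max a b) (max c d) with h | h | h
  · simp [h]
  · simp [h]
  · simp [h, h.ne', h.not_gt]

/-- `G a b` is the order type of the predecessors of `(a, b)` in the canonical order. With `q` above
`max a b` in `δ`, they lie in the product of the initial segment below `q` with itself, which has
size below `δ`; so the values stay below `δ`. -/
theorem exists_godel_pairing {δ : Cardinal.{u}} (hδ : ℵ₀ ≤ δ) :
    ∃ G : Ordinal.{u} → Ordinal.{u} → Ordinal.{u},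
      (∀ a < δ.ord, ∀ b < δ.ord, G a b < δ.ord) ∧
      (∀ a < δ.ord, ∀ b < δ.ord, ∀ c < δ.ord, ∀ d < δ.ord, G a b = G c d → a = c ∧ b = d) ∧
      ∀ a < δ.ord, ∀ b < δ.ord, ∀ γ, γ < G a b ↔ ∃ c < δ.ord, ∃ d < δ.ord,
        GodelLT c.toZFSet d.toZFSet a.toZFSet b.toZFSet ∧ G c d = γ := by
  let α := δ.ord.ToType
  let f : α × α ↪ α ×ₗ (α ×ₗ α) :=
    ⟨fun p => toLex (max p.1 p.2, toLex p), fun p q => congrArg Prod.snd⟩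
  let s := f ⁻¹'o (· < ·)
  have hs : IsWellOrder _ s := (RelEmbedding.preimage ..).isWellOrder
  have hs_iff : ∀ x p, s x p ↔ max x.1 x.2 < max p.1 p.2 ∨ (max x.1 x.2 = max p.1 p.2 ∧
      (x.1 < p.1 ∨ (x.1 = p.1 ∧ x.2 < p.2))) := by
    intro x p
    change toLex (max x.1 x.2, toLex (x.1, x.2)) < toLex (max p.1 p.2, toLex (p.1, p.2)) ↔ _
    simp only [Prod.Lex.toLex_lt_toLex]
  let e : Set.Iio δ.ord ≃o α := Ordinal.ToType.mk
  have hlt : ∀ p, Ordinal.typein s p < δ.ord := by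
    intro p
    have : NoMaxOrder α := by
      have := Ordinal.isSuccPrelimit_type_lt_iff (α := α)
      rw [← this, Ordinal.type_toType]
      exact (isSuccLimit_ord hδ).isSuccPrelimit
    obtain ⟨q, hq⟩ := exists_gt (max p.1 p.2)
    rw [lt_ord, Ordinal.card_typein]
    have h1 : #{y // s y p} ≤ #(Set.Iio q) * #(Set.Iio q) := by
      refine (Set.embeddingOfSubset { x | s x p } (Set.Iio q ×ˢ Set.Iio q) ?_).cardinal_le.trans_eq
        (mk_setProd ..)
      intro x hx
      have hx := (hs_iff x p).1 hx
      have : max x.1 x.2 ≤ max p.1 p.2 := by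
        rcases hx with h | h
        exacts [h.le, h.1.le]
      exact ⟨(le_max_left _ _).trans_lt (this.trans_lt hq),
        (le_max_right _ _).trans_lt (this.trans_lt hq)⟩
    have h2 : #(Set.Iio q) < δ := by
      have := mk_Iio_lt q (by simp [α])
      simpa [α] using this
    exact h1.trans_lt (mul_lt_of_lt hδ h2 h2)
  have hsG : ∀ a b c d : Set.Iio δ.ord, s (e c, e d) (e a, e b) ↔
      GodelLT c.1.toZFSet d.1.toZFSet a.1.toZFSet b.1.toZFSet := by
    intro a b c d
    have hmax : ∀ a b : Set.Iio δ.ord, ((max a b : Set.Iio δ.ord) : Ordinal.{u}) = max a.1 b.1 :=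
      fun a b => Monotone.map_max (f := fun x : Set.Iio δ.ord => x.1) fun _ _ h => h
    rw [godelLT_toZFSet, hs_iff]
    simp only [Prod.Lex.toLex_lt_toLex, ← e.monotone.map_max, e.lt_iff_lt, e.injective.eq_iff,
      ← Subtype.coe_lt_coe, ← Subtype.coe_inj, hmax]
  classical
  let G : Ordinal.{u} → Ordinal.{u} → Ordinal.{u} := fun a b =>
    if h : a < δ.ord ∧ b < δ.ord then Ordinal.typein s (e ⟨a, h.1⟩, e ⟨b, h.2⟩) else 0
  have hG : ∀ a b : Set.Iio δ.ord, G a b = Ordinal.typein s (e a, e b) := by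
    rintro ⟨a, ha⟩ ⟨b, hb⟩
    have : a < δ.ord ∧ b < δ.ord := ⟨ha, hb⟩
    simp only [G, this, and_self, dif_pos]
  refine ⟨G, fun a ha b hb => ?_, fun a ha b hb c hc d hd h => ?_, fun a ha b hb γ => ?_⟩
  · rw [hG ⟨a, ha⟩ ⟨b, hb⟩]
    exact hlt _
  · rw [hG ⟨a, ha⟩ ⟨b, hb⟩, hG ⟨c, hc⟩ ⟨d, hd⟩, Ordinal.typein_inj, Prod.mk.injEq,
      e.injective.eq_iff, e.injective.eq_iff] at h
    exact ⟨congrArg Subtype.val h.1, congrArg Subtype.val h.2⟩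
  · rw [hG ⟨a, ha⟩ ⟨b, hb⟩]
    constructor
    · intro hγ
      obtain ⟨⟨c, d⟩, rfl⟩ := Ordinal.typein_surj s (hγ.trans (Ordinal.typein_lt_type s _))
      rw [Ordinal.typein_lt_typein] at hγ
      obtain ⟨c, rfl⟩ := e.surjective c
      obtain ⟨d, rfl⟩ := e.surjective d
      exact ⟨c, c.2, d, d.2, (hsG ⟨a, ha⟩ ⟨b, hb⟩ c d).1 hγ, hG c d⟩
    · rintro ⟨c, hc, d, hd, h, rfl⟩
      rw [hG ⟨c, hc⟩ ⟨d, hd⟩, Ordinal.typein_lt_typein]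
      exact (hsG ⟨a, ha⟩ ⟨b, hb⟩ ⟨c, hc⟩ ⟨d, hd⟩).2 h

/-- The canonical well-ordering of `D × D`, as a set of pairs. -/
noncomputable def godelRel (D : ZFSet.{u}) : ZFSet.{u} :=
  ZFSet.sep (fun w => ∃ a ∈ D, ∃ b ∈ D, ∃ c ∈ D, ∃ d ∈ D, ∃ p ∈ ZFSet.prod D D,
    ∃ q ∈ ZFSet.prod D D, p = ZFSet.pair a b ∧ q = ZFSet.pair c d ∧ w = ZFSet.pair p q ∧
      GodelLT a b c d) (ZFSet.prod (ZFSet.prod D D) (ZFSet.prod D D))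

theorem pair_mem_godelRel {D a b c d : ZFSet.{u}} (ha : a ∈ D) (hb : b ∈ D) (hc : c ∈ D)
    (hd : d ∈ D) :
    ZFSet.pair (ZFSet.pair a b) (ZFSet.pair c d) ∈ godelRel D ↔ GodelLT a b c d := by
  rw [godelRel, ZFSet.mem_sep]
  constructor
  · rintro ⟨-, a', -, b', -, c', -, d', -, p, -, q, -, rfl, rfl, h, h'⟩
    simp only [ZFSet.pair_inj] at h
    obtain ⟨⟨rfl, rfl⟩, rfl, rfl⟩ := h
    exact h'
  · intro h
    refine ⟨by simp [ha, hb, hc, hd], a, ha, b, hb, c, hc, d, hd, _, ?_, _, ?_, rfl, rfl, rfl,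
      h⟩ <;> simp [ha, hb, hc, hd]

instance D0.eq_prod {k n : ℕ} (f g h : Env.{u} k n → ZFSet.{u}) [IsVar f] [IsVar g] [IsVar h] :
    D0 (fun e => f e = ZFSet.prod (g e) (h e)) := by
  have := fun m => IsVar.comp (m := m) f
  have := fun m => IsVar.comp (m := m) g
  have := fun m => IsVar.comp (m := m) h
  have : D0 (fun e => (∀ w ∈ f e, ∃ a ∈ g e, ∃ b ∈ h e, w = ZFSet.pair a b) ∧
    ∀ a ∈ g e, ∀ b ∈ h e, ZFSet.pair a b ∈ f e) := inferInstance
  refine this.congr fun e => ⟨fun ⟨h1, h2⟩ => ?_, fun h => ?_⟩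
  · ext w
    rw [ZFSet.mem_prod]
    refine ⟨h1 w, ?_⟩
    rintro ⟨a, ha, b, hb, rfl⟩
    exact h2 a ha b hb
  · rw [h]
    exact ⟨fun w hw => ZFSet.mem_prod.1 hw, fun a ha b hb => by simp [ha, hb]⟩

/-- The product `P` is a separate witness so that pairs from `D` can be quantified over boundedly.
-/
instance D0.eq_godelRel {k n : ℕ} (D P Q : Env.{u} k n → ZFSet.{u}) [IsVar D] [IsVar P]
    [IsVar Q] : D0 (fun e => P e = ZFSet.prod (D e) (D e) ∧ Q e = godelRel (D e)) := by
  have := fun m => IsVar.comp (m := m) D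
  have := fun m => IsVar.comp (m := m) P
  have := fun m => IsVar.comp (m := m) Q
  have : D0 (fun e => P e = ZFSet.prod (D e) (D e) ∧ (∀ w ∈ Q e, ∃ p ∈ P e, ∃ q ∈ P e,
    w = ZFSet.pair p q) ∧ ∀ p ∈ P e, ∀ q ∈ P e, ZFSet.pair p q ∈ Q e ↔ ∃ a ∈ D e, ∃ b ∈ D e,
      ∃ c ∈ D e, ∃ d ∈ D e, p = ZFSet.pair a b ∧ q = ZFSet.pair c d ∧ GodelLT a b c d) :=
    inferInstance
  refine this.congr fun e => and_congr_right fun hP => ?_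
  have key : ∀ p ∈ P e, ∀ q ∈ P e, ZFSet.pair p q ∈ godelRel (D e) ↔ ∃ a ∈ D e, ∃ b ∈ D e,
      ∃ c ∈ D e, ∃ d ∈ D e, p = ZFSet.pair a b ∧ q = ZFSet.pair c d ∧ GodelLT a b c d := by
    intro p hp q hq
    rw [hP, ZFSet.mem_prod] at hp hq
    obtain ⟨a, ha, b, hb, rfl⟩ := hp
    obtain ⟨c, hc, d, hd, rfl⟩ := hq
    rw [pair_mem_godelRel ha hb hc hd]
    constructor
    · exact fun h => ⟨a, ha, b, hb, c, hc, d, hd, rfl, rfl, h⟩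
    · rintro ⟨a', -, b', -, c', -, d', -, h1, h2, h3⟩
      obtain ⟨rfl, rfl⟩ := ZFSet.pair_inj.1 h1
      obtain ⟨rfl, rfl⟩ := ZFSet.pair_inj.1 h2
      exact h3
  have hsub : ∀ w ∈ godelRel (D e), ∃ p ∈ P e, ∃ q ∈ P e, w = ZFSet.pair p q := by
    intro w hw
    rw [hP]
    exact ZFSet.mem_prod.1 (ZFSet.mem_sep.1 hw).1
  constructor
  · rintro ⟨h1, h2⟩
    ext w
    constructor
    · intro hw
      obtain ⟨p, hp, q, hq, rfl⟩ := h1 w hw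
      exact (key p hp q hq).2 ((h2 p hp q hq).1 hw)
    · intro hw
      obtain ⟨p, hp, q, hq, rfl⟩ := hsub w hw
      exact (h2 p hp q hq).2 ((key p hp q hq).1 hw)
  · intro h
    rw [h]
    exact ⟨hsub, key⟩

theorem IsTransitiveModel.godelRel_mem {N : Set ZFSet.{u}} (hN : IsTransitiveModel N)
    {D : ZFSet.{u}} (hD : D ∈ N) : godelRel D ∈ N :=
  have hP := hN.prod_mem hD hD
  hN.sep_mem (k := 2) (fun e => ∃ a ∈ e.1 0, ∃ b ∈ e.1 0, ∃ c ∈ e.1 0, ∃ d ∈ e.1 0, ∃ p ∈ e.1 1,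
    ∃ q ∈ e.1 1, p = ZFSet.pair a b ∧ q = ZFSet.pair c d ∧ top e = ZFSet.pair p q ∧
      GodelLT a b c d) ![D, ZFSet.prod D D] (by simp [Fin.forall_fin_two, hD, hP])
      (hN.prod_mem hP hP)

/-! ### The defining formula -/

/-- On the set `s`, the relation `f` is the Mostowski collapse of the relation `R`. -/
def IsCollapse (s R f : ZFSet.{u}) : Prop :=
  ∀ b ∈ s, ∃ y, ZFSet.pair b y ∈ f ∧ (∀ y', ZFSet.pair b y' ∈ f → y' = y) ∧
    (∀ z ∈ y, ∃ a ∈ s, ZFSet.pair a b ∈ R ∧ ZFSet.pair a z ∈ f) ∧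
    ∀ a ∈ s, ZFSet.pair a b ∈ R → ∃ z ∈ y, ZFSet.pair a z ∈ f

/-- On the set `D`, the relation `h` is a function with values in `S`. -/
def IsMapInto (D S h : ZFSet.{u}) : Prop :=
  ∀ i ∈ D, ∃ E ∈ S, ZFSet.pair i E ∈ h ∧ ∀ E', ZFSet.pair i E' ∈ h → E' = E

/-- The function `h` on the ordinal `D` is increasing. -/
def IsIncreasing (D h : ZFSet.{u}) : Prop :=
  ∀ i ∈ D, ∀ j ∈ D, i ∈ j → ∀ E, ZFSet.pair i E ∈ h → ∀ E', ZFSet.pair j E' ∈ h → E ⊆ E'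

/-- The set `S` consists of nonempty subsets of `θ` that `h` does not map onto `D`. -/
def AllSmall (D θ S h : ZFSet.{u}) : Prop :=
  ∀ E ∈ S, E ⊆ θ ∧ (∃ z ∈ E, True) ∧
    ¬ ∀ y ∈ D, ∃ z ∈ E, ZFSet.pair z y ∈ h ∧ ∀ y', ZFSet.pair z y' ∈ h → y' = y

/-- If `h` is a partial function from an element of `D` to `θ`, its range is covered by an element
of `S`. -/
def CoversRange (D θ S h : ZFSet.{u}) : Prop :=
  ∀ β ∈ D, (∀ i ∈ β, ∀ u, ZFSet.pair i u ∈ h → u ∈ θ ∧ ∀ u', ZFSet.pair i u' ∈ h → u' = u) →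
    ∃ E ∈ S, ∀ i ∈ β, ∀ u, ZFSet.pair i u ∈ h → u ∈ E

/-- The subset `r` of the ordinal `D` contains the code of the pair `(i, j)`. -/
def CodeMem (P Γ r i j : ZFSet.{u}) : Prop :=
  ∃ p ∈ P, p = ZFSet.pair i j ∧ ∃ k, ZFSet.pair p k ∈ Γ ∧ k ∈ r

/-- The function `g` enumerates the union of the range of `h` in such a way that the membership
relation and the relation `A` on its range are coded by elements of `a`. -/
def Enumerates (a D P Γ θ A h g : ZFSet.{u}) : Prop :=
  IsMapInto D θ g ∧
  (∀ i ∈ D, ∀ u, ZFSet.pair i u ∈ g → ∃ j ∈ D, ∃ E, ZFSet.pair j E ∈ h ∧ u ∈ E) ∧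
  (∀ j ∈ D, ∀ E, ZFSet.pair j E ∈ h → ∀ u ∈ E, ∃ i ∈ D, ZFSet.pair i u ∈ g) ∧
  ∃ r ∈ a, ∃ c ∈ a, ∀ i ∈ D, ∀ j ∈ D, ∀ u, ZFSet.pair i u ∈ g → ∀ v, ZFSet.pair j v ∈ g →
    (CodeMem P Γ r i j ↔ u ∈ v) ∧ (CodeMem P Γ c i j ↔ ZFSet.pair u v ∈ A)

/-! ### The clauses of the certificate are `Δ₀` -/

section

variable {k n : ℕ}

instance (s R f : Env.{u} k n → ZFSet.{u}) [IsVar s] [IsVar R] [IsVar f] :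
    D0 (fun e => IsCollapse (s e) (R e) (f e)) := by
  have := fun m => IsVar.comp (m := m) s
  have := fun m => IsVar.comp (m := m) R
  have := fun m => IsVar.comp (m := m) f
  unfold IsCollapse
  infer_instance

instance (D S h : Env.{u} k n → ZFSet.{u}) [IsVar D] [IsVar S] [IsVar h] :
    D0 (fun e => IsMapInto (D e) (S e) (h e)) := by
  have := fun m => IsVar.comp (m := m) S
  have := fun m => IsVar.comp (m := m) h
  unfold IsMapInto
  infer_instance

instance (D h : Env.{u} k n → ZFSet.{u}) [IsVar D] [IsVar h] :
    D0 (fun e => IsIncreasing (D e) (h e)) := by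
  have := fun m => IsVar.comp (m := m) D
  have := fun m => IsVar.comp (m := m) h
  unfold IsIncreasing
  infer_instance

instance (D θ S h : Env.{u} k n → ZFSet.{u}) [IsVar D] [IsVar θ] [IsVar S] [IsVar h] :
    D0 (fun e => AllSmall (D e) (θ e) (S e) (h e)) := by
  have := fun m => IsVar.comp (m := m) D
  have := fun m => IsVar.comp (m := m) θ
  have := fun m => IsVar.comp (m := m) h
  unfold AllSmall
  infer_instance

instance (D θ S h : Env.{u} k n → ZFSet.{u}) [IsVar D] [IsVar θ] [IsVar S] [IsVar h] :
    D0 (fun e => CoversRange (D e) (θ e) (S e) (h e)) := by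
  have := fun m => IsVar.comp (m := m) θ
  have := fun m => IsVar.comp (m := m) S
  have := fun m => IsVar.comp (m := m) h
  unfold CoversRange
  infer_instance

instance (P Γ r i j : Env.{u} k n → ZFSet.{u}) [IsVar P] [IsVar Γ] [IsVar r] [IsVar i] [IsVar j] :
    D0 (fun e => CodeMem (P e) (Γ e) (r e) (i e) (j e)) := by
  have := fun m => IsVar.comp (m := m) Γ
  have := fun m => IsVar.comp (m := m) r
  have := fun m => IsVar.comp (m := m) i
  have := fun m => IsVar.comp (m := m) j
  unfold CodeMem
  infer_instance

instance (a D P Γ θ A h g : Env.{u} k n → ZFSet.{u}) [IsVar a] [IsVar D] [IsVar P] [IsVar Γ]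
    [IsVar θ] [IsVar A] [IsVar h] [IsVar g] :
    D0 (fun e => Enumerates (a e) (D e) (P e) (Γ e) (θ e) (A e) (h e) (g e)) := by
  have := fun m => IsVar.comp (m := m) a
  have := fun m => IsVar.comp (m := m) D
  have := fun m => IsVar.comp (m := m) P
  have := fun m => IsVar.comp (m := m) Γ
  have := fun m => IsVar.comp (m := m) A
  have := fun m => IsVar.comp (m := m) h
  have := fun m => IsVar.comp (m := m) g
  unfold Enumerates
  refine @D0.and _ _ _ _ ?_ (@D0.and _ _ _ _ ?_ (@D0.and _ _ _ _ ?_ ?_)) <;> infer_instance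

end

/-- The `Δ₀` matrix of the defining formula. -/
def Certificate (x a D P Q Γ θ A f S G h : ZFSet.{u}) : Prop :=
  (D ∈ a ∧ ∀ y ∈ a, y ⊆ D) ∧ (P = ZFSet.prod D D ∧ Q = godelRel D) ∧ IsCollapse P Q Γ ∧
  (θ.IsOrdinal ∧ IsCollapse θ A f ∧ ∃ α ∈ θ, ZFSet.pair α x ∈ f) ∧
  AllSmall D θ S h ∧ CoversRange D θ S h ∧
  (IsMapInto D S h ∧ IsIncreasing D h → ∃ g ∈ G, Enumerates a D P Γ θ A h g)

/-- The predicate is defined by a `Σ₂` formula. -/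
def Sigma2 {k n : ℕ} (P : Env.{u} k n → Prop) : Prop :=
  ∃ φ : setLang.BoundedFormula (Fin k) n, IsSigma2 φ ∧ ∀ e, φ.Realize e.1 e.2 ↔ P e

theorem Sigma2.ex {k n : ℕ} {P : Env.{u} k n → ZFSet.{u} → Prop}
    (h : Sigma2 (fun e : Env.{u} k (n + 1) => P (pop e) (top e))) :
    Sigma2 (fun e => ∃ z, P e z) := by
  obtain ⟨φ, h1, h2⟩ := h
  refine ⟨φ.ex, .ex h1, fun e => ?_⟩
  rw [BoundedFormula.realize_ex]
  refine exists_congr fun z => ?_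
  have h3 := h2 (e.1, Fin.snoc e.2 z)
  simpa only [D0.pop_snoc, D0.top_snoc] using h3

theorem Sigma2.of_all {k n : ℕ} {P : Env.{u} k n → ZFSet.{u} → Prop}
    (h : D0 (fun e : Env.{u} k (n + 1) => P (pop e) (top e))) :
    Sigma2 (fun e => ∀ z, P e z) := by
  obtain ⟨φ, h1, h2⟩ := h.out
  refine ⟨φ.all, .of_pi1 (.all (.of_delta0 h1)), fun e => ?_⟩
  rw [BoundedFormula.realize_all]
  refine forall_congr' fun z => ?_
  have h3 := h2 (e.1, Fin.snoc e.2 z)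
  simpa only [D0.pop_snoc, D0.top_snoc] using h3

/-- `x` belongs to the model determined by the set `a`. -/
def Certified (x a : ZFSet.{u}) : Prop :=
  ∃ D P Q Γ θ A f S G, ∀ h, Certificate x a D P Q Γ θ A f S G h

theorem exists_formula : ∃ φ : setLang.Formula (Fin 2), IsSigma2 φ ∧
    ∀ x a : ZFSet.{u}, φ.Realize ![x, a] ↔ Certified x a := by
  have : Sigma2 (fun e : Env.{u} 2 0 => Certified (e.1 0) (e.1 1)) := by
    unfold Certified
    refine .ex (.ex (.ex (.ex (.ex (.ex (.ex (.ex (.ex (.of_all ?_)))))))))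
    unfold Certificate
    refine @D0.and _ _ _ _ ?_ (@D0.and _ _ _ _ ?_ (@D0.and _ _ _ _ ?_ (@D0.and _ _ _ _ ?_
      (@D0.and _ _ _ _ ?_ (@D0.and _ _ _ _ ?_ ?_))))) <;> infer_instance
  obtain ⟨φ, h1, h2⟩ := this
  refine ⟨φ, h1, fun x a => ?_⟩
  rw [Formula.Realize]
  convert h2 (![x, a], Fin.elim0) using 2 <;> rfl

/-! ### Certified sets belong to the model -/

/-- If `δ ≤ |E|`, the inverse of an injection of `δ` into `E` is a partial map of `E` onto `δ`,
contradicting the clause for that `h`. -/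
theorem card_lt_of_allSmall {δ : Cardinal.{u}} {θ S E : ZFSet.{u}}
    (hS : ∀ h, AllSmall δ.ord.toZFSet θ S h) (hE : E ∈ S) : E.card < δ := by
  by_contra! hcon
  obtain ⟨F, hF, hinj⟩ := exists_injOn_of_card_le (x := δ.ord.toZFSet) (y := E)
    (by rwa [Ordinal.card_toZFSet, card_ord])
  let h := ZFSet.range fun b : δ.ord.toZFSet => ZFSet.pair (F b) b
  have hh : ∀ z y, ZFSet.pair z y ∈ h ↔ y ∈ δ.ord.toZFSet ∧ z = F y := by
    intro z y
    rw [ZFSet.mem_range]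
    constructor
    · rintro ⟨b, hb⟩
      obtain ⟨rfl, rfl⟩ := ZFSet.pair_inj.1 hb
      exact ⟨b.2, rfl⟩
    · rintro ⟨hy, rfl⟩
      exact ⟨⟨y, hy⟩, rfl⟩
  refine (hS h E hE).2.2 fun y hy => ⟨F y, hF y hy, (hh _ _).2 ⟨hy, rfl⟩, fun y' hy' => ?_⟩
  obtain ⟨h1, h2⟩ := (hh _ _).1 hy'
  exact hinj _ h1 _ hy h2.symm

/-- `X` is the range of a partial function on the initial ordinal of its cardinality, which is an
element of `δ`; that function is used as `h`. -/
theorem exists_mem_of_coversRange {δ : Cardinal.{u}} {θ S X : ZFSet.{u}}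
    (hS : ∀ h, CoversRange δ.ord.toZFSet θ S h) (hX : X ⊆ θ) (hXc : X.card < δ) :
    ∃ E ∈ S, X ⊆ E := by
  obtain ⟨F, hF, hinj⟩ := exists_injOn_of_card_le (x := X) (y := X.card.ord.toZFSet)
    (by rw [Ordinal.card_toZFSet, card_ord])
  let h := ZFSet.range fun b : X => ZFSet.pair (F b) b
  have hh : ∀ z y, ZFSet.pair z y ∈ h ↔ y ∈ X ∧ z = F y := by
    intro z y
    rw [ZFSet.mem_range]
    constructor
    · rintro ⟨b, hb⟩
      obtain ⟨rfl, rfl⟩ := ZFSet.pair_inj.1 hb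
      exact ⟨b.2, rfl⟩
    · rintro ⟨hy, rfl⟩
      exact ⟨⟨y, hy⟩, rfl⟩
  obtain ⟨E, hE, hXE⟩ := hS h X.card.ord.toZFSet
    (Ordinal.toZFSet_mem_toZFSet_iff.2 (ord_lt_ord.2 hXc)) (by
      intro i _ u hu
      obtain ⟨h1, rfl⟩ := (hh _ _).1 hu
      refine ⟨hX h1, fun u' hu' => ?_⟩
      obtain ⟨h2, h3⟩ := (hh _ _).1 hu'
      exact hinj _ h2 _ h1 h3.symm)
  exact ⟨E, hE, fun u hu => hXE _ (hF u hu) u ((hh _ _).2 ⟨hu, rfl⟩)⟩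

/-- Members of `S` alternate with small covers from `N`. Both chains have the same union: the chain
in `S` can be fed to the certificate, while the chain in `N` puts the union into `N` by
approximation. -/
theorem IsApproxModel.exists_chain {δ : Cardinal.{u}} {N : Set ZFSet.{u}}
    (hN : IsApproxModel δ N) {θ S e₀ : ZFSet.{u}} (hθ : θ ∈ N)
    (hS : ∀ E ∈ S, E ⊆ θ ∧ E.card < δ) (hcov : ∀ X, X ⊆ θ → X.card < δ → ∃ E ∈ S, X ⊆ E)
    (he : e₀ ⊆ θ) (hec : e₀.card < δ) :
    ∃ E : Ordinal.{u} → ZFSet.{u}, (∀ i < δ.ord, E i ∈ S) ∧ (∀ i < δ.ord, e₀ ⊆ E i) ∧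
      (∀ j < δ.ord, ∀ i < j, E i ⊆ E j) ∧ ∃ e ∈ N, ∀ u, u ∈ e ↔ ∃ i < δ.ord, u ∈ E i := by
  have hstep : ∀ X : ZFSet.{u}, ∃ E F, X ⊆ θ → X.card < δ → (E ∈ S ∧ X ⊆ E) ∧
      F ∈ N ∧ F.card < δ ∧ E ⊆ F ∧ F ⊆ θ := by
    intro X
    by_cases hX : X ⊆ θ ∧ X.card < δ
    · obtain ⟨E, hE, hXE⟩ := hcov X hX.1 hX.2
      obtain ⟨F, hF⟩ := hN.exists_cover hθ (hS E hE).1 (hS E hE).2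
      exact ⟨E, F, fun _ _ => ⟨⟨hE, hXE⟩, hF⟩⟩
    · exact ⟨∅, ∅, fun h1 h2 => absurd ⟨h1, h2⟩ hX⟩
  choose E F hEF using hstep
  -- `X i` is what stage `i` must contain: `e₀` and all earlier covers from `N`. Regularity of `δ`
  -- keeps it small; then `E (X i) ∈ S` covers it, and `F (X i) ∈ N` covers that.
  let X : Ordinal.{u} → ZFSet.{u} := WellFounded.fix Ordinal.lt_wf fun i f =>
    e₀ ∪ ZFSet.iUnion fun j : Set.Iio i => F (f j j.2)
  have hX : ∀ i u, u ∈ X i ↔ u ∈ e₀ ∨ ∃ j < i, u ∈ F (X j) := by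
    intro i u
    have : X i = e₀ ∪ ZFSet.iUnion fun j : Set.Iio i => F (X j) := WellFounded.fix_eq _ _ _
    rw [this, ZFSet.mem_union, ZFSet.mem_iUnion]
    simp
  have hXs : ∀ i < δ.ord, X i ⊆ θ ∧ (X i).card < δ := by
    intro i
    induction i using WellFoundedLT.induction with
    | ind i ih =>
      intro hi
      have ih' := fun j hj => hEF (X j) (ih j hj (hj.trans hi)).1 (ih j hj (hj.trans hi)).2
      constructor
      · intro u hu
        obtain hu | ⟨j, hj, hu⟩ := (hX i u).1 hu
        exacts [he hu, (ih' j hj).2.2.2.2 hu]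
      · have h1 : (ZFSet.iUnion fun j : Set.Iio i => F (X j)).card < δ := by
          refine card_lt_of_cover hN.reg (y := i.toZFSet) (fun w => F (X w.rank)) ?_ ?_ ?_
          · rwa [Ordinal.card_toZFSet, ← lt_ord]
          · intro w hw
            obtain ⟨j, hj, rfl⟩ := Ordinal.mem_toZFSet_iff.1 hw
            rw [Ordinal.rank_toZFSet]
            exact (ih' j hj).2.2.1
          · intro z hz
            obtain ⟨j, hj⟩ := ZFSet.mem_iUnion.1 hz
            exact ⟨_, Ordinal.toZFSet_mem_toZFSet_iff.2 j.2, by rwa [Ordinal.rank_toZFSet]⟩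
        refine lt_of_le_of_lt (ZFSet.card_mono fun u hu => ?_)
          ((ZFSet.card_union_le (x := e₀)).trans_lt (add_lt_of_lt hN.reg.aleph0_le hec h1))
        obtain hu | ⟨j, hj, hu⟩ := (hX i u).1 hu
        · exact ZFSet.mem_union.2 (Or.inl hu)
        · exact ZFSet.mem_union.2 (Or.inr (ZFSet.mem_iUnion.2 ⟨⟨j, hj⟩, hu⟩))
  have hP := fun i hi => hEF (X i) (hXs i hi).1 (hXs i hi).2
  have hmono : ∀ j < δ.ord, ∀ i < j, F (X i) ⊆ X j := fun j _ i hij u hu =>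
    (hX j u).2 (Or.inr ⟨i, hij, hu⟩)
  have hlim : ∀ i < δ.ord, Order.succ i < δ.ord := fun i hi =>
    (isSuccLimit_ord hN.reg.aleph0_le).succ_lt hi
  refine ⟨fun i => E (X i), fun i hi => (hP i hi).1.1,
    fun i hi u hu => (hP i hi).1.2 ((hX i u).2 (Or.inl hu)), fun j hj i hij u hu => ?_, _,
    hN.app δ hN.reg.cof_ord.ge (fun i => F (X i)) (fun i => (hP i i.2).2.1) ?_, fun u => ?_⟩
  · exact (hP j hj).1.2 (hmono j hj i hij ((hP i (hij.trans hj)).2.2.2.1 hu))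
  · intro i j hij
    obtain rfl | hij := hij.eq_or_lt
    · exact fun _ h => h
    · exact fun u hu => (hP j j.2).2.2.2.1 ((hP j j.2).1.2 (hmono j j.2 i hij hu))
  · rw [ZFSet.mem_iUnion]
    constructor
    · rintro ⟨i, hi⟩
      exact ⟨_, hlim i i.2, (hP _ (hlim i i.2)).1.2 (hmono _ (hlim i i.2) i (Order.lt_succ i.1) hi)⟩
    · rintro ⟨i, hi, hu⟩
      exact ⟨⟨i, hi⟩, (hP i hi).2.2.2.1 hu⟩

/-! ### Enumerations and collapses recovered inside the model -/

namespace IsTransitiveModel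

variable {N : Set ZFSet.{u}}

/-- An enumeration of a set of ordinals is in `N` if the induced relation is. -/
theorem graphOn_mem_of_rel (hN : IsTransitiveModel N) {D e R : ZFSet.{u}} (hD : D ∈ N)
    (he : e ∈ N) (hR : R ∈ N) (heo : ∀ u ∈ e, u.IsOrdinal) {g : ZFSet.{u} → ZFSet.{u}}
    (hg : ∀ i ∈ D, g i ∈ e) (hg' : ∀ u ∈ e, ∃ i ∈ D, g i = u)
    (hgR : ∀ i ∈ D, ∀ j ∈ D, ZFSet.pair i j ∈ R ↔ g i ∈ g j) : graphOn g D ∈ N := by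
  -- `π` is the collapse of `(e, ∈)`, injective on `e` because distinct ordinals are comparable
  -- under `∈`. Since `R` is the pullback of `∈` along `g`, its collapse is `π ∘ g`. Both collapses
  -- lie in `N`, and `g i` is the unique `u ∈ e` with `π u = π (g i)`.
  obtain ⟨π, hπ⟩ : ∃ π : ZFSet.{u} → ZFSet.{u}, ∀ b z, z ∈ π b ↔ ∃ a ∈ b, a ∈ e ∧ z = π a := by
    let π : ZFSet.{u} → ZFSet.{u} := WellFounded.fix ZFSet.mem_wf fun b f =>
      ZFSet.range fun a : (b ∩ e : ZFSet.{u}) => f a (ZFSet.mem_inter.1 a.2).1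
    refine ⟨π, fun b z => ?_⟩
    have : π b = ZFSet.range fun a : (b ∩ e : ZFSet.{u}) => π a := WellFounded.fix_eq _ _ _
    rw [this, ZFSet.mem_range]
    constructor
    · rintro ⟨a, rfl⟩
      exact ⟨a, (ZFSet.mem_inter.1 a.2).1, (ZFSet.mem_inter.1 a.2).2, rfl⟩
    · rintro ⟨a, ha, hae, rfl⟩
      exact ⟨⟨a, ZFSet.mem_inter.2 ⟨ha, hae⟩⟩, rfl⟩
  have hπinj : ∀ a ∈ e, ∀ b ∈ e, π a = π b → a = b := by
    intro a ha b hb hab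
    obtain h | h | h := (heo a ha).mem_trichotomous (heo b hb)
    · exact absurd ((hπ b (π a)).2 ⟨a, h, ha, rfl⟩) (hab ▸ ZFSet.mem_irrefl _)
    · exact h
    · exact absurd ((hπ a (π b)).2 ⟨b, h, hb, rfl⟩) (hab ▸ ZFSet.mem_irrefl _)
  have hmemR := hN.sep_mem (k := 1) (fun e => ∃ a ∈ e.1 0, ∃ b ∈ e.1 0, a ∈ b ∧
    top e = ZFSet.pair a b) ![e] (by simp [he]) (hN.prod_mem he he)
  have h1 : graphOn π e ∈ N := by
    refine hN.graphOn_mem_of_collapse he hmemR fun b hb z => ?_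
    rw [hπ]
    refine exists_congr fun a => ?_
    rw [ZFSet.mem_sep]
    constructor
    · rintro ⟨hab, ha, rfl⟩
      exact ⟨ha, ⟨by simp [ha, hb], a, ha, b, hb, hab, rfl⟩, rfl⟩
    · rintro ⟨ha, ⟨-, a', -, b', -, hab, h⟩, rfl⟩
      obtain ⟨rfl, rfl⟩ := ZFSet.pair_inj.1 h
      exact ⟨hab, ha, rfl⟩
  have h2 : graphOn (fun i => π (g i)) D ∈ N := by
    refine hN.graphOn_mem_of_collapse hD hR fun b hb z => ?_
    rw [hπ]
    constructor
    · rintro ⟨a, hab, ha, rfl⟩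
      obtain ⟨i, hi, rfl⟩ := hg' a ha
      exact ⟨i, hi, (hgR i hi b hb).2 hab, rfl⟩
    · rintro ⟨i, hi, hib, rfl⟩
      exact ⟨g i, (hgR i hi b hb).1 hib, hg i hi, rfl⟩
  convert hN.sep_mem (k := 4) (fun e => ∃ i ∈ e.1 0, ∃ u ∈ e.1 1, top e = ZFSet.pair i u ∧
    ∃ z, ZFSet.pair i z ∈ e.1 2 ∧ ZFSet.pair u z ∈ e.1 3)
    ![D, e, graphOn (fun i => π (g i)) D, graphOn π e]
    (by simp [Fin.forall_fin_succ, hD, he, h1, h2]) (hN.prod_mem hD he) using 1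
  ext w
  refine Iff.trans ?_ ZFSet.mem_sep.symm
  change _ ↔ w ∈ ZFSet.prod D e ∧ ∃ i ∈ D, ∃ u ∈ e, w = ZFSet.pair i u ∧
    ∃ z, ZFSet.pair i z ∈ graphOn (fun i => π (g i)) D ∧ ZFSet.pair u z ∈ graphOn π e
  rw [mem_graphOn]
  constructor
  · rintro ⟨i, hi, rfl⟩
    exact ⟨by simp [hi, hg i hi], i, hi, g i, hg i hi, rfl, _, pair_mem_graphOn.2 ⟨hi, rfl⟩,
      pair_mem_graphOn.2 ⟨hg i hi, rfl⟩⟩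
  · rintro ⟨-, i, hi, u, hu, rfl, z, hz, hz'⟩
    refine ⟨i, hi, ?_⟩
    rw [hπinj u hu (g i) (hg i hi)
      ((pair_mem_graphOn.1 hz').2.symm.trans (pair_mem_graphOn.1 hz).2)]

/-- The witness `f` need not lie in `N`, but its values on `s` form a collapse of a relation in `N`,
so that part of it does. Only the values of `R` on `s` matter, whence the replacement `R'`. -/
theorem exists_graphOn_of_isCollapse (hN : IsTransitiveModel N) {s R R' f : ZFSet.{u}}
    (hs : s ∈ N) (hR : R' ∈ N)
    (hRR : ∀ a ∈ s, ∀ b ∈ s, ZFSet.pair a b ∈ R' ↔ ZFSet.pair a b ∈ R) (hf : IsCollapse s R f) :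
    ∃ F : ZFSet.{u} → ZFSet.{u}, graphOn F s ∈ N ∧
      ∀ b ∈ s, ∀ y, ZFSet.pair b y ∈ f ↔ y = F b := by
  choose! F hF1 hF2 hF3 hF4 using hf
  have hF : ∀ b ∈ s, ∀ y, ZFSet.pair b y ∈ f ↔ y = F b := fun b hb y =>
    ⟨hF2 b hb y, fun h => h ▸ hF1 b hb⟩
  refine ⟨F, hN.graphOn_mem_of_collapse hs hR fun b hb z => ⟨fun hz => ?_, ?_⟩, hF⟩
  · obtain ⟨a, ha, hab, haz⟩ := hF3 b hb z hz
    exact ⟨a, ha, (hRR a ha b hb).2 hab, (hF a ha z).1 haz⟩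
  · rintro ⟨a, ha, hab, rfl⟩
    obtain ⟨z, hz, haz⟩ := hF4 b hb a ha ((hRR a ha b hb).1 hab)
    rwa [← (hF a ha z).1 haz]

end IsTransitiveModel

theorem codeMem_congr {P Γ Γ' r i j : ZFSet.{u}}
    (h : ∀ p ∈ P, ∀ k, ZFSet.pair p k ∈ Γ ↔ ZFSet.pair p k ∈ Γ') :
    CodeMem P Γ r i j ↔ CodeMem P Γ' r i j := by
  unfold CodeMem
  exact exists_congr fun p => and_congr_right fun hp => and_congr_right fun _ =>
    exists_congr fun k => by rw [h p hp k]

theorem exists_function {D S h : ZFSet.{u}} (H : IsMapInto D S h) :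
    ∃ F : ZFSet.{u} → ZFSet.{u}, (∀ i ∈ D, F i ∈ S) ∧
      ∀ i ∈ D, ∀ y, ZFSet.pair i y ∈ h ↔ y = F i := by
  choose! F hF1 hF2 hF3 using H
  exact ⟨F, hF1, fun i hi y => ⟨hF3 i hi y, fun h => h ▸ hF2 i hi⟩⟩

/-! ### Decoding a certificate -/

namespace IsApproxModel

variable {δ : Cardinal.{u}} {N : Set ZFSet.{u}}

theorem mem_powersetIn {x : ZFSet.{u}} :
    x ∈ powersetIn δ N ↔ x ⊆ δ.ord.toZFSet ∧ x ∈ N := by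
  rw [powersetIn, ZFSet.mem_sep, ZFSet.mem_powerset]

theorem exists_coordinates (hN : IsApproxModel δ N) {θ τ : ZFSet.{u}} (hτ : τ.card < δ) :
    ∃ e ⊆ θ, e.card < δ ∧ ∀ u ∈ θ, ∀ v ∈ θ, ZFSet.pair u v ∈ τ → u ∈ e ∧ v ∈ e := by
  let e₁ := ZFSet.sep (fun u => ∃ v, ZFSet.pair u v ∈ τ) θ
  let e₂ := ZFSet.sep (fun v => ∃ u, ZFSet.pair u v ∈ τ) θ
  have h₁ : e₁.card < δ := by
    refine (card_le_of_rel (y := τ) (fun w u => ∃ v, w = ZFSet.pair u v) ?_ ?_).trans_lt hτ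
    · intro u hu
      obtain ⟨-, v, hv⟩ := ZFSet.mem_sep.1 hu
      exact ⟨_, hv, v, rfl⟩
    · rintro w - u - u' - ⟨v, rfl⟩ ⟨v', h⟩
      exact (ZFSet.pair_inj.1 h).1
  have h₂ : e₂.card < δ := by
    refine (card_le_of_rel (y := τ) (fun w v => ∃ u, w = ZFSet.pair u v) ?_ ?_).trans_lt hτ
    · intro u hu
      obtain ⟨-, v, hv⟩ := ZFSet.mem_sep.1 hu
      exact ⟨_, hv, v, rfl⟩
    · rintro w - u - u' - ⟨v, rfl⟩ ⟨v', h⟩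
      exact (ZFSet.pair_inj.1 h).2
  refine ⟨e₁ ∪ e₂, ?_, ZFSet.card_union_le.trans_lt (add_lt_of_lt hN.reg.aleph0_le h₁ h₂),
    fun u hu v hv h => ?_⟩
  · intro u hu
    obtain hu | hu := ZFSet.mem_union.1 hu <;> exact (ZFSet.mem_sep.1 hu).1
  · exact ⟨ZFSet.mem_union.2 (Or.inl (ZFSet.mem_sep.2 ⟨hu, v, h⟩)),
      ZFSet.mem_union.2 (Or.inr (ZFSet.mem_sep.2 ⟨hv, u, h⟩))⟩

/-- Small pieces of a binary relation are decoded from subsets of `δ` in the model. -/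
theorem inter_mem_of_certificate (hN : IsApproxModel δ N) {P Γ θ A S G τ : ZFSet.{u}}
    (hθ : θ ∈ N) (hθo : θ.IsOrdinal)
    (hP : P = ZFSet.prod δ.ord.toZFSet δ.ord.toZFSet) (hΓ : Γ ∈ N)
    (hS1 : ∀ h, AllSmall δ.ord.toZFSet θ S h) (hS2 : ∀ h, CoversRange δ.ord.toZFSet θ S h)
    (hG : ∀ h, IsMapInto δ.ord.toZFSet S h ∧ IsIncreasing δ.ord.toZFSet h →
      ∃ g ∈ G, Enumerates (powersetIn δ N) δ.ord.toZFSet P Γ θ A h g)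
    (hτ : τ ∈ N) (hτc : τ.card < δ) (hτθ : τ ⊆ ZFSet.prod θ θ) : A ∩ τ ∈ N := by
  have hM := hN.model
  have hD := hN.toZFSet_mem δ.ord
  obtain ⟨e₀, he₀, he₀c, hcoord⟩ := hN.exists_coordinates (θ := θ) hτc
  -- The chain starts above the coordinates `e₀` of `τ`, so every pair of `τ` has both coordinates
  -- in the union `e`, where `A` is coded.
  obtain ⟨E, hES, he₀E, hE, e, he, hemem⟩ := hN.exists_chain hθ
    (fun E hE => ⟨(hS1 ∅ E hE).1, card_lt_of_allSmall hS1 hE⟩)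
    (fun X => exists_mem_of_coversRange hS2) he₀ he₀c
  obtain ⟨h, hh⟩ : ∃ h, h = graphOn (fun z => E z.rank) δ.ord.toZFSet := ⟨_, rfl⟩
  have hpair : ∀ i < δ.ord, ∀ y, ZFSet.pair i.toZFSet y ∈ h ↔ y = E i := by
    intro i hi y
    rw [hh, pair_mem_graphOn, Ordinal.rank_toZFSet, Ordinal.toZFSet_mem_toZFSet_iff,
      and_iff_right hi]
  obtain ⟨g, -, hg1, hg2, hg3, r, hr, c, hc, hrc⟩ := hG h (by
    constructor
    · intro i hi
      obtain ⟨i, hi', rfl⟩ := Ordinal.mem_toZFSet_iff.1 hi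
      exact ⟨E i, hES i hi', (hpair i hi' _).2 rfl, fun E' => (hpair i hi' E').1⟩
    · intro i hi j hj hij E₁ h₁ E₂ h₂
      obtain ⟨i, hi', rfl⟩ := Ordinal.mem_toZFSet_iff.1 hi
      obtain ⟨j, hj', rfl⟩ := Ordinal.mem_toZFSet_iff.1 hj
      rw [(hpair i hi' _).1 h₁, (hpair j hj' _).1 h₂]
      exact hE j hj' i (Ordinal.toZFSet_mem_toZFSet_iff.1 hij))
  obtain ⟨F, hFθ, hF⟩ := exists_function hg1
  have hrN := (mem_powersetIn.1 hr).2
  have hcN := (mem_powersetIn.1 hc).2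
  have hPN : P ∈ N := hP ▸ hM.prod_mem hD hD
  have hFe : ∀ i ∈ δ.ord.toZFSet, F i ∈ e := by
    intro i hi
    obtain ⟨j, hj, E', hE', hu⟩ := hg2 i hi (F i) ((hF i hi _).2 rfl)
    obtain ⟨j, hj', rfl⟩ := Ordinal.mem_toZFSet_iff.1 hj
    rw [hpair j hj'] at hE'
    exact (hemem _).2 ⟨j, hj', hE' ▸ hu⟩
  have hFe' : ∀ u ∈ e, ∃ i ∈ δ.ord.toZFSet, F i = u := by
    intro u hu
    obtain ⟨j, hj, hu⟩ := (hemem u).1 hu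
    obtain ⟨i, hi, hiu⟩ := hg3 j.toZFSet (Ordinal.toZFSet_mem_toZFSet_iff.2 hj) _
      ((hpair j hj _).2 rfl) u hu
    exact ⟨i, hi, ((hF i hi u).1 hiu).symm⟩
  have hcode : ∀ i ∈ δ.ord.toZFSet, ∀ j ∈ δ.ord.toZFSet,
      (CodeMem P Γ r i j ↔ F i ∈ F j) ∧ (CodeMem P Γ c i j ↔ ZFSet.pair (F i) (F j) ∈ A) :=
    fun i hi j hj => hrc i hi j hj _ ((hF i hi _).2 rfl) _ ((hF j hj _).2 rfl)
  have hR := hM.sep_mem (k := 4) (fun e => ∃ i ∈ e.1 0, ∃ j ∈ e.1 0, top e = ZFSet.pair i j ∧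
    CodeMem (e.1 1) (e.1 2) (e.1 3) i j) ![δ.ord.toZFSet, P, Γ, r]
    (by simp [Fin.forall_fin_succ, hD, hPN, hΓ, hrN]) (hM.prod_mem hD hD)
  have hgN : graphOn F δ.ord.toZFSet ∈ N := by
    refine hM.graphOn_mem_of_rel hD he hR (fun u hu => ?_) hFe hFe' fun i hi j hj => ?_
    · obtain ⟨i, hi, rfl⟩ := hFe' u hu
      exact hθo.mem (hFθ i hi)
    · rw [ZFSet.mem_sep, ← (hcode i hi j hj).1]
      constructor
      · rintro ⟨-, i', -, j', -, h, h'⟩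
        obtain ⟨rfl, rfl⟩ := ZFSet.pair_inj.1 h
        exact h'
      · exact fun h => ⟨by simp [hi, hj], i, hi, j, hj, rfl, h⟩
  -- With the enumeration now in `N`, a pair of `τ` is in `A` exactly when it is `(F i, F j)` for
  -- indices whose code is in `c`.
  convert hM.sep_mem (k := 5) (fun e => ∃ i ∈ e.1 0, ∃ j ∈ e.1 0, ∃ u, ZFSet.pair i u ∈ e.1 4 ∧
    ∃ v, ZFSet.pair j v ∈ e.1 4 ∧ top e = ZFSet.pair u v ∧ CodeMem (e.1 1) (e.1 2) (e.1 3) i j)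
    ![δ.ord.toZFSet, P, Γ, c, graphOn F δ.ord.toZFSet]
    (by simp [Fin.forall_fin_succ, hD, hPN, hΓ, hcN, hgN]) hτ using 1
  ext w
  refine Iff.trans ?_ ZFSet.mem_sep.symm
  change _ ↔ w ∈ τ ∧ ∃ i ∈ δ.ord.toZFSet, ∃ j ∈ δ.ord.toZFSet,
    ∃ u, ZFSet.pair i u ∈ graphOn F δ.ord.toZFSet ∧ ∃ v, ZFSet.pair j v ∈ graphOn F δ.ord.toZFSet ∧
      w = ZFSet.pair u v ∧ CodeMem P Γ c i j
  rw [ZFSet.mem_inter, and_comm]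
  refine and_congr_right fun hw => ⟨fun hwA => ?_, ?_⟩
  · obtain ⟨u, hu, v, hv, rfl⟩ := ZFSet.mem_prod.1 (hτθ hw)
    obtain ⟨hue, hve⟩ := hcoord u hu v hv hw
    have h0 : 0 < δ.ord := ord_pos.2 hN.reg.pos
    obtain ⟨i, hi, rfl⟩ := hFe' u ((hemem u).2 ⟨0, h0, he₀E 0 h0 hue⟩)
    obtain ⟨j, hj, rfl⟩ := hFe' v ((hemem v).2 ⟨0, h0, he₀E 0 h0 hve⟩)
    exact ⟨i, hi, j, hj, _, pair_mem_graphOn.2 ⟨hi, rfl⟩, _, pair_mem_graphOn.2 ⟨hj, rfl⟩, rfl,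
      (hcode i hi j hj).2.2 hwA⟩
  · rintro ⟨i, hi, j, hj, u, hu, v, hv, rfl, h⟩
    rw [(pair_mem_graphOn.1 hu).2, (pair_mem_graphOn.1 hv).2]
    exact (hcode i hi j hj).2.1 h

theorem mem_of_certified (hN : IsApproxModel δ N) {x : ZFSet.{u}}
    (hx : Certified x (powersetIn δ N)) : x ∈ N := by
  obtain ⟨D, P, Q, Γ, θ, A, f, S, G, hc⟩ := hx
  have hM := hN.model
  have hδ := hN.toZFSet_mem δ.ord
  -- The clauses read off here do not depend on `h`, so any value serves. The set `D` must be `δ`,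
  -- the largest element of `a` under inclusion.
  obtain ⟨⟨hDa, hD⟩, ⟨hP, hQ⟩, hΓ, ⟨hθ, hf, α, hα, hαx⟩, -⟩ := hc ∅
  obtain rfl : D = δ.ord.toZFSet := subset_antisymm (mem_powersetIn.1 hDa).1
    (hD _ (mem_powersetIn.2 ⟨fun _ h => h, hδ⟩))
  have hS1 := fun h => (hc h).2.2.2.2.1
  have hS2 := fun h => (hc h).2.2.2.2.2.1
  have hG := fun h => (hc h).2.2.2.2.2.2
  have hPN : P ∈ N := hP ▸ hM.prod_mem hδ hδ
  have hθN : θ ∈ N := hθ.toZFSet_rank_eq ▸ hN.toZFSet_mem θ.rank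
  obtain ⟨Γ', hΓ'N, hΓ'⟩ := hM.exists_graphOn_of_isCollapse hPN (hM.godelRel_mem hδ)
    (fun a _ b _ => by rw [hQ]) hΓ
  have hcongr : ∀ r i j, CodeMem P Γ r i j ↔ CodeMem P (graphOn Γ' P) r i j := fun r i j =>
    codeMem_congr fun p hp k => by rw [hΓ' p hp, pair_mem_graphOn, and_iff_right hp]
  -- The witness `A` may contain things other than pairs from `θ`; only its part on `θ` is decoded,
  -- and the collapse sees nothing else.
  have hA : A ∩ ZFSet.prod θ θ ∈ N := by
    refine hN.mem_of_forall_inter_mem (hM.prod_mem hθN hθN)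
      (fun w hw => (ZFSet.mem_inter.1 hw).2) fun τ hτ hτc hτθ => ?_
    convert hN.inter_mem_of_certificate hθN hθ hP hΓ'N hS1 hS2 (G := G) (A := A) (fun h hh => by
      simpa only [Enumerates, hcongr] using hG h hh) hτ hτc hτθ using 1
    ext w
    simp only [ZFSet.mem_inter]
    exact ⟨fun h => ⟨h.1.1, h.2⟩, fun h => ⟨⟨h.1, hτθ h.2⟩, h.2⟩⟩
  obtain ⟨F, hFN, hF⟩ := hM.exists_graphOn_of_isCollapse hθN hA
    (fun a ha b hb => by simp [ha, hb]) hf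
  exact (hM.of_pair_mem (hM.mem_of_mem hFN (pair_mem_graphOn.2 ⟨hα, (hF α hα x).1 hαx⟩))).2

end IsApproxModel

/-! ### Elements of the model are certified -/

theorem IsTransitiveModel.graphOn_comp_mem {N : Set ZFSet.{u}} (hN : IsTransitiveModel N)
    {D s : ZFSet.{u}} {F H : ZFSet.{u} → ZFSet.{u}} (hD : D ∈ N) (hF : graphOn F D ∈ N)
    (hH : graphOn H s ∈ N) (hFs : ∀ i ∈ D, F i ∈ s) : graphOn (fun i => H (F i)) D ∈ N := by
  have ht := hN.sUnion_mem (hN.sUnion_mem hH)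
  set t := ZFSet.sUnion (ZFSet.sUnion (graphOn H s)) with htdef
  convert hN.sep_mem (k := 4) (fun e => ∃ i ∈ e.1 0, ∃ u ∈ e.1 1, top e = ZFSet.pair i u ∧
    ∃ v, ZFSet.pair i v ∈ e.1 2 ∧ ZFSet.pair v u ∈ e.1 3) ![D, t, graphOn F D, graphOn H s]
    (by simp [Fin.forall_fin_succ, hD, ht, hF, hH]) (hN.prod_mem hD ht) using 1
  ext w
  refine Iff.trans ?_ ZFSet.mem_sep.symm
  change _ ↔ w ∈ ZFSet.prod D t ∧ ∃ i ∈ D, ∃ u ∈ t, w = ZFSet.pair i u ∧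
    ∃ v, ZFSet.pair i v ∈ graphOn F D ∧ ZFSet.pair v u ∈ graphOn H s
  rw [mem_graphOn]
  constructor
  · rintro ⟨i, hi, rfl⟩
    have h := pair_mem_graphOn.2 ⟨hFs i hi, (rfl : H (F i) = H (F i))⟩
    have hit : H (F i) ∈ t := mem_sUnion_sUnion_of_pair_mem h
    exact ⟨by simp [hi, hit], i, hi, _, hit, rfl, F i, pair_mem_graphOn.2 ⟨hi, rfl⟩, h⟩
  · rintro ⟨-, i, hi, u, -, rfl, v, hv, hu⟩
    exact ⟨i, hi, by rw [(pair_mem_graphOn.1 hu).2, (pair_mem_graphOn.1 hv).2]⟩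

theorem isCollapse_graphOn {s R : ZFSet.{u}} {F : ZFSet.{u} → ZFSet.{u}}
    (hF : ∀ b ∈ s, ∀ z, z ∈ F b ↔ ∃ a ∈ s, ZFSet.pair a b ∈ R ∧ z = F a) :
    IsCollapse s R (graphOn F s) := by
  intro b hb
  refine ⟨F b, pair_mem_graphOn.2 ⟨hb, rfl⟩, fun y' h => (pair_mem_graphOn.1 h).2,
    fun z hz => ?_, fun a ha hab => ?_⟩
  · obtain ⟨a, ha, hab, rfl⟩ := (hF b hb z).1 hz
    exact ⟨a, ha, hab, pair_mem_graphOn.2 ⟨ha, rfl⟩⟩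
  · exact ⟨F a, (hF b hb _).2 ⟨a, ha, hab, rfl⟩, pair_mem_graphOn.2 ⟨ha, rfl⟩⟩

/-- The rank function of the canonical order, written as a set function, is the Mostowski collapse
of that order. This puts Gödel pairing into the model and makes it recognisable by a `Δ₀` clause. -/
theorem exists_godel_collapse {δ : Cardinal.{u}} (hδ : ℵ₀ ≤ δ) {D : ZFSet.{u}}
    (hD : D = δ.ord.toZFSet) :
    ∃ Γ : ZFSet.{u} → ZFSet.{u}, (∀ i ∈ D, ∀ j ∈ D, Γ (ZFSet.pair i j) ∈ D) ∧
      (∀ p ∈ ZFSet.prod D D, ∀ q ∈ ZFSet.prod D D, Γ p = Γ q → p = q) ∧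
      ∀ p ∈ ZFSet.prod D D, ∀ z, z ∈ Γ p ↔
        ∃ q ∈ ZFSet.prod D D, ZFSet.pair q p ∈ godelRel D ∧ z = Γ q := by
  obtain ⟨G, hG, hGinj, hGlt⟩ := exists_godel_pairing hδ
  have : ∀ p : ZFSet.{u}, ∃ y, ∀ a b : Ordinal.{u}, p = ZFSet.pair a.toZFSet b.toZFSet →
      y = (G a b).toZFSet := by
    intro p
    by_cases h : ∃ a b : Ordinal.{u}, p = ZFSet.pair a.toZFSet b.toZFSet
    · obtain ⟨a, b, rfl⟩ := h
      refine ⟨(G a b).toZFSet, fun c d h => ?_⟩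
      obtain ⟨h1, h2⟩ := ZFSet.pair_inj.1 h
      rw [← Ordinal.toZFSet_injective h1, ← Ordinal.toZFSet_injective h2]
    · exact ⟨∅, fun a b hab => absurd ⟨a, b, hab⟩ h⟩
  choose Γ hΓ' using this
  have hΓ : ∀ a b : Ordinal.{u}, Γ (ZFSet.pair a.toZFSet b.toZFSet) = (G a b).toZFSet :=
    fun a b => hΓ' _ a b rfl
  have hmem : ∀ p ∈ ZFSet.prod D D, ∃ a < δ.ord, ∃ b < δ.ord,
      p = ZFSet.pair a.toZFSet b.toZFSet := by
    intro p hp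
    obtain ⟨i, hi, j, hj, rfl⟩ := ZFSet.mem_prod.1 hp
    rw [hD] at hi hj
    obtain ⟨a, ha, rfl⟩ := Ordinal.mem_toZFSet_iff.1 hi
    obtain ⟨b, hb, rfl⟩ := Ordinal.mem_toZFSet_iff.1 hj
    exact ⟨a, ha, b, hb, rfl⟩
  have hDm : ∀ a < δ.ord, a.toZFSet ∈ D := fun a ha => hD ▸ Ordinal.toZFSet_mem_toZFSet_iff.2 ha
  refine ⟨Γ, fun i hi j hj => ?_, fun p hp q hq h => ?_, fun p hp z => ?_⟩
  · obtain ⟨a, ha, b, hb, h⟩ := hmem (ZFSet.pair i j) (by simp [hi, hj])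
    rw [h, hΓ]
    exact hDm _ (hG a ha b hb)
  · obtain ⟨a, ha, b, hb, rfl⟩ := hmem p hp
    obtain ⟨c, hc, d, hd, rfl⟩ := hmem q hq
    rw [hΓ, hΓ] at h
    obtain ⟨rfl, rfl⟩ := hGinj a ha b hb c hc d hd (Ordinal.toZFSet_injective h)
    rfl
  · obtain ⟨a, ha, b, hb, rfl⟩ := hmem p hp
    rw [hΓ, Ordinal.mem_toZFSet_iff]
    constructor
    · rintro ⟨γ, hγ, rfl⟩
      obtain ⟨c, hc, d, hd, h, rfl⟩ := (hGlt a ha b hb γ).1 hγ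
      exact ⟨ZFSet.pair c.toZFSet d.toZFSet, by simp [hDm c hc, hDm d hd],
        (pair_mem_godelRel (hDm c hc) (hDm d hd) (hDm a ha) (hDm b hb)).2 h, (hΓ c d).symm⟩
    · rintro ⟨q, hq, hqp, rfl⟩
      obtain ⟨c, hc, d, hd, rfl⟩ := hmem q hq
      rw [pair_mem_godelRel (hDm c hc) (hDm d hd) (hDm a ha) (hDm b hb)] at hqp
      exact ⟨G c d, (hGlt a ha b hb _).2 ⟨c, hc, d, hd, hqp, rfl⟩, (hΓ c d).symm⟩

/-! ### Enumerations of length `δ` and construction of certificates -/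

namespace IsApproxModel

variable {δ : Cardinal.{u}} {N : Set ZFSet.{u}}

/-- In `N`, the cardinal `δ` maps onto every nonzero ordinal below `δ⁺`. -/
theorem exists_surjection_of_lt_succ (hN : IsApproxModel δ N) (hsucc : ComputesSucc δ N)
    {η : Ordinal.{u}} (h0 : 0 < η) (hη : η < (Order.succ δ).ord) :
    ∃ F : ZFSet.{u} → ZFSet.{u}, graphOn F δ.ord.toZFSet ∈ N ∧
      (∀ i ∈ δ.ord.toZFSet, F i ∈ η.toZFSet) ∧
      ∀ u ∈ η.toZFSet, ∃ i ∈ δ.ord.toZFSet, F i = u := by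
  have hM := hN.model
  have hD := hN.toZFSet_mem δ.ord
  induction η using WellFoundedLT.induction with
  | ind η ih =>
    have hηN := hN.toZFSet_mem η
    rcases le_or_gt η δ.ord with hle | hlt
    · have h0η := Ordinal.toZFSet_mem_toZFSet_iff.2 h0
      have h0N := hN.toZFSet_mem 0
      obtain ⟨z, hz⟩ : ∃ z, z = (0 : Ordinal.{u}).toZFSet := ⟨_, rfl⟩
      rw [← hz] at h0η h0N
      classical
      -- The identity on `η`, with default value `0`, which lies in `η` because `0 < η`.
      refine ⟨fun i => if i ∈ η.toZFSet then i else z, ?_, fun i _ => ?_, fun u hu =>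
        ⟨u, Ordinal.toZFSet_monotone hle hu, if_pos hu⟩⟩
      · convert hM.sep_mem (k := 3) (fun e => ∃ i ∈ e.1 0, ∃ u ∈ e.1 1, top e = ZFSet.pair i u ∧
          ((i ∈ e.1 1 ∧ u = i) ∨ (¬ i ∈ e.1 1 ∧ u = e.1 2))) ![δ.ord.toZFSet, η.toZFSet, z]
          (by simp [Fin.forall_fin_succ, hD, hηN, h0N]) (hM.prod_mem hD hηN) using 1
        ext w
        refine Iff.trans ?_ ZFSet.mem_sep.symm
        change _ ↔ w ∈ ZFSet.prod δ.ord.toZFSet η.toZFSet ∧ ∃ i ∈ δ.ord.toZFSet,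
          ∃ u ∈ η.toZFSet, w = ZFSet.pair i u ∧
            ((i ∈ η.toZFSet ∧ u = i) ∨ (¬ i ∈ η.toZFSet ∧ u = z))
        rw [mem_graphOn]
        constructor
        · rintro ⟨i, hi, rfl⟩
          by_cases hiη : i ∈ η.toZFSet
          · rw [if_pos hiη]
            exact ⟨ZFSet.pair_mem_prod.2 ⟨hi, hiη⟩, i, hi, i, hiη, rfl, Or.inl ⟨hiη, rfl⟩⟩
          · rw [if_neg hiη]
            exact ⟨ZFSet.pair_mem_prod.2 ⟨hi, h0η⟩, i, hi, z, h0η, rfl, Or.inr ⟨hiη, rfl⟩⟩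
        · rintro ⟨-, i, hi, u, -, rfl, ⟨hiη, rfl⟩ | ⟨hiη, rfl⟩⟩
          · exact ⟨_, hi, by rw [if_pos hiη]⟩
          · exact ⟨_, hi, by rw [if_neg hiη]⟩
      · dsimp only
        split_ifs with h
        exacts [h, h0η]
    -- Between `δ` and `δ⁺` there is no cardinal of `N`, so `N` has a bijection from some `β < η`
    -- onto `η`, to be composed with the surjection for `β`.
    · have hcard : ¬ IsCardinalIn N η := fun h => hη.not_ge (hsucc.2 ⟨hlt, h⟩)
      unfold IsCardinalIn at hcard
      push Not at hcard
      obtain ⟨β, hβ, f, hf, ⟨hf1, hf2⟩, hf3⟩ := hcard hηN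
      have hβ0 : 0 < β := by
        obtain ⟨a, ha, -⟩ := hf3 _ (Ordinal.toZFSet_mem_toZFSet_iff.2 h0)
        obtain ⟨ha, -⟩ := ZFSet.pair_mem_prod.1 (hf1 ha)
        obtain ⟨γ, hγ, -⟩ := Ordinal.mem_toZFSet_iff.1 ha
        exact zero_le.trans_lt hγ
      obtain ⟨F, hFN, hF1, hF2⟩ := ih β hβ hβ0 (hβ.trans hη)
      choose! H hH hH' using hf2
      have hHf : graphOn H β.toZFSet = f := by
        ext w
        rw [mem_graphOn]
        constructor
        · rintro ⟨b, hb, rfl⟩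
          exact hH b hb
        · intro hw
          obtain ⟨b, hb, c, hc, rfl⟩ := ZFSet.mem_prod.1 (hf1 hw)
          exact ⟨b, hb, by rw [← hH' b hb c hw]⟩
      refine ⟨fun i => H (F i), hM.graphOn_comp_mem hD hFN (hHf ▸ hf) hF1,
        fun i hi => (ZFSet.pair_mem_prod.1 (hf1 (hH _ (hF1 i hi)))).2, fun u hu => ?_⟩
      obtain ⟨a, ha, -⟩ := hf3 u hu
      have haβ := (ZFSet.pair_mem_prod.1 (hf1 ha)).1
      obtain ⟨i, hi, rfl⟩ := hF2 a haβ
      exact ⟨i, hi, (hH' _ haβ u ha).symm⟩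

/-- Transfers a cardinality bound from `V` to `N`: an enumeration of `e` in `N` has length some `η <
δ⁺`, and `δ` maps onto `η` in `N`. -/
theorem exists_surjection_of_card_lt_succ (hN : IsApproxModel δ N) (hsucc : ComputesSucc δ N)
    {e : ZFSet.{u}} (he : e ∈ N) (hne : e.Nonempty) (hcard : e.card < Order.succ δ) :
    ∃ F : ZFSet.{u} → ZFSet.{u}, graphOn F δ.ord.toZFSet ∈ N ∧
      (∀ i ∈ δ.ord.toZFSet, F i ∈ e) ∧ ∀ u ∈ e, ∃ i ∈ δ.ord.toZFSet, F i = u := by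
  obtain ⟨η, H, hinj, hH, hHN⟩ := hN.model.exists_enumeration hN.toZFSet_mem he
  obtain ⟨u, hu⟩ := hne
  obtain ⟨α, hα, -⟩ := (hH u).1 hu
  obtain ⟨F, hFN, hF1, hF2⟩ := hN.exists_surjection_of_lt_succ hsucc
    (zero_le.trans_lt hα) (η := η) (by
      rw [lt_ord, ← Ordinal.card_toZFSet]
      refine (card_le_of_rel (y := e) (fun w z => w = H z.rank) ?_ ?_).trans_lt hcard
      · intro z hz
        obtain ⟨β, hβ, rfl⟩ := Ordinal.mem_toZFSet_iff.1 hz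
        exact ⟨_, (hH _).2 ⟨β, hβ, rfl⟩, by rw [Ordinal.rank_toZFSet]⟩
      · rintro w - z hz z' hz' rfl h
        obtain ⟨β, hβ, rfl⟩ := Ordinal.mem_toZFSet_iff.1 hz
        obtain ⟨γ, hγ, rfl⟩ := Ordinal.mem_toZFSet_iff.1 hz'
        rw [Ordinal.rank_toZFSet, Ordinal.rank_toZFSet] at h
        rw [hinj β hβ γ hγ h])
  refine ⟨_, hN.model.graphOn_comp_mem (hN.toZFSet_mem _) hFN hHN hF1, fun i hi => ?_,
    fun u hu => ?_⟩
  · obtain ⟨β, hβ, h⟩ := Ordinal.mem_toZFSet_iff.1 (hF1 i hi)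
    exact (hH _).2 ⟨β, hβ, by rw [← h, Ordinal.rank_toZFSet]⟩
  · obtain ⟨β, hβ, rfl⟩ := (hH u).1 hu
    obtain ⟨i, hi, h⟩ := hF2 _ (Ordinal.toZFSet_mem_toZFSet_iff.2 hβ)
    exact ⟨i, hi, by rw [h, Ordinal.rank_toZFSet]⟩

/-- Binary relations on `δ` in `N` are coded by subsets of `δ` in `N`. -/
theorem exists_code (hN : IsApproxModel δ N) {P R : ZFSet.{u}} {Γ : ZFSet.{u} → ZFSet.{u}}
    (hP : P = ZFSet.prod δ.ord.toZFSet δ.ord.toZFSet) (hΓ : graphOn Γ P ∈ N)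
    (hΓD : ∀ i ∈ δ.ord.toZFSet, ∀ j ∈ δ.ord.toZFSet, Γ (ZFSet.pair i j) ∈ δ.ord.toZFSet)
    (hinj : ∀ p ∈ P, ∀ q ∈ P, Γ p = Γ q → p = q) (hR : R ∈ N) :
    ∃ r ∈ powersetIn δ N, ∀ i ∈ δ.ord.toZFSet, ∀ j ∈ δ.ord.toZFSet,
      (CodeMem P (graphOn Γ P) r i j ↔ ZFSet.pair i j ∈ R) := by
  have hM := hN.model
  have hD := hN.toZFSet_mem δ.ord
  have hPN : P ∈ N := hP ▸ hM.prod_mem hD hD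
  have hr := hM.sep_mem (k := 3) (fun e => ∃ p ∈ e.1 0, p ∈ e.1 1 ∧ ZFSet.pair p (top e) ∈ e.1 2)
    ![P, R, graphOn Γ P] (by simp [Fin.forall_fin_succ, hPN, hR, hΓ]) hD
  refine ⟨_, mem_powersetIn.2 ⟨ZFSet.sep_subset, hr⟩, fun i hi j hj => ?_⟩
  have hij : ZFSet.pair i j ∈ P := hP ▸ ZFSet.pair_mem_prod.2 ⟨hi, hj⟩
  constructor
  · rintro ⟨_, -, rfl, k, hk, hkr⟩
    obtain ⟨-, q, hq, hqR, hqk⟩ := ZFSet.mem_sep.1 hkr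
    change q ∈ P at hq
    change q ∈ R at hqR
    change ZFSet.pair q k ∈ graphOn Γ P at hqk
    rwa [hinj _ hij q hq ((pair_mem_graphOn.1 hk).2.symm.trans (pair_mem_graphOn.1 hqk).2)]
  · intro h
    have hk := pair_mem_graphOn.2 ⟨hij, (rfl : Γ _ = Γ _)⟩
    exact ⟨_, hij, rfl, _, hk, ZFSet.mem_sep.2 ⟨hΓD i hi j hj, _, hij, h, hk⟩⟩

/-- The chain itself need not be in `N`, but its union is, by approximation. Being a union of `δ`
sets smaller than `δ`, it is enumerated by `δ` in `N`; the relations pulled back along such an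
enumeration are in `N`, so their codes are in `N ∩ 𝒫(δ)`. -/
theorem exists_enumerates (hN : IsApproxModel δ N) (hsucc : ComputesSucc δ N)
    {P θ A h : ZFSet.{u}} {Γ : ZFSet.{u} → ZFSet.{u}} {E : ZFSet.{u} → ZFSet.{u}}
    (hP : P = ZFSet.prod δ.ord.toZFSet δ.ord.toZFSet) (hΓ : graphOn Γ P ∈ N)
    (hΓD : ∀ i ∈ δ.ord.toZFSet, ∀ j ∈ δ.ord.toZFSet, Γ (ZFSet.pair i j) ∈ δ.ord.toZFSet)
    (hinj : ∀ p ∈ P, ∀ q ∈ P, Γ p = Γ q → p = q) (hA : A ∈ N)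
    (hE : ∀ i ∈ δ.ord.toZFSet, E i ∈ N ∧ E i ⊆ θ ∧ (E i).Nonempty ∧ (E i).card < δ)
    (hmono : ∀ i ∈ δ.ord.toZFSet, ∀ j ∈ δ.ord.toZFSet, i ∈ j → E i ⊆ E j)
    (hh : ∀ i ∈ δ.ord.toZFSet, ∀ y, ZFSet.pair i y ∈ h ↔ y = E i) :
    ∃ g ∈ (ZFSet.prod δ.ord.toZFSet θ).powerset,
      Enumerates (powersetIn δ N) δ.ord.toZFSet P (graphOn Γ P) θ A h g := by
  have hM := hN.model
  have hD := hN.toZFSet_mem δ.ord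
  have hmem : ∀ i : Set.Iio δ.ord, i.1.toZFSet ∈ δ.ord.toZFSet := fun i =>
    Ordinal.toZFSet_mem_toZFSet_iff.2 i.2
  have heN := hN.app δ hN.reg.cof_ord.ge (fun i => E i.1.toZFSet) (fun i => (hE _ (hmem i)).1)
    (fun i j hij => by
      obtain rfl | hij := hij.eq_or_lt
      · exact fun _ h => h
      · exact hmono _ (hmem i) _ (hmem j) (Ordinal.toZFSet_mem_toZFSet_iff.2 hij))
  obtain ⟨e, he⟩ : ∃ e, e = ZFSet.iUnion fun i : Set.Iio δ.ord => E i.1.toZFSet := ⟨_, rfl⟩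
  rw [← he] at heN
  have hemem : ∀ u, u ∈ e ↔ ∃ i ∈ δ.ord.toZFSet, u ∈ E i := by
    intro u
    rw [he, ZFSet.mem_iUnion]
    constructor
    · rintro ⟨i, hi⟩
      exact ⟨_, hmem i, hi⟩
    · rintro ⟨i, hi, hu⟩
      obtain ⟨i, hi', rfl⟩ := Ordinal.mem_toZFSet_iff.1 hi
      exact ⟨⟨i, hi'⟩, hu⟩
  have h0 : (0 : Ordinal.{u}).toZFSet ∈ δ.ord.toZFSet :=
    Ordinal.toZFSet_mem_toZFSet_iff.2 (ord_pos.2 hN.reg.pos)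
  obtain ⟨F, hFN, hF1, hF2⟩ := hN.exists_surjection_of_card_lt_succ hsucc heN
    (by
      obtain ⟨u, hu⟩ := (hE _ h0).2.2.1
      exact ⟨u, (hemem u).2 ⟨_, h0, hu⟩⟩)
    (card_lt_of_cover (isRegular_succ hN.reg.aleph0_le) (y := δ.ord.toZFSet) E
      (by rw [Ordinal.card_toZFSet, card_ord]; exact Order.lt_succ δ)
      (fun i hi => (hE i hi).2.2.2.trans (Order.lt_succ δ)) fun u hu => (hemem u).1 hu)
  have hFθ : ∀ i ∈ δ.ord.toZFSet, F i ∈ θ := by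
    intro i hi
    obtain ⟨j, hj, hu⟩ := (hemem _).1 (hF1 i hi)
    exact (hE j hj).2.1 hu
  have hg : ∀ i ∈ δ.ord.toZFSet, ∀ u, ZFSet.pair i u ∈ graphOn F δ.ord.toZFSet ↔ u = F i :=
    fun i hi u => by rw [pair_mem_graphOn, and_iff_right hi]
  have hR₁ := hM.sep_mem (k := 2) (fun e => ∃ i ∈ e.1 0, ∃ j ∈ e.1 0, top e = ZFSet.pair i j ∧
    ∃ u, ZFSet.pair i u ∈ e.1 1 ∧ ∃ v, ZFSet.pair j v ∈ e.1 1 ∧ u ∈ v)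
    ![δ.ord.toZFSet, graphOn F δ.ord.toZFSet]
    (by simp [Fin.forall_fin_succ, hD, hFN]) (hM.prod_mem hD hD)
  have hR₂ := hM.sep_mem (k := 3) (fun e => ∃ i ∈ e.1 0, ∃ j ∈ e.1 0, top e = ZFSet.pair i j ∧
    ∃ u, ZFSet.pair i u ∈ e.1 1 ∧ ∃ v, ZFSet.pair j v ∈ e.1 1 ∧ ZFSet.pair u v ∈ e.1 2)
    ![δ.ord.toZFSet, graphOn F δ.ord.toZFSet, A]
    (by simp [Fin.forall_fin_succ, hD, hFN, hA]) (hM.prod_mem hD hD)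
  obtain ⟨r, hr, hr'⟩ := hN.exists_code hP hΓ hΓD hinj hR₁
  obtain ⟨c, hc, hc'⟩ := hN.exists_code hP hΓ hΓD hinj hR₂
  refine ⟨graphOn F δ.ord.toZFSet, ?_, fun i hi => ⟨F i, hFθ i hi, (hg i hi _).2 rfl,
    fun u => (hg i hi u).1⟩, fun i hi u hu => ?_, fun j hj E' hE' u hu => ?_, r, hr, c, hc,
    fun i hi j hj u hu v hv => ?_⟩
  · rw [ZFSet.mem_powerset]
    intro w hw
    obtain ⟨i, hi, rfl⟩ := mem_graphOn.1 hw
    exact ZFSet.pair_mem_prod.2 ⟨hi, hFθ i hi⟩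
  · obtain ⟨j, hj, hu'⟩ := (hemem _).1 (hF1 i hi)
    exact ⟨j, hj, E j, (hh j hj _).2 rfl, by rwa [(hg i hi u).1 hu]⟩
  · rw [(hh j hj _).1 hE'] at hu
    obtain ⟨i, hi, rfl⟩ := hF2 u ((hemem u).2 ⟨j, hj, hu⟩)
    exact ⟨i, hi, (hg i hi _).2 rfl⟩
  · rw [hr' i hi j hj, hc' i hi j hj, (hg i hi u).1 hu, (hg j hj v).1 hv, ZFSet.mem_sep,
      ZFSet.mem_sep, and_iff_right (ZFSet.pair_mem_prod.2 ⟨hi, hj⟩),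
      and_iff_right (ZFSet.pair_mem_prod.2 ⟨hi, hj⟩)]
    constructor
    · constructor
      · rintro ⟨i', hi', j', hj', h, u, hu, v, hv, huv⟩
        obtain ⟨rfl, rfl⟩ := ZFSet.pair_inj.1 h
        rwa [← (hg _ hi u).1 hu, ← (hg _ hj v).1 hv]
      · exact fun h => ⟨i, hi, j, hj, rfl, _, (hg i hi _).2 rfl, _, (hg j hj _).2 rfl, h⟩
    · constructor
      · rintro ⟨i', hi', j', hj', h, u, hu, v, hv, huv⟩
        obtain ⟨rfl, rfl⟩ := ZFSet.pair_inj.1 h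
        rw [← (hg _ hi u).1 hu, ← (hg _ hj v).1 hv]
        exact huv
      · exact fun h => ⟨i, hi, j, hj, rfl, _, (hg i hi _).2 rfl, _, (hg j hj _).2 rfl, h⟩

theorem certified_of_mem (hN : IsApproxModel δ N) (hsucc : ComputesSucc δ N) {x : ZFSet.{u}}
    (hx : x ∈ N) : Certified x (powersetIn δ N) := by
  have hM := hN.model
  have hD := hN.toZFSet_mem δ.ord
  obtain ⟨t, ht, htt, hxt⟩ := hM.exists_isTransitive hx
  obtain ⟨θ₀, F₀, -, hF₀, hfN⟩ := hM.exists_enumeration hN.toZFSet_mem ht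
  obtain ⟨F, hF⟩ : ∃ F : ZFSet.{u} → ZFSet.{u}, F = fun a => F₀ a.rank := ⟨_, rfl⟩
  obtain ⟨θ, hθ⟩ : ∃ θ, θ = θ₀.toZFSet := ⟨_, rfl⟩
  rw [← hF, ← hθ] at hfN
  have hFt : ∀ z, z ∈ t ↔ ∃ a ∈ θ, F a = z := by
    intro z
    rw [hF₀, hθ, hF]
    constructor
    · rintro ⟨α, hα, rfl⟩
      exact ⟨_, Ordinal.toZFSet_mem_toZFSet_iff.2 hα, by simp only [Ordinal.rank_toZFSet]⟩
    · rintro ⟨a, ha, rfl⟩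
      obtain ⟨α, hα, rfl⟩ := Ordinal.mem_toZFSet_iff.1 ha
      exact ⟨α, hα, by simp only [Ordinal.rank_toZFSet]⟩
  have hθN : θ ∈ N := hθ ▸ hN.toZFSet_mem θ₀
  have hAN := hM.sep_mem (k := 2) (fun e => ∃ a ∈ e.1 0, ∃ b ∈ e.1 0, top e = ZFSet.pair a b ∧
    ∃ u, ZFSet.pair a u ∈ e.1 1 ∧ ∃ v, ZFSet.pair b v ∈ e.1 1 ∧ u ∈ v)
    ![θ, graphOn F θ] (by simp [Fin.forall_fin_succ, hθN, hfN]) (hM.prod_mem hθN hθN)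
  obtain ⟨A, hA⟩ : ∃ A, A = ZFSet.sep (fun w => ∃ a ∈ θ, ∃ b ∈ θ, w = ZFSet.pair a b ∧
    ∃ u, ZFSet.pair a u ∈ graphOn F θ ∧ ∃ v, ZFSet.pair b v ∈ graphOn F θ ∧ u ∈ v)
    (ZFSet.prod θ θ) := ⟨_, rfl⟩
  replace hAN : A ∈ N := hA ▸ hAN
  have hAmem : ∀ a ∈ θ, ∀ b ∈ θ, ZFSet.pair a b ∈ A ↔ F a ∈ F b := by
    intro a ha b hb
    rw [hA, ZFSet.mem_sep, and_iff_right (ZFSet.pair_mem_prod.2 ⟨ha, hb⟩)]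
    constructor
    · rintro ⟨a', -, b', -, h, u, hu, v, hv, huv⟩
      obtain ⟨rfl, rfl⟩ := ZFSet.pair_inj.1 h
      rwa [← (pair_mem_graphOn.1 hu).2, ← (pair_mem_graphOn.1 hv).2]
    · exact fun h => ⟨a, ha, b, hb, rfl, _, pair_mem_graphOn.2 ⟨ha, rfl⟩, _,
        pair_mem_graphOn.2 ⟨hb, rfl⟩, h⟩
  obtain ⟨P, hP⟩ : ∃ P, P = ZFSet.prod δ.ord.toZFSet δ.ord.toZFSet := ⟨_, rfl⟩
  obtain ⟨Γ, hΓD, hΓinj, hΓ⟩ := exists_godel_collapse hN.reg.aleph0_le (D := δ.ord.toZFSet) rfl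
  rw [← hP] at hΓinj hΓ
  have hPN : P ∈ N := hP ▸ hM.prod_mem hD hD
  have hΓN : graphOn Γ P ∈ N := hM.graphOn_mem_of_collapse hPN (hM.godelRel_mem hD) hΓ
  obtain ⟨S, hS⟩ : ∃ S, S = ZFSet.sep (fun E => E ∈ N ∧ E.Nonempty ∧ E.card < δ) θ.powerset :=
    ⟨_, rfl⟩
  have hSmem : ∀ E, E ∈ S ↔ E ∈ N ∧ E ⊆ θ ∧ E.Nonempty ∧ E.card < δ := by
    intro E
    rw [hS, ZFSet.mem_sep, ZFSet.mem_powerset]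
    tauto
  obtain ⟨α, hα, hαx⟩ := (hFt x).1 hxt
  -- The bound for the enumerations `g` is the full power set of `δ × θ` in `V`, so it does not
  -- depend on `h`.
  refine ⟨δ.ord.toZFSet, P, godelRel δ.ord.toZFSet, graphOn Γ P, θ, A, graphOn F θ, S,
    (ZFSet.prod δ.ord.toZFSet θ).powerset, fun h => ⟨⟨mem_powersetIn.2 ⟨fun _ h => h, hD⟩,
    fun y hy => (mem_powersetIn.1 hy).1⟩, ⟨hP, rfl⟩, isCollapse_graphOn hΓ,
    ⟨hθ ▸ ZFSet.isOrdinal_toZFSet θ₀, isCollapse_graphOn fun b hb z => ?_, α, hα,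
      pair_mem_graphOn.2 ⟨hα, hαx.symm⟩⟩, ?_, ?_, ?_⟩⟩
  · constructor
    · intro hz
      obtain ⟨a, ha, rfl⟩ := (hFt z).1 (htt _ ((hFt _).2 ⟨b, hb, rfl⟩) hz)
      exact ⟨a, ha, (hAmem a ha b hb).2 hz, rfl⟩
    · rintro ⟨a, ha, hab, rfl⟩
      exact (hAmem a ha b hb).1 hab
  · intro E hE
    obtain ⟨-, hEθ, ⟨u, hu⟩, hEc⟩ := (hSmem E).1 hE
    refine ⟨hEθ, ⟨u, hu, trivial⟩, fun hcon => hEc.not_ge ?_⟩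
    rw [← card_ord δ, ← Ordinal.card_toZFSet]
    refine card_le_of_rel (fun z y => ZFSet.pair z y ∈ h ∧ ∀ y', ZFSet.pair z y' ∈ h → y' = y)
      hcon ?_
    rintro w - z - z' - ⟨-, h1⟩ ⟨h2, -⟩
    exact (h1 z' h2).symm
  · intro β hβ hβh
    obtain ⟨β, hβδ, rfl⟩ := Ordinal.mem_toZFSet_iff.1 hβ
    let σ := ZFSet.sep (fun u => ∃ i ∈ β.toZFSet, ZFSet.pair i u ∈ h) θ
    have hσ : σ.card < δ := by
      refine (card_le_of_rel (y := β.toZFSet) (fun i u => ZFSet.pair i u ∈ h) (fun u hu =>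
        (ZFSet.mem_sep.1 hu).2) ?_).trans_lt (by rwa [Ordinal.card_toZFSet, ← lt_ord])
      intro i hi u _ u' _ hu hu'
      exact (hβh i hi u' hu').2 u hu
    -- Adding `α` makes the cover nonempty, as members of `S` must be: the union of a chain can be
    -- enumerated by `δ` only if it is nonempty.
    obtain ⟨τ, hτ, hτc, hστ, hτθ⟩ := hN.exists_cover hθN (σ := insert α σ)
      (fun u hu => by
        obtain rfl | hu := ZFSet.mem_insert_iff.1 hu
        exacts [hα, (ZFSet.mem_sep.1 hu).1])
      (ZFSet.card_insert_le.trans_lt (add_lt_of_lt hN.reg.aleph0_le hσ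
        (one_lt_aleph0.trans_le hN.reg.aleph0_le)))
    refine ⟨τ, (hSmem τ).2 ⟨hτ, hτθ, ⟨α, hστ (ZFSet.mem_insert _ _)⟩, hτc⟩, fun i hi u hu => ?_⟩
    exact hστ (ZFSet.mem_insert_of_mem _ (ZFSet.mem_sep.2 ⟨(hβh i hi u hu).1, i, hi, hu⟩))
  · rintro ⟨hmap, hinc⟩
    obtain ⟨E, hES, hE⟩ := exists_function hmap
    exact hN.exists_enumerates hsucc hP hΓN hΓD hΓinj hAN (fun i hi => (hSmem _).1 (hES i hi))
      (fun i hi j hj hij => hinc i hi j hj hij _ ((hE i hi _).2 rfl) _ ((hE j hj _).2 rfl)) hE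

theorem mem_iff_certified (hN : IsApproxModel δ N) (hsucc : ComputesSucc δ N) (x : ZFSet.{u}) :
    x ∈ N ↔ Certified x (powersetIn δ N) :=
  ⟨hN.certified_of_mem hsucc, hN.mem_of_certified⟩

end IsApproxModel

end HLW

theorem mainTheorem11 :
    (∀ δ : Cardinal.{u}, δ.IsRegular → Cardinal.aleph0 < δ →
      ∀ M N : Set ZFSet.{u},
        HLW.IsTransitiveModel M → HLW.Covering δ M → HLW.Approximation δ M →
        HLW.ComputesSucc δ M →
        HLW.IsTransitiveModel N → HLW.Covering δ N → HLW.Approximation δ N →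
        HLW.ComputesSucc δ N →
        HLW.powersetIn δ N = HLW.powersetIn δ M →
        M = N) ∧
    ∃ φ : HLW.setLang.Formula (Fin 2), HLW.IsSigma2 φ ∧
      ∀ δ : Cardinal.{u}, δ.IsRegular → Cardinal.aleph0 < δ →
        ∀ N : Set ZFSet.{u},
          HLW.IsTransitiveModel N → HLW.Covering δ N → HLW.Approximation δ N →
          HLW.ComputesSucc δ N →
          ∀ x : ZFSet.{u}, x ∈ N ↔ φ.Realize ![x, HLW.powersetIn δ N] := by
  obtain ⟨φ, hφ, hφ'⟩ := HLW.exists_formula.{u}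
  have key := fun (δ : Cardinal.{u}) hδ N hN hc ha hs x =>
    HLW.IsApproxModel.mem_iff_certified (δ := δ) (N := N) ⟨hδ, hN, hc, ha⟩ hs x
  refine ⟨fun δ hδ _ M N hM hcM haM hsM hN hcN haN hsN h => Set.ext fun x => ?_,
    φ, hφ, fun δ hδ _ N hN hc ha hs x => ?_⟩
  · rw [key δ hδ M hM hcM haM hsM, key δ hδ N hN hcN haN hsN, h]
  · rw [key δ hδ N hN hc ha hs, hφ']
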